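/- Setting. Let $V$ and $W$ be two distinct lines through $0$ in $\mathbb{R}^2$, neither of them parallel to a coordinate axis, and let $Y$ be the vertical coordinate axis, identified with $\mathbb{R}$. Let $\Pi_V$ be the projection to $V$ parallel to $W$ and $\Pi_Y$ the projection to $Y$ parallel to $V$. A window is a half-open interval $\Omega\subset Y$ of positive length (of the form $[a,b)$ or $(a,b]$); it is singular if one of its endpoints lies in $\Pi_Y(\mathbb{Z}^2)$. The projection tiling $T_\Omega$ of the line $V$ has the vertex set $\Pi_V(\mathbb{Z}^2\cap(V+\Omega))$. Two tilings are locally isomorphic if every finite patch of either one occurs, up to translation, in the other. A substitution rule $\sigma$ consists of finitely many labelled prototiles (intervals of positive length; different labels may have the same length), a factor $\lambda>1$, and for each prototile a finite sequence of prototiles that exactly covers the prototile inflated by $\lambda$. It acts on labelled tilings by inflating by $\lambda$ (about $0$) and replacing each inflated tile. A labelled tiling $\mathcal{T}$ is a substitution tiling for $\sigma$ if for every $n\in\mathbb{N}$ there is a labelled tiling $\mathcal{T}'$, locally isomorphic to $\mathcal{T}$ as a labelled tiling, with $\sigma^n\mathcal{T}'=\mathcal{T}$. A tiling without labels admits $\sigma$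 if it can be labelled (tiles with the same label having the same length) so as to become a substitution tiling for $\sigma$. For windows $\Omega,\Omega'$ we say that $\sigma$, with such a labelling $\mathcal{T}$ of $T_\Omega$, maps $T_\Omega$ to $T_{\Omega'}$ if $\sigma\mathcal{T}$ without its labels is $T_{\Omega'}$. For $M\in GL(2,\mathbb{Z})$, $\lambda>1$ and windows $\Omega,\Omega'$ consider the conditions (i) $|\Omega'|=|\Omega|$; (ii) $M(\Omega+V)\subset\Omega'+V$; (iii) the length of each connected component of $\Omega'\setminus\Pi_Y M(\Omega)$ is in $\mathbb{Q}(\lambda)$. A matrix is called primitive here if some power of it has no zero entry. Theorem. Let $V,W$ be as above and let $\Omega$ be a window. (1) Let $M\in GL(2,\mathbb{Z})$ be primitive, with $V$ its eigenspace for an eigenvalue $\lambda>1$ and $W$ its eigenspace for an eigenvalue of absolute value less than $1$. Let $\Omega'$ be a window that satisfies (i), (ii) and (iii); if $\Omega$ and $\Omega'$ are both singular, suppose also that $\Omega'$ contains its lower endpoint if and only if $\Pi_Y M(\Omega)$ contains its lower endpoint. Then $T_{\Omega'}$ is locally isomorphic to $T_\Omega$, and there are a substitution rule $\sigma$ with factor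 $\lambda$ and a labelling of $T_\Omega$ that makes it a substitution tiling for $\sigma$, such that $\sigma$ maps $T_\Omega$ to $T_{\Omega'}$. (2) Conversely, suppose that $T_\Omega$ is nonperiodic (only the trivial translation maps it to itself), and let $\sigma$ be a substitution rule with factor $\lambda$ and $\mathcal{T}$ a labelling of $T_\Omega$ that is a substitution tiling for $\sigma$. Then there are a primitive $M\in GL(2,\mathbb{Z})$, with $V$ its eigenspace for the eigenvalue $\lambda$ and $W$ its eigenspace for an eigenvalue of absolute value less than $1$, a window $\Omega_0$ with the same endpoints as $\Omega$ and with $T_{\Omega_0}=T_\Omega$, and a window $\Omega'$, such that (i), (ii) and (iii) hold for $\Omega_0$ and $\Omega'$, the tiling $T_{\Omega'}$ is locally isomorphic to $T_\Omega$, and $\sigma\mathcal{T}$ without its labels is $T_{\Omega'}$. -/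

import Mathlib

/-! ### Lines, projections and windows in the plane

The plane is `Fin 2 → ℝ`.  The line `V` is spanned by `v`, the line `W` by `w`, and `Y` is the
vertical coordinate axis, whose points are written `![0, y]` and identified with `y : ℝ`.
The line `V` is identified with `ℝ` through `c ↦ c • v`. -/

/-- The coordinate along `v` of the projection of `z` to `V = ℝ v` parallel to `W = ℝ w`. -/
noncomputable def projV (v w z : Fin 2 → ℝ) : ℝ :=
  (z 0 * w 1 - z 1 * w 0) / (v 0 * w 1 - v 1 * w 0)

/-- The projection of `z` to the vertical axis `Y` parallel to `V = ℝ v`. -/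
noncomputable def projY (v z : Fin 2 → ℝ) : ℝ :=
  z 1 - z 0 / v 0 * v 1

/-- The defining property of `projV`: the difference of `z` and its projection lies in `W`. -/
theorem sub_projV_mem (v w z : Fin 2 → ℝ) (h : v 0 * w 1 - v 1 * w 0 ≠ 0) :
    ∃ c : ℝ, z - projV v w z • v = c • w := by
  refine ⟨(v 0 * z 1 - v 1 * z 0) / (v 0 * w 1 - v 1 * w 0), ?_⟩
  have key : ∀ i, z i * (v 0 * w 1 - v 1 * w 0) - (z 0 * w 1 - z 1 * w 0) * v i
      = (v 0 * z 1 - v 1 * z 0) * w i := by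
    intro i
    fin_cases i <;> simp <;> ring
  ext i
  have hk := key i
  simp only [projV, Pi.sub_apply, Pi.smul_apply, smul_eq_mul]
  rw [div_mul_eq_mul_div, div_mul_eq_mul_div, eq_div_iff h, sub_mul, div_mul_cancel₀ _ h]
  exact hk

/-- The defining property of `projY`: the difference of `z` and its projection lies in `V`. -/
theorem sub_projY_mem (v z : Fin 2 → ℝ) (h : v 0 ≠ 0) :
    ∃ c : ℝ, z - ![0, projY v z] = c • v := by
  refine ⟨z 0 / v 0, ?_⟩
  ext i
  fin_cases i
  · simp [projY, h]
  · simp [projY]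

/-- A point of the integer lattice, as a point of the plane. -/
def latticePt (z : Fin 2 → ℤ) : Fin 2 → ℝ := fun i => (z i : ℝ)

/-- A half-open interval of positive length: `[lo, hi)` if `leftClosed`, otherwise `(lo, hi]`. -/
structure Window where
  lo : ℝ
  hi : ℝ
  lo_lt_hi : lo < hi
  leftClosed : Bool

namespace Window

/-- The underlying set of a half-open interval. -/
def carrier (Ω : Window) : Set ℝ :=
  if Ω.leftClosed then Set.Ico Ω.lo Ω.hi else Set.Ioc Ω.lo Ω.hi

/-- The length of a half-open interval. -/
def length (Ω : Window) : ℝ := Ω.hi - Ω.lo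

/-- A window is singular if one of its endpoints is the projection to `Y` of a lattice point. -/
def IsSingular (v : Fin 2 → ℝ) (Ω : Window) : Prop :=
  ∃ z : Fin 2 → ℤ, projY v (latticePt z) = Ω.lo ∨ projY v (latticePt z) = Ω.hi

end Window

/-- The strip `Ω + V`, for a subset `Ω` of `Y`. -/
def strip (v : Fin 2 → ℝ) (Ω : Set ℝ) : Set (Fin 2 → ℝ) :=
  {z | ∃ y ∈ Ω, ∃ c : ℝ, z = ![0, y] + c • v}

theorem mem_strip_iff (v z : Fin 2 → ℝ) (Ω : Set ℝ) (h : v 0 ≠ 0) :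
    z ∈ strip v Ω ↔ projY v z ∈ Ω := by
  constructor
  · rintro ⟨y, hy, c, rfl⟩
    have : projY v (![0, y] + c • v) = y := by
      simp [projY]
      field_simp
      ring
    rwa [this]
  · intro hz
    obtain ⟨c, hc⟩ := sub_projY_mem v z h
    exact ⟨_, hz, c, by rw [← hc, add_sub_cancel]⟩

/-! ### Tilings of the line

A collection of tiles is a set of pairs `(x, a)`, where `x` is the left endpoint of the tile and
`a` is its label.  For tilings without labels, `a` is the length of the tile. -/

/-- The unlabelled tiles cut out by a set of vertices: `(x, ℓ)` stands for the interval
`[x, x + ℓ]` between two consecutive vertices. -/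
def tilesOf (A : Set ℝ) : Set (ℝ × ℝ) :=
  {p | 0 < p.2 ∧ p.1 ∈ A ∧ p.1 + p.2 ∈ A ∧ ∀ y ∈ A, ¬ (p.1 < y ∧ y < p.1 + p.2)}

/-- The vertices `Π_V (ℤ² ∩ (V + Ω))`. -/
def projVertices (v w : Fin 2 → ℝ) (Ω : Window) : Set ℝ :=
  {x | ∃ z : Fin 2 → ℤ, latticePt z ∈ strip v Ω.carrier ∧ projV v w (latticePt z) = x}

/-- The projection tiling with tiling space `ℝ v`, window space `ℝ w` and window `Ω`. -/
def projTiling (v w : Fin 2 → ℝ) (Ω : Window) : Set (ℝ × ℝ) :=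
  tilesOf (projVertices v w Ω)

/-- Translation of a collection of tiles. -/
def translateTiles {α : Type} (t : ℝ) (S : Set (ℝ × α)) : Set (ℝ × α) :=
  (fun p => (p.1 + t, p.2)) '' S

/-- Only the trivial translation maps the tiling to itself. -/
def IsNonperiodic {α : Type} (S : Set (ℝ × α)) : Prop :=
  ∀ t : ℝ, translateTiles t S = S → t = 0

/-- Local isomorphism: every finite patch of one tiling occurs, up to a translation,
in the other one. -/
def LocallyIsomorphic {α : Type} (S S' : Set (ℝ × α)) : Prop :=
  (∀ P ⊆ S, P.Finite → ∃ t : ℝ, translateTiles t P ⊆ S') ∧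
  (∀ P ⊆ S', P.Finite → ∃ t : ℝ, translateTiles t P ⊆ S)

/-- The tiles with the given lengths cover the line and overlap at most in endpoints. -/
def IsTiling {α : Type} (len : α → ℝ) (S : Set (ℝ × α)) : Prop :=
  ∀ x : ℝ, ∃! p : ℝ × α, p ∈ S ∧ p.1 ≤ x ∧ x < p.1 + len p.2

/-! ### Substitution rules -/

/-- A (vertex hierarchic) substitution rule on labelled prototiles: the prototile `a` is an interval
of length `len a`; it is inflated by `factor > 1` and then replaced by the tiles `word a`, listed
from left to right, which cover the inflated tile exactly. -/
structure SubstitutionRule (L : Type) where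
  len : L → ℝ
  len_pos : ∀ a, 0 < len a
  factor : ℝ
  one_lt_factor : 1 < factor
  word : L → List L
  word_len : ∀ a, ((word a).map len).sum = factor * len a

namespace SubstitutionRule

variable {L : Type}

/-- The image of a collection of labelled tiles under the substitution rule. -/
def subst (σ : SubstitutionRule L) (S : Set (ℝ × L)) : Set (ℝ × L) :=
  {q | ∃ p ∈ S, ∃ (i : ℕ) (h : i < (σ.word p.2).length),
    q = (σ.factor * p.1 + (((σ.word p.2).take i).map σ.len).sum, (σ.word p.2)[i])}

/-- Forget the labels and keep the geometric tiles. -/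
def shape (σ : SubstitutionRule L) (S : Set (ℝ × L)) : Set (ℝ × ℝ) :=
  (fun p => (p.1, σ.len p.2)) '' S

/-- A labelled tiling is a substitution tiling for `σ` if for every `n` it is the image under `σ ^ n`
of a locally isomorphic labelled tiling. -/
def IsSubstitutionTiling (σ : SubstitutionRule L) (S : Set (ℝ × L)) : Prop :=
  IsTiling σ.len S ∧
  ∀ n : ℕ, ∃ S' : Set (ℝ × L),
    IsTiling σ.len S' ∧ LocallyIsomorphic S S' ∧ σ.subst^[n] S' = S

end SubstitutionRule

/-! ### The matrix and the conditions on the windows -/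

/-- The linear action of an integer matrix on the plane. -/
def actOn (M : Matrix.GeneralLinearGroup (Fin 2) ℤ) (z : Fin 2 → ℝ) : Fin 2 → ℝ :=
  ((M : Matrix (Fin 2) (Fin 2) ℤ).map (fun k : ℤ => (k : ℝ))).mulVec z

/-- Some power of the matrix has no zero entry. -/
def IsPrimitiveMatrix (M : Matrix.GeneralLinearGroup (Fin 2) ℤ) : Prop :=
  ∃ n : ℕ, ∀ i j, ((M : Matrix (Fin 2) (Fin 2) ℤ) ^ n) i j ≠ 0

/-- `ℝ v` is the expanding eigenspace of `M`, with eigenvalue `lam > 1`, and `ℝ w` is the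
contracting eigenspace. -/
def HasEigenlines (M : Matrix.GeneralLinearGroup (Fin 2) ℤ) (v w : Fin 2 → ℝ) (lam : ℝ) : Prop :=
  1 < lam ∧ actOn M v = lam • v ∧ ∃ ν : ℝ, |ν| < 1 ∧ actOn M w = ν • w

/-- The subset `Π_Y M(Ω)` of `Y`. -/
def subwindow (v : Fin 2 → ℝ) (M : Matrix.GeneralLinearGroup (Fin 2) ℤ) (Ω : Window) : Set ℝ :=
  (fun y => projY v (actOn M ![0, y])) '' Ω.carrier

/-- The conditions on a window pair: equal lengths, `M(Ω + V) ⊆ Ω' + V`, and every connected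
component of `Ω' \ Π_Y M(Ω)` has its length in the field `ℚ(lam)`. -/
structure IsWindowPair (v : Fin 2 → ℝ) (M : Matrix.GeneralLinearGroup (Fin 2) ℤ) (lam : ℝ)
    (Ω Ω' : Window) : Prop where
  length_eq : Ω'.length = Ω.length
  image_subset : actOn M '' strip v Ω.carrier ⊆ strip v Ω'.carrier
  component_length : ∀ y ∈ Ω'.carrier \ subwindow v M Ω,
    (MeasureTheory.volume (connectedComponentIn (Ω'.carrier \ subwindow v M Ω) y)).toReal ∈
      IntermediateField.adjoin ℚ {lam}

/-- The half-open intervals `Ω'` and `Π_Y M(Ω)` contain the endpoint on the same side. -/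
def SameSide (v : Fin 2 → ℝ) (M : Matrix.GeneralLinearGroup (Fin 2) ℤ) (Ω Ω' : Window) : Prop :=
  (∃ y, IsLeast Ω'.carrier y) ↔ (∃ y, IsLeast (subwindow v M Ω) y)

/-! A lattice point z has a tiling coordinate x(z) along V and an internal coordinate y(z) in Y, and
it gives a vertex exactly when y(z) lies in the window. A matrix with eigenlines V and W multiplies
x by lam and y by ν, with 0 < |ν| < 1. Inflating the vertices by lam therefore contracts the window
by ν, and substitution has to fill up the contracted window to a window of the old length.

From windows to rules: a tile is labelled by the cell of the position u = y(z) - lo of its left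
vertex, where the window is partitioned by a finite set D of cut points. Inflation acts on positions
by u ↦ ν u + c with c = ν lo - lo'. The subdivision of an inflated tile depends on the cell alone if
D contains the window ends shifted by short lattice vectors and is closed under the preimages (d - c
- y m)/ν with m short. Condition (iii) says that c and the length l lie in ℚ(lam), hence are
y-values of lattice points divided by some N. So D can consist of the d with N d = y(z), |x z| ≤ R:
taking preimages divides x by lam, so a large R is stable, and discreteness of the lattice makes D
finite (`IsCutProject.exists_inflation`, `Inflation.subst_tiling`). All windows of length l give
locally isomorphic labelled tilings because y has dense image.

From rules to windows: nonperiodicity makes y injective, and together with the inflation it makes x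
injective (`x_injective_of_inflation`). Each image of the tiling under a power of the rule looks
locally like the tiling, so it comes from a window Ω n of the same length (`exists_window`).
Differences of inflated vertices are projected lattice points, which gives M on ℤ²; the boundedness
of the strip gives y ∘ M = ν y with |ν| < 1.

The heart is a finiteness argument. A cut is a position in Ω 0 at which the n-th image of a patch
changes, for any n. Cuts separate patches, and there are only finitely many patches of a given
radius, so there are finitely many cuts for all n together (`finite_cuts`). Every end of every Ω n,
pulled back by ν^n, is a cut modulo the lattice (`exists_radius`). The pigeonhole principle then
yields algebraic relations: M is onto, and offset and length lie in ℚ(lam). The closed sides of the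
half-open windows need a separate argument when lattice points sit on the ends of both windows: a
mismatch would give a patch that occurs only once, the image would be a translate of the tiling, and
its window a translate of the window, which excludes the mismatch (`not_mismatch`). -/

/-! ### Labelled tilings of the line -/

section Tilings

variable {L : Type} {len : L → ℝ}

namespace IsTiling

theorem exists_tile {S : Set (ℝ × L)} (hS : IsTiling len S) (x : ℝ) :
    ∃ p ∈ S, p.1 ≤ x ∧ x < p.1 + len p.2 := by
  obtain ⟨p, hp, -⟩ := hS x
  exact ⟨p, hp.1, hp.2⟩

theorem eq_of_mem_tile {S : Set (ℝ × L)} (hS : IsTiling len S) {p q : ℝ × L} (hp : p ∈ S)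
    (hq : q ∈ S) {x : ℝ} (h1 : p.1 ≤ x) (h2 : x < p.1 + len p.2) (h3 : q.1 ≤ x)
    (h4 : x < q.1 + len q.2) : p = q :=
  (hS x).unique ⟨hp, h1, h2⟩ ⟨hq, h3, h4⟩

/-- No tile starts in the interior of another tile. -/
theorem not_mem_interior {S : Set (ℝ × L)} (hS : IsTiling len S) (hlen : ∀ a, 0 < len a)
    {p q : ℝ × L} (hp : p ∈ S) (hq : q ∈ S) (h1 : p.1 < q.1) (h2 : q.1 < p.1 + len p.2) :
    False := by
  have := hS.eq_of_mem_tile hp hq h1.le h2 le_rfl (by linarith [hlen q.2])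
  rw [this] at h1
  exact lt_irrefl _ h1

/-- The right endpoint of a tile is the left endpoint of the next one. -/
theorem exists_next {S : Set (ℝ × L)} (hS : IsTiling len S) (hlen : ∀ a, 0 < len a)
    {p : ℝ × L} (hp : p ∈ S) : ∃ q ∈ S, q.1 = p.1 + len p.2 := by
  obtain ⟨q, hq, h1, h2⟩ := hS.exists_tile (p.1 + len p.2)
  refine ⟨q, hq, le_antisymm h1 ?_⟩
  by_contra! h
  rcases le_or_gt p.1 q.1 with h3 | h3
  · have := hS.eq_of_mem_tile hp hq (x := q.1) h3 h le_rfl (by linarith [hlen q.2])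
    rw [this] at h2
    exact lt_irrefl _ h2
  · exact hS.not_mem_interior hlen hq hp h3 (by linarith [hlen p.2])

/-- The unlabelled tiling is thus determined by its vertices, which allows the later arguments to
speak of vertex sets only. -/
theorem image_eq_tilesOf {S : Set (ℝ × L)} (hS : IsTiling len S) (hlen : ∀ a, 0 < len a) :
    (fun p => (p.1, len p.2)) '' S = tilesOf (Prod.fst '' S) := by
  ext ⟨a, l⟩
  constructor
  · rintro ⟨p, hp, h⟩
    simp only [Prod.mk.injEq] at h
    obtain ⟨rfl, rfl⟩ := h
    obtain ⟨q, hq, hq'⟩ := hS.exists_next hlen hp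
    refine ⟨hlen _, ⟨p, hp, rfl⟩, ⟨q, hq, hq'⟩, ?_⟩
    rintro _ ⟨r, hr, rfl⟩ ⟨h1, h2⟩
    exact hS.not_mem_interior hlen hp hr h1 h2
  · rintro ⟨hl, ⟨p, hp, h1⟩, ⟨q, hq, h2⟩, h3⟩
    simp only at hl h1 h2 h3
    refine ⟨p, hp, ?_⟩
    obtain ⟨r, hr, hr'⟩ := hS.exists_next hlen hp
    have h4 : l ≤ len p.2 := by
      by_contra! h
      exact h3 r.1 ⟨r, hr, rfl⟩ ⟨by linarith [hlen p.2], by linarith⟩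
    have h5 : len p.2 ≤ l := by
      by_contra! h
      exact hS.not_mem_interior hlen hp hq (by linarith) (by linarith)
    simp only [Prod.mk.injEq]
    exact ⟨h1, le_antisymm h5 h4⟩

/-- A tiling leaves no room for a further tile. This reduces equalities of tilings to inclusions. -/
theorem eq_of_subset {S T : Set (ℝ × L)} (hS : IsTiling len S) (hT : IsTiling len T)
    (hlen : ∀ a, 0 < len a) (h : S ⊆ T) : S = T := by
  refine h.antisymm fun p hp => ?_
  obtain ⟨q, hq, h1, h2⟩ := hS.exists_tile p.1
  have := hT.eq_of_mem_tile hp (h hq) le_rfl (by linarith [hlen p.2]) h1 h2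
  rwa [this]

theorem translate {S : Set (ℝ × L)} (hS : IsTiling len S) (t : ℝ) :
    IsTiling len (translateTiles t S) := by
  intro x
  obtain ⟨p, ⟨hp, h1, h2⟩, hu⟩ := hS (x - t)
  refine ⟨(p.1 + t, p.2), ⟨⟨p, hp, rfl⟩, by simp only; linarith, by simp only; linarith⟩, ?_⟩
  rintro q ⟨⟨r, hr, rfl⟩, h3, h4⟩
  simp only at h3 h4
  rw [hu r ⟨hr, by linarith, by linarith⟩]

/-- A tiling with finitely many prototiles is locally finite. -/
theorem finite_abs_le [Finite L] {S : Set (ℝ × L)} (hS : IsTiling len S)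
    (hlen : ∀ a, 0 < len a) (R : ℝ) : {p ∈ S | |p.1| ≤ R}.Finite := by
  obtain ⟨p0, hp0, -⟩ := hS.exists_tile 0
  have : Nonempty L := ⟨p0.2⟩
  obtain ⟨a0, ha0⟩ := Finite.exists_min len
  have hd := hlen a0
  set d := len a0
  -- Tiles are at least d long, so each cell of length d contains the left end of at most one tile.
  refine Set.Finite.of_finite_image (f := fun p : ℝ × L => ⌊p.1 / d⌋) ?_ ?_
  · refine (Set.finite_Icc ⌊-R / d⌋ ⌊R / d⌋).subset ?_
    rintro _ ⟨p, ⟨-, hp⟩, rfl⟩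
    rw [abs_le] at hp
    exact ⟨Int.floor_le_floor (by gcongr; exact hp.1), Int.floor_le_floor (by gcongr; exact hp.2)⟩
  · have key : ∀ p ∈ S, ∀ q ∈ S, ⌊p.1 / d⌋ = ⌊q.1 / d⌋ → p.1 ≤ q.1 → p = q := by
      intro p hp q hq h hpq
      have h1 := Int.lt_floor_add_one (q.1 / d)
      have h2 := Int.floor_le (p.1 / d)
      rw [h] at h2
      have h3 : q.1 / d < p.1 / d + 1 := by linarith
      have h4 : q.1 < p.1 + d := by
        have := mul_lt_mul_of_pos_right h3 hd
        rwa [add_mul, div_mul_cancel₀ _ hd.ne', div_mul_cancel₀ _ hd.ne', one_mul] at this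
      exact hS.eq_of_mem_tile hp hq hpq (by linarith [ha0 p.2]) le_rfl (by linarith [hlen q.2])
    rintro p ⟨hp, -⟩ q ⟨hq, -⟩ h
    rcases le_total p.1 q.1 with h' | h'
    · exact key p hp q hq h h'
    · exact (key q hq p hp h.symm h').symm

end IsTiling

theorem translateTiles_translateTiles (s t : ℝ) (S : Set (ℝ × L)) :
    translateTiles s (translateTiles t S) = translateTiles (t + s) S := by
  simp only [translateTiles, Set.image_image, add_assoc]

theorem translateTiles_mono (t : ℝ) {S T : Set (ℝ × L)} (h : S ⊆ T) :
    translateTiles t S ⊆ translateTiles t T := Set.image_mono h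

theorem LocallyIsomorphic.refl (S : Set (ℝ × L)) : LocallyIsomorphic S S := by
  constructor <;> exact fun P hP _ => ⟨0, by simpa [translateTiles] using hP⟩

theorem LocallyIsomorphic.symm {S T : Set (ℝ × L)} (h : LocallyIsomorphic S T) :
    LocallyIsomorphic T S := ⟨h.2, h.1⟩

theorem LocallyIsomorphic.trans {S T U : Set (ℝ × L)} (h : LocallyIsomorphic S T)
    (h' : LocallyIsomorphic T U) : LocallyIsomorphic S U := by
  constructor
  · intro P hP hf
    obtain ⟨t, ht⟩ := h.1 P hP hf
    obtain ⟨s, hs⟩ := h'.1 _ ht (hf.image _)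
    exact ⟨t + s, by rwa [translateTiles_translateTiles] at hs⟩
  · intro P hP hf
    obtain ⟨t, ht⟩ := h'.2 P hP hf
    obtain ⟨s, hs⟩ := h.2 _ ht (hf.image _)
    exact ⟨t + s, by rwa [translateTiles_translateTiles] at hs⟩

theorem exists_translate_relabel_subset {L' : Type} {S T : Set (ℝ × L)} (f : L → L')
    (h : ∀ P ⊆ S, P.Finite → ∃ t : ℝ, translateTiles t P ⊆ T) :
    ∀ P ⊆ (fun p => (p.1, f p.2)) '' S, P.Finite →
      ∃ t : ℝ, translateTiles t P ⊆ (fun p => (p.1, f p.2)) '' T := by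
  intro P hP hf
  obtain ⟨Q, hQ, hQf, rfl⟩ :=
    (Set.exists_subset_image_finite_and (p := fun t => t = P)).1 ⟨P, hP, hf, rfl⟩
  obtain ⟨t, ht⟩ := h Q hQ hQf
  refine ⟨t, ?_⟩
  rintro _ ⟨_, ⟨q, hq, rfl⟩, rfl⟩
  exact ⟨(q.1 + t, q.2), ht ⟨q, hq, rfl⟩, rfl⟩

theorem LocallyIsomorphic.relabel {L' : Type} {S T : Set (ℝ × L)} (f : L → L')
    (h : LocallyIsomorphic S T) :
    LocallyIsomorphic ((fun p : ℝ × L => (p.1, f p.2)) '' S) ((fun p => (p.1, f p.2)) '' T) :=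
  ⟨exists_translate_relabel_subset f h.1, exists_translate_relabel_subset f h.2⟩

/-! ### Subdivision of an interval by a list of tiles -/

theorem sum_map_take_succ (l : List L) (i : ℕ) (hi : i < l.length) :
    ((l.take (i + 1)).map len).sum = ((l.take i).map len).sum + len l[i] := by
  rw [List.take_add_one, List.getElem?_eq_getElem hi, List.map_append, List.sum_append]
  simp

theorem sum_map_take_le (hlen : ∀ a, 0 < len a) (l : List L) {i j : ℕ} (hij : i ≤ j) :
    ((l.take i).map len).sum ≤ ((l.take j).map len).sum := by
  induction j, hij using Nat.le_induction with
  | base => rfl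
  | succ j _ ih =>
    rcases lt_or_ge j l.length with h | h
    · rw [sum_map_take_succ l j h]
      linarith [hlen l[j]]
    · have h1 : l.take (j + 1) = l.take j := by
        rw [List.take_of_length_le h, List.take_of_length_le (by omega)]
      rwa [h1]

theorem exists_prefix_sum (l : List L) {r : ℝ} (h0 : 0 ≤ r) (h1 : r < (l.map len).sum) :
    ∃ (i : ℕ) (h : i < l.length), ((l.take i).map len).sum ≤ r ∧
      r < ((l.take i).map len).sum + len l[i] := by
  by_contra! hc
  have key : ∀ i ≤ l.length, ((l.take i).map len).sum ≤ r := by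
    intro i
    induction i with
    | zero => intro; simpa using h0
    | succ i ih =>
      intro hi
      rw [sum_map_take_succ l i (by omega)]
      exact hc i (by omega) (ih (by omega))
  have := key l.length le_rfl
  rw [List.take_length] at this
  linarith

theorem prefix_sum_unique (hlen : ∀ a, 0 < len a) (l : List L) {r : ℝ} {i j : ℕ}
    (hi : i < l.length) (hj : j < l.length)
    (h1 : ((l.take i).map len).sum ≤ r) (h2 : r < ((l.take i).map len).sum + len l[i])
    (h3 : ((l.take j).map len).sum ≤ r) (h4 : r < ((l.take j).map len).sum + len l[j]) :
    i = j := by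
  rw [← sum_map_take_succ l i hi] at h2
  rw [← sum_map_take_succ l j hj] at h4
  by_contra hne
  rcases Nat.lt_or_gt_of_ne hne with h | h
  · linarith [sum_map_take_le hlen l (show i + 1 ≤ j from h)]
  · linarith [sum_map_take_le hlen l (show j + 1 ≤ i from h)]

end Tilings

/-! ### Substitution of tilings -/

namespace SubstitutionRule

variable {L : Type} (σ : SubstitutionRule L)

theorem factor_pos : 0 < σ.factor := by linarith [σ.one_lt_factor]

theorem subst_mono {S T : Set (ℝ × L)} (h : S ⊆ T) : σ.subst S ⊆ σ.subst T := by
  rintro q ⟨p, hp, i, hi, rfl⟩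
  exact ⟨p, h hp, i, hi, rfl⟩

/-- Every tile of a substituted tiling lies in an inflated tile. -/
theorem mem_supertile {q p : ℝ × L} (h : q ∈ σ.subst {p}) :
    σ.factor * p.1 ≤ q.1 ∧ q.1 + σ.len q.2 ≤ σ.factor * (p.1 + σ.len p.2) := by
  obtain ⟨p', hp', i, hi, rfl⟩ := h
  obtain rfl : p' = p := hp'
  have h1 := sum_map_take_le σ.len_pos (σ.word p'.2) (Nat.zero_le i)
  have h2 := sum_map_take_le σ.len_pos (σ.word p'.2) (show i + 1 ≤ (σ.word p'.2).length from hi)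
  rw [List.take_length, σ.word_len, sum_map_take_succ _ _ hi] at h2
  simp only [List.take_zero, List.map_nil, List.sum_nil] at h1
  constructor
  · simpa using h1
  · simp only
    linarith

theorem mem_subst_iff {S : Set (ℝ × L)} {q : ℝ × L} :
    q ∈ σ.subst S ↔ ∃ p ∈ S, q ∈ σ.subst {p} := by
  constructor
  · rintro ⟨p, hp, i, hi, rfl⟩
    exact ⟨p, hp, p, rfl, i, hi, rfl⟩
  · rintro ⟨p, hp, h⟩
    exact σ.subst_mono (Set.singleton_subset_iff.2 hp) h

theorem exists_subst_singleton (p : ℝ × L) {x : ℝ} (h0 : σ.factor * p.1 ≤ x)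
    (h1 : x < σ.factor * (p.1 + σ.len p.2)) :
    ∃ q ∈ σ.subst {p}, q.1 ≤ x ∧ x < q.1 + σ.len q.2 := by
  obtain ⟨i, hi, h2, h3⟩ := exists_prefix_sum (len := σ.len) (σ.word p.2)
    (r := x - σ.factor * p.1) (by linarith) (by rw [σ.word_len]; linarith)
  exact ⟨_, ⟨p, rfl, i, hi, rfl⟩, by simp only; linarith, by simp only; linarith⟩

/-- The point x / factor selects the inflated tile over x, and the partial sums of its word select
the tile inside it. -/
theorem isTiling_subst {S : Set (ℝ × L)} (hS : IsTiling σ.len S) :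
    IsTiling σ.len (σ.subst S) := by
  intro x
  have hf := σ.factor_pos
  obtain ⟨p, hp, h1, h2⟩ := hS.exists_tile (x / σ.factor)
  rw [le_div_iff₀ hf, mul_comm] at h1
  rw [div_lt_iff₀ hf, mul_comm] at h2
  obtain ⟨q, hq, h3, h4⟩ := σ.exists_subst_singleton p h1 h2
  refine ⟨q, ⟨σ.mem_subst_iff.2 ⟨p, hp, hq⟩, h3, h4⟩, ?_⟩
  rintro q' ⟨hq', h5, h6⟩
  obtain ⟨p', hp', hq'⟩ := σ.mem_subst_iff.1 hq'
  obtain ⟨h7, h8⟩ := σ.mem_supertile hq'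
  have : p' = p := by
    refine hS.eq_of_mem_tile hp' hp (x := x / σ.factor) ?_ ?_ ?_ ?_
    · rw [le_div_iff₀ hf]; linarith
    · rw [div_lt_iff₀ hf]; linarith
    · rw [le_div_iff₀ hf]; linarith
    · rw [div_lt_iff₀ hf]; linarith
  subst this
  obtain ⟨r, hr, i, hi, rfl⟩ := hq
  obtain rfl : r = p' := hr
  obtain ⟨r', hr', j, hj, rfl⟩ := hq'
  obtain rfl : r' = r := hr'
  simp only at h3 h4 h5 h6
  obtain rfl : i = j := prefix_sum_unique (r := x - σ.factor * r'.1) σ.len_pos _ hi hj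
    (by linarith) (by linarith) (by linarith) (by linarith)
  rfl

theorem subst_translateTiles (t : ℝ) (S : Set (ℝ × L)) :
    σ.subst (translateTiles t S) = translateTiles (σ.factor * t) (σ.subst S) := by
  ext q
  constructor
  · rintro ⟨_, ⟨p, hp, rfl⟩, i, hi, rfl⟩
    exact ⟨_, ⟨p, hp, i, hi, rfl⟩, by simp only [Prod.mk.injEq]; exact ⟨by ring, trivial⟩⟩
  · rintro ⟨_, ⟨p, hp, i, hi, rfl⟩, rfl⟩
    exact ⟨_, ⟨p, hp, rfl⟩, i, hi, by simp only [Prod.mk.injEq]; exact ⟨by ring, trivial⟩⟩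

theorem exists_translate_subst_subset {S T : Set (ℝ × L)}
    (h : ∀ P ⊆ S, P.Finite → ∃ t : ℝ, translateTiles t P ⊆ T) :
    ∀ P ⊆ σ.subst S, P.Finite → ∃ t : ℝ, translateTiles t P ⊆ σ.subst T := by
  intro P hP hf
  choose! f hf1 hf2 using fun q (hq : q ∈ P) => σ.mem_subst_iff.1 (hP hq)
  obtain ⟨t, ht⟩ := h (f '' P) (by rintro _ ⟨q, hq, rfl⟩; exact hf1 q hq) (hf.image _)
  refine ⟨σ.factor * t, ?_⟩
  rintro _ ⟨q, hq, rfl⟩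
  have h1 : q ∈ σ.subst (f '' P) := σ.mem_subst_iff.2 ⟨f q, ⟨q, hq, rfl⟩, hf2 q hq⟩
  have h2 := σ.subst_mono ht
  rw [subst_translateTiles] at h2
  exact h2 ⟨q, h1, rfl⟩

theorem locallyIsomorphic_subst {S T : Set (ℝ × L)} (h : LocallyIsomorphic S T) :
    LocallyIsomorphic (σ.subst S) (σ.subst T) :=
  ⟨σ.exists_translate_subst_subset h.1, σ.exists_translate_subst_subset h.2⟩

theorem isTiling_iterate_subst {S : Set (ℝ × L)} (hS : IsTiling σ.len S) (n : ℕ) :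
    IsTiling σ.len (σ.subst^[n] S) := by
  induction n with
  | zero => exact hS
  | succ n ih =>
    rw [Function.iterate_succ_apply']
    exact σ.isTiling_subst ih

/-- A substitution tiling is locally isomorphic to its images under the substitution rule. -/
theorem IsSubstitutionTiling.locallyIsomorphic_iterate {σ : SubstitutionRule L}
    {S : Set (ℝ × L)} (hS : σ.IsSubstitutionTiling S) (n : ℕ) :
    LocallyIsomorphic S (σ.subst^[n] S) := by
  have h1 : LocallyIsomorphic S (σ.subst S) := by
    obtain ⟨T, -, hT, hTS⟩ := hS.2 1
    have := σ.locallyIsomorphic_subst hT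
    rw [Function.iterate_one] at hTS
    rw [hTS] at this
    exact this.symm
  induction n with
  | zero => exact LocallyIsomorphic.refl S
  | succ n ih =>
    rw [Function.iterate_succ_apply']
    exact h1.trans (σ.locallyIsomorphic_subst ih)

theorem mem_iterate_subst_iff (n : ℕ) {S : Set (ℝ × L)} {q : ℝ × L} :
    q ∈ σ.subst^[n] S ↔ ∃ p ∈ S, q ∈ σ.subst^[n] {p} := by
  induction n generalizing q with
  | zero => simp
  | succ n ih =>
    simp only [Function.iterate_succ_apply']
    rw [σ.mem_subst_iff]
    constructor
    · rintro ⟨r, hr, hq⟩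
      obtain ⟨p, hp, hr⟩ := ih.1 hr
      exact ⟨p, hp, σ.mem_subst_iff.2 ⟨r, hr, hq⟩⟩
    · rintro ⟨p, hp, hq⟩
      obtain ⟨r, hr, hq⟩ := σ.mem_subst_iff.1 hq
      exact ⟨r, ih.2 ⟨p, hp, hr⟩, hq⟩

theorem mem_iterate_supertile (n : ℕ) {q p : ℝ × L} (h : q ∈ σ.subst^[n] {p}) :
    σ.factor ^ n * p.1 ≤ q.1 ∧ q.1 + σ.len q.2 ≤ σ.factor ^ n * (p.1 + σ.len p.2) := by
  induction n generalizing q with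
  | zero =>
    obtain rfl : q = p := h
    simp
  | succ n ih =>
    rw [Function.iterate_succ_apply', σ.mem_subst_iff] at h
    obtain ⟨r, hr, hq⟩ := h
    have h1 := ih hr
    have h2 := σ.mem_supertile hq
    have hf := σ.factor_pos
    rw [pow_succ']
    constructor
    · nlinarith
    · nlinarith

theorem iterate_subst_translateTiles (n : ℕ) (t : ℝ) (S : Set (ℝ × L)) :
    σ.subst^[n] (translateTiles t S) = translateTiles (σ.factor ^ n * t) (σ.subst^[n] S) := by
  induction n with
  | zero => simp
  | succ n ih =>
    rw [Function.iterate_succ_apply', Function.iterate_succ_apply', ih, subst_translateTiles,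
      pow_succ', mul_assoc]

/-- The inflated vertices of a tiling are vertices of its image. -/
theorem factor_mul_mem {S : Set (ℝ × L)} {a : ℝ} (ha : a ∈ Prod.fst '' S) :
    σ.factor * a ∈ Prod.fst '' σ.subst S := by
  obtain ⟨p, hp, rfl⟩ := ha
  have hf := σ.factor_pos
  obtain ⟨q, hq, h1, -⟩ := σ.exists_subst_singleton p (x := σ.factor * p.1) le_rfl
    (by nlinarith [σ.len_pos p.2])
  exact ⟨q, σ.mem_subst_iff.2 ⟨p, hp, hq⟩, le_antisymm h1 (σ.mem_supertile hq).1⟩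

theorem factor_pow_mul_mem {S : Set (ℝ × L)} {a : ℝ} (ha : a ∈ Prod.fst '' S) (n : ℕ) :
    σ.factor ^ n * a ∈ Prod.fst '' σ.subst^[n] S := by
  induction n with
  | zero => simpa using ha
  | succ n ih =>
    rw [Function.iterate_succ_apply', pow_succ', mul_assoc]
    exact σ.factor_mul_mem ih

end SubstitutionRule

/-! ### Sidedness of half-open intervals -/

/-- `a < b`, or `a ≤ b` if `s` is true. -/
def SideLE (s : Bool) (a b : ℝ) : Prop := a < b ∨ (s = true ∧ a = b)

theorem SideLE.le {s : Bool} {a b : ℝ} (h : SideLE s a b) : a ≤ b := by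
  rcases h with h | ⟨-, h⟩
  exacts [h.le, h.le]

theorem SideLE.of_lt {s : Bool} {a b : ℝ} (h : a < b) : SideLE s a b := Or.inl h

theorem not_sideLE_of_lt {s : Bool} {a b : ℝ} (h : b < a) : ¬ SideLE s a b :=
  fun h' => absurd h'.le (not_le.2 h)

theorem le_of_not_sideLE {s : Bool} {a b : ℝ} (h : ¬ SideLE s a b) : b ≤ a :=
  not_lt.1 fun h' => h (Or.inl h')

theorem sideLE_congr {s : Bool} {a b a' b' : ℝ} (h : b - a = b' - a') :
    SideLE s a b ↔ SideLE s a' b' := by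
  have h1 : a < b ↔ a' < b' := by constructor <;> intro <;> linarith
  have h2 : a = b ↔ a' = b' := by constructor <;> intro <;> linarith
  rw [SideLE, SideLE, h1, h2]

theorem sideLE_mul_pos {s : Bool} {a b k : ℝ} (hk : 0 < k) :
    SideLE s (k * a) (k * b) ↔ SideLE s a b := by
  rw [SideLE, SideLE, mul_lt_mul_iff_right₀ hk, mul_right_inj' hk.ne']

/-- A negative factor reverses the order, so the strict and the weak comparison change places. This
is why the closed side of a window flips under ν < 0. -/
theorem sideLE_mul_neg {s : Bool} {a b k : ℝ} (hk : k < 0) :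
    SideLE s (k * a) (k * b) ↔ ¬ SideLE (!s) a b := by
  have h1 : k * a < k * b ↔ b < a := mul_lt_mul_left_of_neg hk
  rw [SideLE, SideLE, h1, mul_right_inj' hk.ne]
  cases s
  · simp only [Bool.false_eq_true, false_and, or_false, Bool.not_false, true_and, not_or, not_lt]
    exact ⟨fun h => ⟨h.le, h.ne'⟩, fun h => lt_of_le_of_ne h.1 (Ne.symm h.2)⟩
  · simp only [true_and, Bool.not_true, Bool.false_eq_true, false_and, or_false, not_lt]
    exact ⟨fun h => h.elim le_of_lt Eq.ge, fun h => h.lt_or_eq.imp id Eq.symm⟩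

namespace Window

/-- Both kinds of half-open interval become the same pair of comparisons with one parameter, which
avoids a case distinction in everything that follows. -/
theorem mem_carrier_iff (Ω : Window) (u : ℝ) :
    u ∈ Ω.carrier ↔ SideLE Ω.leftClosed Ω.lo u ∧ ¬ SideLE Ω.leftClosed Ω.hi u := by
  rcases Ω with ⟨lo, hi, h, s⟩
  cases s
  · simp [carrier, SideLE]
  · simp only [carrier, SideLE, if_true, Set.mem_Ico, true_and, not_or, not_lt]
    exact and_congr le_iff_lt_or_eq
      ⟨fun h => ⟨h.le, h.ne'⟩, fun h => lt_of_le_of_ne h.1 (Ne.symm h.2)⟩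

theorem Ioo_subset_carrier (Ω : Window) : Set.Ioo Ω.lo Ω.hi ⊆ Ω.carrier := fun _ hu =>
  (Ω.mem_carrier_iff _).2 ⟨.of_lt hu.1, not_sideLE_of_lt hu.2⟩

theorem carrier_subset_Icc (Ω : Window) : Ω.carrier ⊆ Set.Icc Ω.lo Ω.hi := fun u hu =>
  ⟨((Ω.mem_carrier_iff u).1 hu).1.le, le_of_not_sideLE ((Ω.mem_carrier_iff u).1 hu).2⟩

theorem length_pos (Ω : Window) : 0 < Ω.length := sub_pos.2 Ω.lo_lt_hi

end Window

/-! ### Cut and project sets -/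

/-- The vertices with internal coordinate in `J`. -/
def cutPoints (x y : (Fin 2 → ℤ) →+ ℝ) (J : Set ℝ) : Set ℝ := {a | ∃ z, y z ∈ J ∧ x z = a}

/-- The pair of coordinates embeds `ℤ²` as a discrete set, and the internal coordinate `y` is
injective. -/
structure IsCutProject (x y : (Fin 2 → ℤ) →+ ℝ) : Prop where
  finite_box : ∀ R : ℝ, {z | |x z| ≤ R ∧ |y z| ≤ R}.Finite
  y_injective : Function.Injective y

namespace IsCutProject

variable {x y : (Fin 2 → ℤ) →+ ℝ}

theorem neg_right (h : IsCutProject x y) : IsCutProject x (-y) where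
  finite_box R := by simpa using h.finite_box R
  y_injective a b hab := h.y_injective (neg_injective hab)

theorem finite_of_bounds (h : IsCutProject x y) (a b c d : ℝ) :
    {z | a ≤ x z ∧ x z ≤ b ∧ c ≤ y z ∧ y z ≤ d}.Finite := by
  refine (h.finite_box (|a| + |b| + |c| + |d|)).subset fun z hz => ?_
  obtain ⟨h1, h2, h3, h4⟩ := hz
  have ha := neg_abs_le a
  have hb := le_abs_self b
  have hc := neg_abs_le c
  have hd := le_abs_self d
  have ha' := abs_nonneg a
  have hb' := abs_nonneg b
  have hc' := abs_nonneg c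
  have hd' := abs_nonneg d
  constructor <;> rw [abs_le] <;> constructor <;> linarith

/-- If the image were cyclic, the values at the two basis vectors would satisfy an integer relation,
against injectivity. -/
theorem dense_range (h : IsCutProject x y) : Dense (Set.range y) := by
  rcases AddSubgroup.dense_or_cyclic y.range with hd | ⟨a, ha⟩
  · simpa using hd
  exfalso
  have key : ∀ z, ∃ k : ℤ, k * a = y z := by
    intro z
    have : y z ∈ y.range := ⟨z, rfl⟩
    rw [ha, AddSubgroup.mem_closure_singleton] at this
    simpa using this
  obtain ⟨k, hk⟩ := key ![1, 0]
  obtain ⟨l, hl⟩ := key ![0, 1]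
  have h1 : y (l • ![1, 0] - k • ![0, 1]) = y 0 := by
    rw [map_sub, map_zsmul, map_zsmul, ← hk, ← hl, map_zero]
    simp only [zsmul_eq_mul]
    ring
  have h2 := h.y_injective h1
  have h3 : l = 0 := by simpa using congrFun h2 0
  rw [h3] at hl
  have h4 : y ![0, 1] = y 0 := by rw [← hl]; simp
  have h5 := congrFun (h.y_injective h4) 1
  simp at h5

theorem exists_between (h : IsCutProject x y) {a b : ℝ} (hab : a < b) :
    ∃ z, a < y z ∧ y z < b := by
  obtain ⟨_, ⟨z, rfl⟩, hz⟩ := h.dense_range.exists_between hab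
  exact ⟨z, hz⟩

/-- Otherwise fix z1 with 0 < y z1 < ε. Each z with 0 < y z < y z1 has x z ≤ 0, and so has z1 - z;
all these z lie in a bounded box. There are then finitely many of them, against density. -/
theorem exists_step (h : IsCutProject x y) {ε : ℝ} (hε : 0 < ε) :
    ∃ p, 0 < x p ∧ 0 < y p ∧ y p < ε := by
  by_contra! hc
  obtain ⟨z1, h1, h2⟩ := h.exists_between hε
  have hfin : {z | 0 < y z ∧ y z < y z1}.Finite := by
    refine (h.finite_of_bounds (x z1) 0 0 (y z1)).subset fun z ⟨h3, h4⟩ => ?_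
    refine ⟨?_, ?_, h3.le, h4.le⟩
    · by_contra! h5
      have h6 := hc (z1 - z) (by rw [map_sub]; linarith) (by rw [map_sub]; linarith)
      rw [map_sub] at h6
      linarith
    · by_contra! h5
      linarith [hc z h5 h3]
  obtain ⟨z2, h3, h4⟩ := h.exists_between h1
  obtain ⟨z3, ⟨h5, h6⟩, h7⟩ := Set.exists_min_image _ (fun z => y z) hfin ⟨z2, h3, h4⟩
  obtain ⟨z4, h8, h9⟩ := h.exists_between h5
  exact absurd (h7 z4 ⟨h8, h9.trans h6⟩) (not_le.2 h9)

/-- One short step goes up and one goes down, both to the right and by less than half the width.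
From the lower half of the strip one can go up and from the upper half down; the negated steps lead
to the left. -/
theorem exists_forward (h : IsCutProject x y) {l : ℝ} (hl : 0 < l) :
    ∃ δ > 0, ∃ K : ℝ, ∀ u, 0 ≤ u → u ≤ l →
      (∃ p, δ ≤ x p ∧ x p ≤ K ∧ 0 < u + y p ∧ u + y p < l) ∧
      (∃ p, δ ≤ - x p ∧ 0 < u + y p ∧ u + y p < l) := by
  obtain ⟨p, hp1, hp2, hp3⟩ := h.exists_step (half_pos hl)
  obtain ⟨q, hq1, hq2, hq3⟩ := h.neg_right.exists_step (half_pos hl)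
  simp only [AddMonoidHom.neg_apply] at hq2 hq3
  refine ⟨min (x p) (x q), lt_min hp1 hq1, max (x p) (x q), fun u h0 h1 => ?_⟩
  rcases le_or_gt u (l / 2) with hu | hu
  · exact ⟨⟨p, min_le_left _ _, le_max_left _ _, by linarith, by linarith⟩,
      ⟨-q, by simp, by simp; linarith, by simp; linarith⟩⟩
  · exact ⟨⟨q, min_le_right _ _, le_max_right _ _, by linarith, by linarith⟩,
      ⟨-p, by simp, by simp; linarith, by simp; linarith⟩⟩

/-- The lattice points in a strip are relatively dense, uniformly in the position of the strip. -/
theorem exists_mem_strip (h : IsCutProject x y) {l : ℝ} (hl : 0 < l) :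
    ∃ K > 0, ∀ a r : ℝ, ∃ z, r ≤ x z ∧ x z < r + K ∧ a < y z ∧ y z < a + l := by
  obtain ⟨δ, hδ, K, hK⟩ := h.exists_forward hl
  refine ⟨|K| + 1, by positivity, fun a r => ?_⟩
  have hKK := le_abs_self K
  obtain ⟨z0, h1, h2⟩ := h.exists_between (show a < a + l by linarith)
  have back : ∀ n : ℕ, ∃ z, x z ≤ x z0 - n * δ ∧ a < y z ∧ y z < a + l := by
    intro n
    induction n with
    | zero => exact ⟨z0, by simp, h1, h2⟩
    | succ n ih =>
      obtain ⟨z, h3, h4, h5⟩ := ih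
      obtain ⟨p, hp1, hp2, hp3⟩ := (hK (y z - a) (by linarith) (by linarith)).2
      refine ⟨z + p, ?_, ?_, ?_⟩ <;> rw [map_add]
      · push_cast; linarith
      · linarith
      · linarith
  obtain ⟨n, hn⟩ := exists_nat_gt ((x z0 - r) / δ)
  rw [div_lt_iff₀ hδ] at hn
  obtain ⟨zb, h3, h4, h5⟩ := back n
  have hfin : {z | x zb ≤ x z ∧ x z < r ∧ a < y z ∧ y z < a + l}.Finite :=
    (h.finite_of_bounds (x zb) r a (a + l)).subset fun z ⟨h6, h7, h8, h9⟩ =>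
      ⟨h6, h7.le, h8.le, h9.le⟩
  -- From the last point before r a single forward step crosses r, by at most its own length.
  obtain ⟨z1, ⟨h6, h7, h8, h9⟩, h10⟩ :=
    Set.exists_max_image _ (fun z => x z) hfin ⟨zb, le_rfl, by linarith, h4, h5⟩
  obtain ⟨p, hp1, hp2, hp3, hp4⟩ := (hK (y z1 - a) (by linarith) (by linarith)).1
  have hx : x (z1 + p) = x z1 + x p := map_add _ _ _
  have hy : y (z1 + p) = y z1 + y p := map_add _ _ _
  refine ⟨z1 + p, ?_, by linarith, by linarith, by linarith⟩
  by_contra! h11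
  linarith [h10 (z1 + p) ⟨by linarith, h11, by linarith, by linarith⟩]

theorem exists_mem_carrier (h : IsCutProject x y) (Ω : Window) :
    ∃ K > 0, ∀ r : ℝ, ∃ z, r ≤ x z ∧ x z < r + K ∧ y z ∈ Ω.carrier := by
  obtain ⟨K, hK, h1⟩ := h.exists_mem_strip Ω.length_pos
  refine ⟨K, hK, fun r => ?_⟩
  obtain ⟨z, h2, h3, h4, h5⟩ := h1 Ω.lo r
  refine ⟨z, h2, h3, Ω.Ioo_subset_carrier ⟨h4, ?_⟩⟩
  rw [Window.length] at h5
  linarith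

/-- Every vertex of a projection tiling is the left endpoint of a tile. -/
theorem fst_image_tilesOf (h : IsCutProject x y) (Ω : Window) :
    Prod.fst '' tilesOf (cutPoints x y Ω.carrier) = cutPoints x y Ω.carrier := by
  ext a
  constructor
  · rintro ⟨p, hp, rfl⟩
    exact hp.2.1
  · intro ha
    obtain ⟨K, hK, h1⟩ := h.exists_mem_carrier Ω
    obtain ⟨z, hz1, hz2, hz3⟩ := h1 (a + 1)
    have hfin : {z' | a < x z' ∧ x z' ≤ x z ∧ y z' ∈ Ω.carrier}.Finite :=
      (h.finite_of_bounds a (x z) Ω.lo Ω.hi).subset fun z' ⟨h2, h3, h4⟩ =>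
        ⟨h2.le, h3, Ω.carrier_subset_Icc h4⟩
    obtain ⟨z1, ⟨h2, h3, h4⟩, h5⟩ :=
      Set.exists_min_image _ (fun z => x z) hfin ⟨z, by linarith, le_rfl, hz3⟩
    refine ⟨(a, x z1 - a), ⟨sub_pos.2 h2, ha, ⟨z1, h4, by simp⟩, ?_⟩, rfl⟩
    rintro _ ⟨z2, h6, rfl⟩ ⟨h7, h8⟩
    simp only [add_sub_cancel] at h7 h8
    linarith [h5 z2 ⟨h7, by linarith, h6⟩]

/-- A labelled tiling with the shape of a projection tiling has the same vertices. -/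
theorem fst_image_of_shape (h : IsCutProject x y) {Ω : Window} {L : Type} {len : L → ℝ}
    {S : Set (ℝ × L)}
    (hS : (fun p : ℝ × L => (p.1, len p.2)) '' S = tilesOf (cutPoints x y Ω.carrier)) :
    Prod.fst '' S = cutPoints x y Ω.carrier := by
  rw [← h.fst_image_tilesOf Ω, ← hS, Set.image_image]

end IsCutProject

/-! ### The substitution rule of an inflation of a window -/

theorem SideLE.le_trans {s : Bool} {a b c : ℝ} (h : SideLE s b c) (hab : a ≤ b) :
    SideLE s a c := by
  rcases h with h | ⟨h, rfl⟩
  · exact .of_lt (hab.trans_lt h)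
  · exact hab.lt_or_eq.imp id fun h' => ⟨h, h'⟩

/-- The closed side of the image of a half-open interval under an affine map with slope `ν`. -/
noncomputable def flipSide (ν : ℝ) (s : Bool) : Bool := if 0 < ν then s else !s

theorem sideLE_affine_pos {ν : ℝ} (hν : 0 < ν) (s : Bool) (c a b : ℝ) :
    SideLE (flipSide ν s) (ν * a + c) (ν * b + c) ↔ SideLE s a b := by
  rw [flipSide, if_pos hν, ← sideLE_mul_pos (a := a) hν]
  exact sideLE_congr (by ring)

theorem sideLE_affine_neg {ν : ℝ} (hν : ν < 0) (s : Bool) (c a b : ℝ) :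
    SideLE (flipSide ν s) (ν * a + c) (ν * b + c) ↔ ¬ SideLE s a b := by
  have h : SideLE (!s) (ν * a) (ν * b) ↔ ¬ SideLE s a b := by
    rw [sideLE_mul_neg hν, Bool.not_not]
  rw [flipSide, if_neg (not_lt.2 hν.le), ← h]
  exact sideLE_congr (by ring)

/-- An inflation acts on the lattice by `M`, on the tiling coordinate by `lam`, and on the position
in the window (relative to its lower endpoint) by `u ↦ ν * u + c`.  The finite set `D` of cut
points is closed under the preimages that occur in the subdivision of the tiles. -/
structure Inflation (x y : (Fin 2 → ℤ) →+ ℝ) where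
  cutProject : IsCutProject x y
  x_injective : Function.Injective x
  M : (Fin 2 → ℤ) →+ (Fin 2 → ℤ)
  lam : ℝ
  ν : ℝ
  c : ℝ
  l : ℝ
  K : ℝ
  D : Set ℝ
  x_M : ∀ z, x (M z) = lam * x z
  y_M : ∀ z, y (M z) = ν * y z
  one_lt_lam : 1 < lam
  ν_ne : ν ≠ 0
  l_pos : 0 < l
  maps : ∀ u, 0 ≤ u → u ≤ l → 0 ≤ ν * u + c ∧ ν * u + c ≤ l
  step : ∀ u, 0 ≤ u → u ≤ l → ∃ m, 0 < x m ∧ x m ≤ K ∧ 0 < u + y m ∧ u + y m < l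
  D_finite : D.Finite
  lower_mem : ∀ m, |x m| ≤ lam * K → 0 ≤ - y m → - y m ≤ l → - y m ∈ D
  upper_mem : ∀ m, |x m| ≤ lam * K → 0 ≤ l - y m → l - y m ≤ l → l - y m ∈ D
  preimage_mem : ∀ d ∈ D, ∀ m, |x m| ≤ lam * K → 0 ≤ (d - c - y m) / ν →
    (d - c - y m) / ν ≤ l → (d - c - y m) / ν ∈ D

namespace Inflation

variable {x y : (Fin 2 → ℤ) →+ ℝ} (I : Inflation x y)

/-- `u` is in the half-open interval of length `l` starting at `0`. -/
def Mem (s : Bool) (u : ℝ) : Prop := SideLE s 0 u ∧ ¬ SideLE s I.l u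

/-- Two positions lie in the same cell of the partition by `D`. -/
def Same (s : Bool) (u : ℝ) (s' : Bool) (u' : ℝ) : Prop :=
  ∀ d ∈ I.D, (SideLE s d u ↔ SideLE s' d u')

variable {I}

theorem Mem.nonneg {s : Bool} {u : ℝ} (h : I.Mem s u) : 0 ≤ u := h.1.le

theorem Mem.le {s : Bool} {u : ℝ} (h : I.Mem s u) : u ≤ I.l := le_of_not_sideLE h.2

theorem Mem.of_lt {s : Bool} {u : ℝ} (h : 0 < u) (h' : u < I.l) : I.Mem s u :=
  ⟨.of_lt h, not_sideLE_of_lt h'⟩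

theorem K_pos (I : Inflation x y) : 0 < I.K := by
  obtain ⟨m, h1, h2, -⟩ := I.step 0 le_rfl I.l_pos.le
  linarith

theorem lam_pos (I : Inflation x y) : 0 < I.lam := by linarith [I.one_lt_lam]

theorem K_le (I : Inflation x y) : I.K ≤ I.lam * I.K := by
  nlinarith [I.K_pos, I.one_lt_lam]

/-- The field `maps` only compares closed intervals. The half-open version follows since `flipSide`
keeps the missing end of the image on the correct side. -/
theorem Mem.map {s : Bool} {u : ℝ} (h : I.Mem s u) :
    I.Mem (flipSide I.ν s) (I.ν * u + I.c) := by
  have h0 := I.maps 0 le_rfl I.l_pos.le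
  have h1 := I.maps I.l I.l_pos.le le_rfl
  rcases I.ν_ne.lt_or_gt with hν | hν
  · refine ⟨((sideLE_affine_neg hν s I.c I.l u).2 h.2).le_trans h1.1, fun h' => ?_⟩
    exact (sideLE_affine_neg hν s I.c 0 u).1 (h'.le_trans h0.2) h.1
  · refine ⟨((sideLE_affine_pos hν s I.c 0 u).2 h.1).le_trans h0.1, fun h' => ?_⟩
    exact h.2 ((sideLE_affine_pos hν s I.c I.l u).1 (h'.le_trans h1.2))

theorem Same.symm {s s' : Bool} {u u' : ℝ} (h : I.Same s u s' u') : I.Same s' u' s u :=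
  fun d hd => (h d hd).symm

/-- Cut points outside [0, l] do not distinguish positions in the window, so D only has to contain
those inside. -/
theorem Same.sideLE_iff {s s' : Bool} {u u' : ℝ} (h : I.Same s u s' u') (hu : I.Mem s u)
    (hu' : I.Mem s' u') {d : ℝ} (hd : 0 ≤ d → d ≤ I.l → d ∈ I.D) :
    SideLE s d u ↔ SideLE s' d u' := by
  rcases lt_or_ge d 0 with h0 | h0
  · exact iff_of_true (hu.1.le_trans h0.le) (hu'.1.le_trans h0.le)
  rcases lt_or_ge I.l d with h1 | h1
  · exact iff_of_false (not_sideLE_of_lt (hu.le.trans_lt h1))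
      (not_sideLE_of_lt (hu'.le.trans_lt h1))
  exact h d (hd h0 h1)

/-- Staying in the window after a translation by m is a comparison of u with the shifted ends - y m
and l - y m, which belong to D by `lower_mem` and `upper_mem`. -/
theorem Same.mem_iff {s s' : Bool} {u u' : ℝ} (h : I.Same s u s' u') (hu : I.Mem s u)
    (hu' : I.Mem s' u') {m : Fin 2 → ℤ} (hm : |x m| ≤ I.lam * I.K) :
    I.Mem s (u + y m) ↔ I.Mem s' (u' + y m) := by
  have h1 := h.sideLE_iff hu hu' (I.lower_mem m hm)
  have h2 := h.sideLE_iff hu hu' (d := I.l - y m) fun h0 _ => by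
    rcases le_or_gt (I.l - y m) I.l with h3 | h3
    · exact I.upper_mem m hm h0 h3
    · linarith
  have e1 : ∀ s v, SideLE s 0 (v + y m) ↔ SideLE s (- y m) v := fun s v =>
    sideLE_congr (by ring)
  have e2 : ∀ s v, SideLE s I.l (v + y m) ↔ SideLE s (I.l - y m) v := fun s v =>
    sideLE_congr (by ring)
  rw [Mem, Mem, e1, e1, e2, e2, h1, h2]

/-- Comparing the image with d amounts to comparing u with the preimage of d, and `preimage_mem`
puts this preimage into D. -/
theorem Same.map {s s' : Bool} {u u' : ℝ} (h : I.Same s u s' u') (hu : I.Mem s u)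
    (hu' : I.Mem s' u') {m : Fin 2 → ℤ} (hm : |x m| ≤ I.lam * I.K) :
    I.Same (flipSide I.ν s) (I.ν * u + I.c + y m) (flipSide I.ν s') (I.ν * u' + I.c + y m) := by
  intro d hd
  have h1 := h.sideLE_iff hu hu' (I.preimage_mem d hd m hm)
  have h2 : d = I.ν * ((d - I.c - y m) / I.ν) + (I.c + y m) := by
    rw [mul_div_cancel₀ _ I.ν_ne]; ring
  rw [add_assoc, add_assoc, h2]
  rcases I.ν_ne.lt_or_gt with hν | hν
  · rw [sideLE_affine_neg hν, sideLE_affine_neg hν, h1]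
  · rw [sideLE_affine_pos hν, sideLE_affine_pos hν, h1]

theorem exists_next {s : Bool} {u : ℝ} (hu : I.Mem s u) :
    ∃ m, 0 < x m ∧ x m ≤ I.K ∧ I.Mem s (u + y m) ∧
      ∀ m', 0 < x m' → I.Mem s (u + y m') → x m ≤ x m' := by
  obtain ⟨m0, h1, h2, h3, h4⟩ := I.step u hu.nonneg hu.le
  have hfin : {m | 0 < x m ∧ x m ≤ I.K ∧ I.Mem s (u + y m)}.Finite :=
    (I.cutProject.finite_of_bounds 0 I.K (-u) (I.l - u)).subset fun m ⟨h5, h6, h7⟩ =>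
      ⟨h5.le, h6, by linarith [h7.nonneg], by linarith [h7.le]⟩
  obtain ⟨m, ⟨h5, h6, h7⟩, h8⟩ :=
    Set.exists_min_image _ (fun z => x z) hfin ⟨m0, h1, h2, Mem.of_lt h3 h4⟩
  refine ⟨m, h5, h6, h7, fun m' h9 h10 => ?_⟩
  rcases le_or_gt (x m') I.K with h11 | h11
  · exact h8 m' ⟨h9, h11, h10⟩
  · linarith

variable (I) in
open Classical in
/-- The lattice vector from a vertex to the next one. -/
noncomputable def next (s : Bool) (u : ℝ) : Fin 2 → ℤ :=
  if hu : I.Mem s u then (exists_next hu).choose else 0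

theorem Mem.next_spec {s : Bool} {u : ℝ} (hu : I.Mem s u) :
    0 < x (I.next s u) ∧ x (I.next s u) ≤ I.K ∧ I.Mem s (u + y (I.next s u)) ∧
      ∀ m', 0 < x m' → I.Mem s (u + y m') → x (I.next s u) ≤ x m' := by
  rw [next, dif_pos hu]
  exact (exists_next hu).choose_spec

theorem Same.next_le {s s' : Bool} {u u' : ℝ} (h : I.Same s u s' u') (hu : I.Mem s u)
    (hu' : I.Mem s' u') : x (I.next s u) ≤ x (I.next s' u') := by
  obtain ⟨h1, h2, h3, -⟩ := hu'.next_spec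
  refine hu.next_spec.2.2.2 _ h1 ((h.mem_iff hu hu' ?_).2 h3)
  rw [abs_of_pos h1]
  exact h2.trans I.K_le

theorem Same.next_eq {s s' : Bool} {u u' : ℝ} (h : I.Same s u s' u') (hu : I.Mem s u)
    (hu' : I.Mem s' u') : I.next s u = I.next s' u' :=
  I.x_injective (le_antisymm (h.next_le hu hu') (h.symm.next_le hu' hu))

/-! #### Successive vertices -/

variable (I) in
/-- The lattice vector from a vertex at position `u` to the `i`-th following one. -/
noncomputable def pos (s : Bool) (u : ℝ) : ℕ → (Fin 2 → ℤ)
  | 0 => 0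
  | i + 1 => pos s u i + I.next s (u + y (pos s u i))

theorem Mem.pos {s : Bool} {u : ℝ} (hu : I.Mem s u) (i : ℕ) :
    I.Mem s (u + y (I.pos s u i)) := by
  induction i with
  | zero => simpa [Inflation.pos] using hu
  | succ i ih =>
    have := ih.next_spec.2.2.1
    rwa [add_assoc, ← map_add] at this

theorem Mem.x_pos_lt_succ {s : Bool} {u : ℝ} (hu : I.Mem s u) (i : ℕ) :
    x (I.pos s u i) < x (I.pos s u (i + 1)) := by
  rw [Inflation.pos, map_add]
  linarith [(hu.pos i).next_spec.1]

theorem Mem.strictMono_pos {s : Bool} {u : ℝ} (hu : I.Mem s u) :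
    StrictMono fun i => x (I.pos s u i) := strictMono_nat_of_lt_succ hu.x_pos_lt_succ

theorem Mem.x_pos_nonneg {s : Bool} {u : ℝ} (hu : I.Mem s u) (i : ℕ) :
    0 ≤ x (I.pos s u i) := by
  have := hu.strictMono_pos.monotone (Nat.zero_le i)
  simpa [Inflation.pos] using this

/-- Discreteness gives a last successive vertex that does not pass m. If it were not m, its
successor would still not pass m. -/
theorem Mem.exists_pos_eq {s : Bool} {u : ℝ} (hu : I.Mem s u) {m : Fin 2 → ℤ}
    (hm : I.Mem s (u + y m)) (hx : 0 ≤ x m) : ∃ i, I.pos s u i = m := by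
  have hfin : {i | x (I.pos s u i) ≤ x m}.Finite := by
    refine Set.Finite.of_finite_image (f := I.pos s u) ?_ fun i _ j _ hij =>
      hu.strictMono_pos.injective (congrArg x hij)
    refine (I.cutProject.finite_of_bounds 0 (x m) (-u) (I.l - u)).subset ?_
    rintro _ ⟨i, hi, rfl⟩
    exact ⟨hu.x_pos_nonneg i, hi, by linarith [(hu.pos i).nonneg], by linarith [(hu.pos i).le]⟩
  obtain ⟨i, hi, hmax⟩ := Set.exists_max_image _ id hfin ⟨0, by simpa [Inflation.pos] using hx⟩
  refine ⟨i, ?_⟩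
  by_contra hne
  have h1 : x (I.pos s u i) < x m :=
    lt_of_le_of_ne hi fun h => hne (I.x_injective h)
  have h2 := (hu.pos i).next_spec.2.2.2 (m - I.pos s u i) (by rw [map_sub]; linarith)
    (by rw [map_sub, add_assoc, add_sub_cancel]; exact hm)
  have h3 : i + 1 ∈ {i | x (I.pos s u i) ≤ x m} := by
    rw [map_sub] at h2
    change x (I.pos s u i + I.next s (u + y (I.pos s u i))) ≤ x m
    rw [map_add]
    linarith
  have := hmax _ h3
  simp at this

/-! #### Labels -/

variable (I) in
/-- The cell of a position in the window. -/
def cell (s : Bool) (u : ℝ) : Set ℝ := {d ∈ I.D | SideLE s d u}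

variable (I) in
/-- Labels are the cells which occur. -/
def Label : Type := {b : Set ℝ // ∃ s u, I.Mem s u ∧ I.cell s u = b}

theorem finite_label : Finite I.Label := by
  have : {b : Set ℝ | ∃ s u, I.Mem s u ∧ I.cell s u = b}.Finite :=
    I.D_finite.finite_subsets.subset (by rintro _ ⟨s, u, -, rfl⟩; exact fun d hd => hd.1)
  exact this.to_subtype

/-- The label of a position. -/
def Mem.label {s : Bool} {u : ℝ} (hu : I.Mem s u) : I.Label := ⟨I.cell s u, s, u, hu, rfl⟩

theorem Mem.label_eq {s s' : Bool} {u u' : ℝ} (hu : I.Mem s u) (hu' : I.Mem s' u')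
    (h : I.Same s u s' u') : hu.label = hu'.label := by
  refine Subtype.ext (Set.ext fun d => ?_)
  exact and_congr_right fun hd => h d hd

theorem Mem.same_of_label_eq {s s' : Bool} {u u' : ℝ} (hu : I.Mem s u) (hu' : I.Mem s' u')
    (h : hu.label = hu'.label) : I.Same s u s' u' := by
  intro d hd
  have h1 : I.cell s u = I.cell s' u' := congrArg Subtype.val h
  have h2 := Set.ext_iff.1 h1 d
  simpa [cell, hd] using h2

/-- The side of a representative of a label. -/
noncomputable def Label.side (b : I.Label) : Bool := b.2.choose

/-- The position of a representative of a label. -/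
noncomputable def Label.rep (b : I.Label) : ℝ := b.2.choose_spec.choose

theorem Label.mem (b : I.Label) : I.Mem b.side b.rep := b.2.choose_spec.choose_spec.1

theorem Label.label_mem (b : I.Label) : b.mem.label = b :=
  Subtype.ext b.2.choose_spec.choose_spec.2

theorem Mem.same_label {s : Bool} {u : ℝ} (hu : I.Mem s u) :
    I.Same s u hu.label.side hu.label.rep :=
  hu.same_of_label_eq hu.label.mem hu.label.label_mem.symm

/-- The length of the tiles with a given label. -/
noncomputable def Label.len (b : I.Label) : ℝ := x (I.next b.side b.rep)

theorem Label.len_pos (b : I.Label) : 0 < b.len := b.mem.next_spec.1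

theorem Mem.len_label {s : Bool} {u : ℝ} (hu : I.Mem s u) :
    hu.label.len = x (I.next s u) := by
  rw [Label.len, hu.same_label.next_eq hu hu.label.mem]

/-- The right end of the inflated tile is the image under M of a vertex, hence a vertex of the new
tiling, so the successive vertices hit it. This makes the word cover the inflated tile exactly. -/
theorem Label.exists_count (b : I.Label) :
    ∃ k, I.pos (flipSide I.ν b.side) (I.ν * b.rep + I.c) k = I.M (I.next b.side b.rep) := by
  have h := b.mem.next_spec
  refine b.mem.map.exists_pos_eq ?_ ?_
  · have := h.2.2.1.map
    rw [I.y_M]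
    convert this using 1
    ring
  · rw [I.x_M]
    exact mul_nonneg I.lam_pos.le h.1.le

/-- The number of tiles in an inflated tile. -/
noncomputable def Label.count (b : I.Label) : ℕ := b.exists_count.choose

/-- The tiles in an inflated tile. -/
noncomputable def Label.word (b : I.Label) : List I.Label :=
  (List.range b.count).map fun i => (b.mem.map.pos i).label

theorem Mem.sum_len_pos {s : Bool} {u : ℝ} (hu : I.Mem s u) (k : ℕ) :
    (((List.range k).map fun i => (hu.pos i).label).map Label.len).sum = x (I.pos s u k) := by
  induction k with
  | zero => simp [Inflation.pos]
  | succ k ih =>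
    rw [List.range_succ, List.map_append, List.map_append, List.sum_append, ih, Inflation.pos,
      map_add]
    simp [Mem.len_label]

/-! ### The substitution rule and the labelled tilings on which it acts -/

variable (I) in
/-- The substitution rule of an inflation. -/
noncomputable def rule : SubstitutionRule I.Label where
  len := Label.len
  len_pos := Label.len_pos
  factor := I.lam
  one_lt_factor := I.one_lt_lam
  word := Label.word
  word_len b := by
    rw [Label.word, b.mem.map.sum_len_pos, Label.count, b.exists_count.choose_spec, I.x_M]
    rfl

variable (I) in
/-- The labelled projection tiling with window of lower endpoint `t` and closed side `s`. -/
def tiling (s : Bool) (t : ℝ) : Set (ℝ × I.Label) :=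
  {p | ∃ (z : Fin 2 → ℤ) (h : I.Mem s (y z - t)), p = (x z, h.label)}

theorem exists_lt_vertex (I : Inflation x y) (s : Bool) (t r : ℝ) :
    ∃ z, x z ≤ r ∧ I.Mem s (y z - t) := by
  obtain ⟨K, hK, h⟩ := I.cutProject.exists_mem_strip I.l_pos
  obtain ⟨z, h1, h2, h3, h4⟩ := h t (r - K)
  exact ⟨z, by linarith, Mem.of_lt (by linarith) (by linarith)⟩

theorem isTiling_tiling (s : Bool) (t : ℝ) : IsTiling (Label.len (I := I)) (I.tiling s t) := by
  intro r
  obtain ⟨z0, h1, h2⟩ := I.exists_lt_vertex s t r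
  have hfin : {z | x z0 ≤ x z ∧ x z ≤ r ∧ I.Mem s (y z - t)}.Finite :=
    (I.cutProject.finite_of_bounds (x z0) r t (t + I.l)).subset fun z ⟨h3, h4, h5⟩ =>
      ⟨h3, h4, by linarith [h5.nonneg], by linarith [h5.le]⟩
  obtain ⟨z, ⟨h3, h4, h5⟩, h6⟩ :=
    Set.exists_max_image _ (fun z => x z) hfin ⟨z0, le_rfl, h1, h2⟩
  have hmax : ∀ z', I.Mem s (y z' - t) → x z' ≤ r → x z' ≤ x z := by
    intro z' h7 h8
    rcases le_total (x z0) (x z') with h9 | h9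
    · exact h6 z' ⟨h9, h8, h7⟩
    · exact h9.trans h3
  have hnext : ∀ z', (h : I.Mem s (y z' - t)) → I.Mem s (y (z' + I.next s (y z' - t)) - t) := by
    intro z' h
    have := h.next_spec.2.2.1
    rw [map_add]
    convert this using 1
    ring
  refine ⟨(x z, h5.label), ⟨⟨z, h5, rfl⟩, h4, ?_⟩, ?_⟩
  · simp only [h5.len_label]
    by_contra! h7
    have h8 := hmax _ (hnext z h5) (by rw [map_add]; exact h7)
    rw [map_add] at h8
    linarith [h5.next_spec.1]
  · rintro _ ⟨⟨z', h7, rfl⟩, h8, h9⟩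
    simp only [h7.len_label] at h8 h9
    have h10 := hmax z' h7 h8
    have h11 : x z' = x z := by
      refine le_antisymm h10 ?_
      by_contra! h12
      have := h7.next_spec.2.2.2 (z - z') (by rw [map_sub]; linarith) (by
        rw [map_sub]
        convert h5 using 1
        ring)
      rw [map_sub] at this
      linarith
    obtain rfl := I.x_injective h11
    rfl

/-- By `eq_of_subset` an inclusion suffices. The word is computed at the representative of the cell;
`Same.map` carries every vertex and label in it over to the actual position of the tile. -/
theorem subst_tiling (s : Bool) (t : ℝ) :
    I.rule.subst (I.tiling s t) = I.tiling (flipSide I.ν s) (I.ν * t - I.c) := by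
  refine (I.rule.isTiling_subst (isTiling_tiling s t)).eq_of_subset (isTiling_tiling _ _)
    I.rule.len_pos ?_
  rintro _ ⟨_, ⟨z, hz, rfl⟩, i, hi, rfl⟩
  set b := hz.label with hb
  have hi' : i < b.count := by simpa [rule, Label.word] using hi
  set m := I.pos (flipSide I.ν b.side) (I.ν * b.rep + I.c) i with hm
  have hsum : (((I.rule.word b).take i).map I.rule.len).sum = x m := by
    have h1 : (I.rule.word b).take i = (List.range i).map fun i => (b.mem.map.pos i).label := by
      simp only [rule, Label.word]
      rw [← List.map_take, List.take_range, min_eq_left hi'.le]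
    rw [h1]
    exact b.mem.map.sum_len_pos i
  -- The vertex lies in an inflated tile, and tiles have length at most K. This is the range of
  -- lattice vectors for which D is closed.
  have hxm : |x m| ≤ I.lam * I.K := by
    rw [abs_of_nonneg (b.mem.map.x_pos_nonneg i)]
    have h1 : x m ≤ x (I.pos (flipSide I.ν b.side) (I.ν * b.rep + I.c) b.count) :=
      b.mem.map.strictMono_pos.monotone hi'.le
    rw [Label.count, b.exists_count.choose_spec, I.x_M] at h1
    exact h1.trans (mul_le_mul_of_nonneg_left b.mem.next_spec.2.1 I.lam_pos.le)
  have hsame := hz.same_label.map hz b.mem hxm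
  have hrep : I.Mem (flipSide I.ν b.side) (I.ν * b.rep + I.c + y m) := b.mem.map.pos i
  have hmem : I.Mem (flipSide I.ν s) (I.ν * (y z - t) + I.c + y m) := by
    refine (Same.mem_iff (u' := I.ν * b.rep + I.c) ?_ hz.map b.mem.map hxm).2 hrep
    have h0 := hz.same_label.map hz b.mem (m := 0)
      (by simpa using mul_nonneg I.lam_pos.le I.K_pos.le)
    simpa using h0
  have hy : y (I.M z + m) - (I.ν * t - I.c) = I.ν * (y z - t) + I.c + y m := by
    rw [map_add, I.y_M]; ring
  have hmem' : I.Mem (flipSide I.ν s) (y (I.M z + m) - (I.ν * t - I.c)) := by rwa [hy]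
  refine ⟨I.M z + m, hmem', ?_⟩
  rw [Prod.mk.injEq]
  constructor
  · rw [map_add, I.x_M]
    exact congrArg _ hsum
  · have h1 : (I.rule.word b)[i] = hrep.label := by
      simp only [rule, Label.word, List.getElem_map, List.getElem_range]
    refine h1.trans (hrep.label_eq hmem' ?_)
    rw [hy]
    exact hsame.symm

/-! ### Local isomorphism of the labelled tilings and inverse substitution -/

/-- A small move away from the missing side turns each comparison into a strict one without changing
its truth value; afterwards the closed side plays no role. -/
theorem eventually_sideLE {d u : ℝ} (s' : Bool) :
    (∀ᶠ δ in nhdsWithin 0 (Set.Ioi 0), (SideLE true d u ↔ SideLE s' d (u + δ))) ∧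
    (∀ᶠ δ in nhdsWithin 0 (Set.Iio 0), (SideLE false d u ↔ SideLE s' d (u + δ))) := by
  rcases lt_trichotomy d u with h | h | h
  · have : ∀ᶠ δ in nhds (0 : ℝ), d - u < δ := eventually_gt_nhds (by linarith)
    constructor <;>
    · filter_upwards [this.filter_mono nhdsWithin_le_nhds] with δ hδ
      exact iff_of_true (.of_lt h) (.of_lt (by linarith))
  · subst h
    constructor <;> filter_upwards [self_mem_nhdsWithin] with δ hδ
    · exact iff_of_true (Or.inr ⟨rfl, rfl⟩) (.of_lt (by simpa using hδ))
    · exact iff_of_false (by simp [SideLE]) (not_sideLE_of_lt (by simpa using hδ))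
  · have : ∀ᶠ δ in nhds (0 : ℝ), δ < d - u := eventually_lt_nhds (by linarith)
    constructor <;>
    · filter_upwards [this.filter_mono nhdsWithin_le_nhds] with δ hδ
      exact iff_of_false (not_sideLE_of_lt h) (not_sideLE_of_lt (by linarith))

/-- A finite patch involves finitely many comparisons with 0, l and D. By density some y m
approximates t' - t from the side on which all of them persist. -/
theorem exists_translate_tiling_subset (s s' : Bool) (t t' : ℝ) :
    ∀ P ⊆ I.tiling s t, P.Finite → ∃ r : ℝ, translateTiles r P ⊆ I.tiling s' t' := by
  intro P hP hf
  let E : Set ℝ := insert 0 (insert I.l I.D)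
  have hE : E.Finite := (I.D_finite.insert _).insert _
  choose! f hf1 hf2 using fun p (hp : p ∈ P) => hP hp
  have key : ∃ m, ∀ p ∈ P, ∀ d ∈ E,
      (SideLE s d (y (f p) - t) ↔ SideLE s' d (y (f p) - t + (y m - (t' - t)))) := by
    cases s
    · have h1 : ∀ᶠ δ in nhdsWithin (0 : ℝ) (Set.Iio 0), ∀ p ∈ P, ∀ d ∈ E,
          (SideLE false d (y (f p) - t) ↔ SideLE s' d (y (f p) - t + δ)) := by
        rw [hf.eventually_all]
        intro p _
        rw [hE.eventually_all]
        exact fun d _ => (eventually_sideLE s').2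
      obtain ⟨a, ha, h2⟩ := (mem_nhdsLT_iff_exists_Ioo_subset).1 h1
      obtain ⟨m, h3, h4⟩ := I.cutProject.exists_between
        (show (t' - t) + a < t' - t by linarith [Set.mem_Iio.1 ha])
      exact ⟨m, h2 ⟨by linarith, by linarith⟩⟩
    · have h1 : ∀ᶠ δ in nhdsWithin (0 : ℝ) (Set.Ioi 0), ∀ p ∈ P, ∀ d ∈ E,
          (SideLE true d (y (f p) - t) ↔ SideLE s' d (y (f p) - t + δ)) := by
        rw [hf.eventually_all]
        intro p _
        rw [hE.eventually_all]
        exact fun d _ => (eventually_sideLE s').1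
      obtain ⟨a, ha, h2⟩ := (mem_nhdsGT_iff_exists_Ioo_subset).1 h1
      obtain ⟨m, h3, h4⟩ := I.cutProject.exists_between
        (show t' - t < (t' - t) + a by linarith [Set.mem_Ioi.1 ha])
      exact ⟨m, h2 ⟨by linarith, by linarith⟩⟩
  obtain ⟨m, hm⟩ := key
  refine ⟨x m, ?_⟩
  rintro _ ⟨p, hp, rfl⟩
  have e : y (f p + m) - t' = y (f p) - t + (y m - (t' - t)) := by rw [map_add]; ring
  have hmem : I.Mem s' (y (f p + m) - t') := by
    rw [e]
    exact ⟨(hm p hp 0 (by simp [E])).1 (hf1 p hp).1,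
      fun h => (hf1 p hp).2 ((hm p hp I.l (by simp [E])).2 h)⟩
  refine ⟨f p + m, hmem, ?_⟩
  have h1 := congrArg Prod.fst (hf2 p hp)
  have h2 := congrArg Prod.snd (hf2 p hp)
  simp only at h1 h2
  simp only [Prod.mk.injEq]
  refine ⟨by rw [h1, map_add], h2.trans (Mem.label_eq _ _ fun d hd => ?_)⟩
  rw [e]
  exact hm p hp d (by simp [E, hd])

theorem locallyIsomorphic_tiling (s s' : Bool) (t t' : ℝ) :
    LocallyIsomorphic (I.tiling s t) (I.tiling s' t') :=
  ⟨exists_translate_tiling_subset s s' t t', exists_translate_tiling_subset s' s t' t⟩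

theorem flipSide_flipSide (ν : ℝ) (s : Bool) : flipSide ν (flipSide ν s) = s := by
  unfold flipSide
  split_ifs <;> simp

/-- Since ν is nonzero, the affine map on lower endpoints in `subst_tiling` can be inverted. -/
theorem exists_iterate_subst_tiling (n : ℕ) (s : Bool) (t : ℝ) :
    ∃ s' t', I.rule.subst^[n] (I.tiling s' t') = I.tiling s t := by
  induction n with
  | zero => exact ⟨s, t, rfl⟩
  | succ n ih =>
    obtain ⟨s', t', h⟩ := ih
    refine ⟨flipSide I.ν s', (t' + I.c) / I.ν, ?_⟩
    rw [Function.iterate_succ_apply, subst_tiling, flipSide_flipSide,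
      mul_div_cancel₀ _ I.ν_ne, add_sub_cancel_right, h]

theorem isSubstitutionTiling_tiling (s : Bool) (t : ℝ) :
    I.rule.IsSubstitutionTiling (I.tiling s t) := by
  refine ⟨isTiling_tiling s t, fun n => ?_⟩
  obtain ⟨s', t', h⟩ := exists_iterate_subst_tiling (I := I) n s t
  exact ⟨_, isTiling_tiling s' t', locallyIsomorphic_tiling s s' t t', h⟩

theorem shape_tiling (Ω : Window) (h : Ω.length = I.l) :
    I.rule.shape (I.tiling Ω.leftClosed Ω.lo) = tilesOf (cutPoints x y Ω.carrier) := by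
  have h1 := (isTiling_tiling (I := I) Ω.leftClosed Ω.lo).image_eq_tilesOf I.rule.len_pos
  refine h1.trans (congrArg tilesOf ?_)
  have h2 : ∀ z, y z ∈ Ω.carrier ↔ I.Mem Ω.leftClosed (y z - Ω.lo) := by
    intro z
    rw [Window.mem_carrier_iff, Mem, ← h, Window.length]
    refine and_congr (sideLE_congr (by ring)) (not_congr (sideLE_congr (by ring)))
  ext a
  constructor
  · rintro ⟨_, ⟨z, hz, rfl⟩, rfl⟩
    exact ⟨z, (h2 z).2 hz, rfl⟩
  · rintro ⟨z, hz, rfl⟩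
    exact ⟨_, ⟨z, (h2 z).1 hz, rfl⟩, rfl⟩

end Inflation

/-! ### Point sets that look locally like a cut and project set -/

/-- Every bounded part of `A` agrees with a translated part of `B`. -/
def LocallyMatches (A B : Set ℝ) : Prop :=
  ∀ R : ℝ, ∃ t : ℝ, ∀ r, |r| ≤ R → (r ∈ A ↔ r + t ∈ B)

/-- A patch reaching one tile length beyond R covers every r with |r| ≤ R. A point that is not a
vertex is interior to a tile of the patch, so its translate is not a vertex either. -/
theorem LocallyIsomorphic.locallyMatches {L : Type} [Finite L] {len : L → ℝ}
    (hlen : ∀ a, 0 < len a) {S T : Set (ℝ × L)} (hS : IsTiling len S) (hT : IsTiling len T)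
    (h : LocallyIsomorphic S T) : LocallyMatches (Prod.fst '' T) (Prod.fst '' S) := by
  intro R
  obtain ⟨C, hC⟩ := (Set.finite_range len).bddAbove
  obtain ⟨t, ht⟩ := h.2 {p ∈ T | |p.1| ≤ R + |C|} (fun p hp => hp.1) (hT.finite_abs_le hlen _)
  refine ⟨t, fun r hr => ⟨?_, fun hr' => ?_⟩⟩
  · rintro ⟨p, hp, rfl⟩
    exact ⟨(p.1 + t, p.2), ht ⟨p, ⟨hp, by linarith [abs_nonneg C]⟩, rfl⟩, rfl⟩
  · obtain ⟨p, hp, h1, h2⟩ := hT.exists_tile r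
    have h3 : len p.2 ≤ C := hC ⟨p.2, rfl⟩
    have h4 := le_abs_self C
    rw [abs_le] at hr
    have h5 : (p.1 + t, p.2) ∈ S :=
      ht ⟨p, ⟨hp, abs_le.2 ⟨by linarith, by linarith⟩⟩, rfl⟩
    obtain ⟨q, hq, hq'⟩ := hr'
    rcases h1.lt_or_eq with h6 | h6
    · exact (hS.not_mem_interior hlen h5 hq (by simp only; linarith)
        (by simp only; linarith)).elim
    · exact ⟨p, hp, h6⟩

theorem Window.mem_iff_not_add_length (Ω : Window) {u : ℝ} (h1 : Ω.lo < u + Ω.length)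
    (h2 : u < Ω.hi) : u ∈ Ω.carrier ↔ u + Ω.length ∉ Ω.carrier := by
  rw [mem_carrier_iff, mem_carrier_iff]
  have h3 : SideLE Ω.leftClosed Ω.hi (u + Ω.length) ↔ SideLE Ω.leftClosed Ω.lo u :=
    sideLE_congr (by rw [length]; ring)
  have h4 := not_sideLE_of_lt (s := Ω.leftClosed) h2
  have h5 := SideLE.of_lt (s := Ω.leftClosed) h1
  rw [h3]
  tauto

namespace IsCutProject

variable {x y : (Fin 2 → ℤ) →+ ℝ}

/-- A set which is locally a translate of a cut and project set, and which meets the projected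
lattice, is a cut and project set for a window of the same length. -/
theorem exists_window (h : IsCutProject x y) (hx : Function.Injective x) (Ω : Window)
    {A : Set ℝ} (hne : ∃ z, x z ∈ A) (hA : LocallyMatches A (cutPoints x y Ω.carrier)) :
    ∃ Ω' : Window, Ω'.length = Ω.length ∧ A = cutPoints x y Ω'.carrier := by
  obtain ⟨z0, hz0⟩ := hne
  -- The known point x z0 of A forces the matching translation to be a projected lattice vector.
  have hm : ∀ R, |x z0| ≤ R → ∃ m, ∀ r, |r| ≤ R →
      (r ∈ A ↔ r + x m ∈ cutPoints x y Ω.carrier) := by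
    intro R hR
    obtain ⟨t, ht⟩ := hA R
    obtain ⟨z1, -, h2⟩ := (ht _ hR).1 hz0
    refine ⟨z1 - z0, ?_⟩
    rw [map_sub, h2, add_sub_cancel_left]
    exact ht
  have hrange : ∀ r ∈ A, ∃ z, x z = r := by
    intro r hr
    obtain ⟨m, h1⟩ := hm (max |x z0| |r|) (le_max_left _ _)
    obtain ⟨z, -, h2⟩ := (h1 r (le_max_right _ _)).1 hr
    exact ⟨z - m, by rw [map_sub, h2, add_sub_cancel_right]⟩
  -- In internal space: on any finite set of lattice points, A looks like the window translated by -
  -- y m.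
  have hB : ∀ F : Finset (Fin 2 → ℤ), ∃ m, ∀ z ∈ F, (x z ∈ A ↔ y z + y m ∈ Ω.carrier) := by
    intro F
    obtain ⟨m, h1⟩ := hm (|x z0| + ∑ z ∈ F, |x z|)
      (le_add_of_nonneg_right (Finset.sum_nonneg fun _ _ => abs_nonneg _))
    refine ⟨m, fun z hz => ?_⟩
    have h2 : |x z| ≤ ∑ z ∈ F, |x z| :=
      Finset.single_le_sum (f := fun z => |x z|) (fun _ _ => abs_nonneg _) hz
    rw [h1 _ (by linarith [abs_nonneg (x z0)])]
    constructor
    · rintro ⟨z', h3, h4⟩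
      rw [← map_add] at h4
      rw [← map_add, ← hx h4]
      exact h3
    · intro h3
      exact ⟨z + m, by rwa [map_add], map_add _ _ _⟩
  have hlen : Ω.hi - Ω.lo = Ω.length := rfl
  have hpos := Ω.length_pos
  set l := Ω.length
  have hdiff : ∀ z z', x z ∈ A → x z' ∈ A → y z ≤ y z' + l := by
    intro z z' h1 h2
    obtain ⟨m, hm⟩ := hB {z, z'}
    have h3 := Ω.carrier_subset_Icc ((hm z (by simp)).1 h1)
    have h4 := Ω.carrier_subset_Icc ((hm z' (by simp)).1 h2)
    linarith [h3.2, h4.1]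
  set U := {u | ∃ z, x z ∈ A ∧ y z = u} with hU
  have hUne : U.Nonempty := ⟨y z0, z0, hz0, rfl⟩
  have hUb : BddBelow U := ⟨y z0 - l, by
    rintro _ ⟨z, hz, rfl⟩
    linarith [hdiff z0 z hz0 hz]⟩
  set s := sInf U with hs
  have hlow : ∀ z, x z ∈ A → s ≤ y z := fun z hz => csInf_le hUb ⟨z, hz, rfl⟩
  have hupp : ∀ z, x z ∈ A → y z ≤ s + l := by
    intro z hz
    have : y z - l ≤ s := le_csInf hUne (by
      rintro _ ⟨z', hz', rfl⟩
      linarith [hdiff z z' hz hz'])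
    linarith
  -- A translated window that contains z', but neither w on its left nor z on its right, would have
  -- to fit between y w and y z, whose distance is less than l.
  have hinner : ∀ z, s < y z → y z < s + l → x z ∈ A := by
    intro z h1 h2
    by_contra hz
    obtain ⟨_, ⟨z', hz', rfl⟩, h3⟩ := exists_lt_of_csInf_lt hUne h1
    obtain ⟨w, h4, h5⟩ := h.exists_between (show y z - l < s by linarith)
    have hw : x w ∉ A := fun hw => absurd (hlow w hw) (not_le.2 h5)
    obtain ⟨m, hm⟩ := hB {z, z', w}
    have e1 := (hm z' (by simp)).1 hz'
    have e1' := Ω.carrier_subset_Icc e1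
    have e2 : y z + y m ∉ Ω.carrier := fun h => hz ((hm z (by simp)).2 h)
    have e3 : y w + y m ∉ Ω.carrier := fun h => hw ((hm w (by simp)).2 h)
    have e4 : Ω.hi ≤ y z + y m := by
      by_contra! h6
      exact e2 (Ω.Ioo_subset_carrier ⟨by linarith [e1'.1], h6⟩)
    have e5 : y w + y m ≤ Ω.lo := by
      by_contra! h6
      exact e3 (Ω.Ioo_subset_carrier ⟨h6, by linarith [e1'.2, hlow z' hz']⟩)
    linarith
  obtain ⟨zi, hzi1, hzi2⟩ := h.exists_between (show s < s + l by linarith)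
  have hziA := hinner zi hzi1 hzi2
  have hends : ∀ z z', y z = s → y z' = s + l → (x z ∈ A ↔ x z' ∉ A) := by
    intro z z' h1 h2
    obtain ⟨m, hm⟩ := hB {z, z', zi}
    have e1 := Ω.carrier_subset_Icc ((hm zi (by simp)).1 hziA)
    rw [hm z (by simp), hm z' (by simp), Ω.mem_iff_not_add_length (by linarith [e1.1])
      (by linarith [e1.2]), h2, h1]
    have : s + y m + Ω.length = s + l + y m := by ring
    rw [this]
  classical
  -- Possibly only one end is the coordinate of a lattice point, so the closed side is read off at
  -- either end. If neither is, the default false is as good as true.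
  let side : Bool := decide ((∃ z, x z ∈ A ∧ y z = s) ∨ ∃ z, x z ∉ A ∧ y z = s + l)
  have hside : side = true ↔ (∃ z, x z ∈ A ∧ y z = s) ∨ ∃ z, x z ∉ A ∧ y z = s + l :=
    decide_eq_true_iff
  refine ⟨⟨s, s + l, by linarith, side⟩, add_sub_cancel_left _ _, ?_⟩
  have key : ∀ z, x z ∈ A ↔ y z ∈ (Window.mk s (s + l) (by linarith) side).carrier := by
    intro z
    rw [Window.mem_carrier_iff]
    simp only
    rcases lt_trichotomy (y z) s with h1 | h1 | h1
    · exact iff_of_false (fun hz => absurd (hlow z hz) (not_le.2 h1))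
        fun hz => absurd hz.1 (not_sideLE_of_lt h1)
    · have h2 : ¬ SideLE side (s + l) (y z) := not_sideLE_of_lt (by linarith)
      have h3 : SideLE side s (y z) ↔ side = true := by simp [SideLE, h1]
      rw [and_iff_left h2, h3, hside]
      constructor
      · exact fun hz => Or.inl ⟨z, hz, h1⟩
      · rintro (⟨z', h4, h5⟩ | ⟨z', h4, h5⟩)
        · rwa [h.y_injective (h1.trans h5.symm)]
        · exact (hends z z' h1 h5).2 h4
    rcases lt_trichotomy (y z) (s + l) with h2 | h2 | h2
    · exact iff_of_true (hinner z h1 h2) ⟨.of_lt h1, not_sideLE_of_lt h2⟩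
    · have h3 : SideLE side (s + l) (y z) ↔ side = true := by simp [SideLE, h2]
      rw [and_iff_right (SideLE.of_lt h1), h3, hside]
      constructor
      · rintro hz (⟨z', h4, h5⟩ | ⟨z', h4, h5⟩)
        · exact (hends z' z h5 h2).1 h4 hz
        · rw [h.y_injective (h5.trans h2.symm)] at h4
          exact h4 hz
      · intro h4
        by_contra hz
        exact h4 (Or.inr ⟨z, hz, h2⟩)
    · exact iff_of_false (fun hz => absurd (hupp z hz) (not_le.2 h2))
        fun hz => absurd (SideLE.of_lt h2) hz.2
  ext r
  constructor
  · intro hr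
    obtain ⟨z, rfl⟩ := hrange r hr
    exact ⟨z, (key z).1 hr, rfl⟩
  · rintro ⟨z, hz, rfl⟩
    exact (key z).2 hz

/-- If the inflated vertices of a projection tiling lie in a set that looks locally like the tiling,
then the projected lattice is invariant under the inflation. -/
theorem exists_mul_eq (h : IsCutProject x y) (Ω : Window) {A : Set ℝ} {lam : ℝ}
    (hA : LocallyMatches A (cutPoints x y Ω.carrier))
    (hinfl : ∀ a ∈ cutPoints x y Ω.carrier, lam * a ∈ A) (z : Fin 2 → ℤ) :
    ∃ z', x z' = lam * x z := by
  -- Such an m is the difference of two points of the strip. The inflated vertices translate to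
  -- vertices, whose difference is a projected lattice point.
  have key : ∀ m, |y m| < Ω.length → ∃ z', x z' = lam * x m := by
    intro m hm
    rw [abs_lt, Window.length] at hm
    obtain ⟨z0, h1, h2⟩ := h.exists_between
      (show max Ω.lo (Ω.lo - y m) < min Ω.hi (Ω.hi - y m) from
        max_lt (lt_min (by linarith) (by linarith)) (lt_min (by linarith) (by linarith)))
    rw [max_lt_iff] at h1
    rw [lt_min_iff] at h2
    have e1 := hinfl (x z0) ⟨z0, Ω.Ioo_subset_carrier ⟨h1.1, h2.1⟩, rfl⟩
    have e2 := hinfl (x (z0 + m)) ⟨z0 + m, Ω.Ioo_subset_carrier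
      (by rw [map_add]; exact ⟨by linarith, by linarith⟩), rfl⟩
    obtain ⟨t, ht⟩ := hA (max |lam * x z0| |lam * x (z0 + m)|)
    obtain ⟨w, -, hw⟩ := (ht _ (le_max_left _ _)).1 e1
    obtain ⟨w', -, hw'⟩ := (ht _ (le_max_right _ _)).1 e2
    refine ⟨w' - w, ?_⟩
    rw [map_sub, hw, hw', map_add]
    ring
  -- Division with remainder by y m: the vectors treated in `key` generate ℤ².
  obtain ⟨m, h1, h2⟩ := h.exists_between Ω.length_pos
  obtain ⟨z1, hz1⟩ := key m (by rwa [abs_of_pos h1])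
  have h3 := Int.floor_le (y z / y m)
  have h4 := Int.lt_floor_add_one (y z / y m)
  set k := ⌊y z / y m⌋
  rw [le_div_iff₀ h1] at h3
  rw [div_lt_iff₀ h1, add_mul, one_mul] at h4
  have h5 : y (z - k • m) = y z - k * y m := by
    rw [map_sub, map_zsmul, zsmul_eq_mul]
  obtain ⟨z2, hz2⟩ := key (z - k • m) (by
    rw [h5, abs_of_nonneg (by linarith)]
    linarith)
  refine ⟨z2 + k • z1, ?_⟩
  rw [map_add, map_zsmul, hz2, hz1, map_sub, map_zsmul, zsmul_eq_mul, zsmul_eq_mul]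
  ring

/-! ### Rational window directions -/

/-- A kernel vector is an integer relation between the values at the basis, so all values are
multiples of one number g. The image is then not dense, hence cyclic. -/
theorem exists_cyclic_generator (x : (Fin 2 → ℤ) →+ ℝ) {k p : Fin 2 → ℤ} (hk : k ≠ 0)
    (hxk : x k = 0) (hp : x p ≠ 0) :
    ∃ e : Fin 2 → ℤ, x e ≠ 0 ∧ ∀ z, ∃ n : ℤ, x z = n * x e := by
  have hlin : ∀ z, x z = z 0 * x ![1, 0] + z 1 * x ![0, 1] := by
    intro z
    have : z = z 0 • ![1, 0] + z 1 • ![0, 1] := by ext i; fin_cases i <;> simp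
    conv_lhs => rw [this]
    rw [map_add, map_zsmul, map_zsmul, zsmul_eq_mul, zsmul_eq_mul]
  have hg : ∃ g : ℝ, g ≠ 0 ∧ ∀ z, ∃ n : ℤ, x z = n * g := by
    rw [hlin] at hxk
    by_cases h1 : k 1 = 0
    · have h0 : (k 0 : ℝ) ≠ 0 := by
        intro h0
        refine hk (funext fun i => ?_)
        fin_cases i
        · exact_mod_cast h0
        · exact h1
      have ha : x ![1, 0] = 0 := by simpa [h1, h0] using hxk
      refine ⟨x ![0, 1], fun hb => hp ?_, fun z => ⟨z 1, ?_⟩⟩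
      · rw [hlin, ha, hb]; ring
      · rw [hlin, ha]; ring
    · have h1' : (k 1 : ℝ) ≠ 0 := by exact_mod_cast h1
      have hb : x ![0, 1] = - (k 0 * x ![1, 0]) / k 1 := by
        rw [eq_div_iff h1']; linarith
      refine ⟨x ![1, 0] / k 1, fun ha => hp ?_, fun z => ⟨z 0 * k 1 - z 1 * k 0, ?_⟩⟩
      · have ha' : x ![1, 0] = 0 := by simpa [h1'] using ha
        rw [hlin, hb, ha']; ring
      · rw [hlin, hb]
        push_cast
        field_simp
        ring
  obtain ⟨g, hg0, hg⟩ := hg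
  rcases AddSubgroup.dense_or_cyclic x.range with hd | ⟨a, ha⟩
  · exfalso
    obtain ⟨_, ⟨z, rfl⟩, h1, h2⟩ := hd.exists_between (abs_pos.2 hg0)
    obtain ⟨n, hn⟩ := hg z
    have h3 : |x z| < |g| := by rwa [abs_of_pos h1]
    rw [hn, abs_mul] at h3
    have h4 : |(n : ℝ)| < 1 := by
      by_contra! h5
      nlinarith [abs_pos.2 hg0]
    have h5 : n = 0 := by
      rw [← Int.cast_abs] at h4
      exact Int.abs_lt_one_iff.1 (by exact_mod_cast h4)
    rw [hn, h5] at h1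
    simp at h1
  · have hmem : a ∈ x.range := by
      rw [ha]
      exact AddSubgroup.subset_closure rfl
    obtain ⟨e, rfl⟩ := hmem
    have hz : ∀ z, ∃ n : ℤ, x z = n * x e := by
      intro z
      have : x z ∈ x.range := ⟨z, rfl⟩
      rw [ha, AddSubgroup.mem_closure_singleton] at this
      obtain ⟨n, hn⟩ := this
      exact ⟨n, by rw [← hn, zsmul_eq_mul]⟩
    refine ⟨e, fun he => hp ?_, hz⟩
    obtain ⟨n, hn⟩ := hz p
    rw [hn, he, mul_zero]

theorem exists_kernel_generator (h : IsCutProject x y) {k : Fin 2 → ℤ} (hk : k ≠ 0)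
    (hxk : x k = 0) :
    ∃ e : Fin 2 → ℤ, x e = 0 ∧ 0 < y e ∧ ∀ z, x z = 0 → ∃ n : ℤ, y z = n * y e := by
  have hk' : ∃ k, x k = 0 ∧ 0 < y k := by
    have : y k ≠ 0 := fun h0 => hk (h.y_injective (by rw [h0, map_zero]))
    rcases this.lt_or_gt with h1 | h1
    · exact ⟨-k, by simp [hxk], by simpa using h1⟩
    · exact ⟨k, hxk, h1⟩
  obtain ⟨k, hxk, hyk⟩ := hk'
  have hfin : {z | x z = 0 ∧ 0 < y z ∧ y z ≤ y k}.Finite :=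
    (h.finite_of_bounds 0 0 0 (y k)).subset fun z ⟨h1, h2, h3⟩ => ⟨h1.ge, h1.le, h2.le, h3⟩
  obtain ⟨e, ⟨h1, h2, h3⟩, hmin⟩ :=
    Set.exists_min_image _ (fun z => y z) hfin ⟨k, hxk, hyk, le_rfl⟩
  refine ⟨e, h1, h2, fun z hz => ?_⟩
  have hleast : IsLeast {g : ℝ | g ∈ x.ker.map y ∧ 0 < g} (y e) := by
    refine ⟨⟨⟨e, h1, rfl⟩, h2⟩, ?_⟩
    rintro _ ⟨⟨z', h4, rfl⟩, h5⟩
    rcases le_or_gt (y z') (y k) with h6 | h6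
    · exact hmin z' ⟨h4, h5, h6⟩
    · exact h3.trans h6.le
  have h4 := AddSubgroup.cyclic_of_min hleast
  have h5 : y z ∈ x.ker.map y := ⟨z, hz, rfl⟩
  rw [h4, AddSubgroup.mem_closure_singleton] at h5
  obtain ⟨n, hn⟩ := h5
  exact ⟨n, by rw [← hn, zsmul_eq_mul]⟩

/-- For a rational window direction, a nonperiodic projection tiling has no inflation. -/
theorem x_injective_of_inflation (h : IsCutProject x y) (Ω : Window)
    (hnp : ∀ t, (∀ a, a ∈ cutPoints x y Ω.carrier ↔ a + t ∈ cutPoints x y Ω.carrier) → t = 0)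
    {A : Set ℝ} {lam : ℝ} (hlam : 1 < lam)
    (hA : LocallyMatches A (cutPoints x y Ω.carrier))
    (hinfl : ∀ a ∈ cutPoints x y Ω.carrier, lam * a ∈ A) : Function.Injective x := by
  rw [injective_iff_map_eq_zero]
  intro k hxk
  by_contra hk
  obtain ⟨p, hp, -⟩ := h.exists_step one_pos
  obtain ⟨e, he, hgen⟩ := exists_cyclic_generator x hk hxk hp.ne'
  obtain ⟨q, hq, hκ, hker⟩ := h.exists_kernel_generator hk hxk
  set κ := y q
  obtain ⟨j, hj⟩ : ∃ j : ℤ, lam = j := by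
    obtain ⟨z', hz'⟩ := h.exists_mul_eq Ω hA hinfl e
    obtain ⟨j, hj⟩ := hgen z'
    exact ⟨j, mul_right_cancel₀ he (hz'.symm.trans hj)⟩
  have hj2 : (2 : ℝ) ≤ j := by
    rw [hj] at hlam
    have : (1 : ℤ) < j := by exact_mod_cast hlam
    exact_mod_cast this
  have hpos := Ω.length_pos
  -- A window of length at least κ meets every class modulo κ. Then every projected lattice point
  -- would be a vertex and x e a period.
  have hlκ : Ω.length < κ := by
    by_contra! hle
    have hall : ∀ z, x z ∈ cutPoints x y Ω.carrier := by
      intro z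
      have hn : ∃ n : ℤ, y z + n • κ ∈ Ω.carrier := by
        rw [Window.length] at hle
        unfold Window.carrier
        split_ifs
        · obtain ⟨n, hn, -⟩ := existsUnique_add_zsmul_mem_Ico hκ (y z) Ω.lo
          exact ⟨n, hn.1, by linarith [hn.2]⟩
        · obtain ⟨n, hn, -⟩ := existsUnique_add_zsmul_mem_Ioc hκ (y z) Ω.lo
          exact ⟨n, hn.1, by linarith [hn.2]⟩
      obtain ⟨n, hn⟩ := hn
      exact ⟨z + n • q, by rwa [map_add, map_zsmul], by rw [map_add, map_zsmul, hq]; simp⟩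
    refine he (hnp (x e) fun a => ⟨?_, ?_⟩)
    · rintro ⟨z, -, rfl⟩
      rw [← map_add]
      exact hall _
    · rintro ⟨z, -, hz⟩
      rw [← eq_sub_iff_add_eq.2 hz.symm |>.symm, ← map_sub]
      exact hall _
  set l := Ω.length with hl
  have hlen : Ω.hi - Ω.lo = l := rfl
  -- With N this large, a step of internal size below 3l/(4N) stays below κ - l even after
  -- multiplication by j. A size above l/(2N) makes N steps span more than l/2, and starting in the
  -- lowest quarter they all stay in the window.
  obtain ⟨N, hN⟩ := exists_nat_gt (j * l / (κ - l))
  have hκl : 0 < κ - l := by linarith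
  have hN0 : (0 : ℝ) < N := lt_of_le_of_lt (by positivity) hN
  rw [div_lt_iff₀ hκl] at hN
  obtain ⟨m, hm1, hm2⟩ := h.exists_between
    (show l / (2 * N) < 3 * l / (4 * N) by
      rw [div_lt_div_iff₀ (by positivity) (by positivity)]
      nlinarith [mul_pos hN0 hpos])
  rw [div_lt_iff₀ (by positivity)] at hm1
  rw [lt_div_iff₀ (by positivity)] at hm2
  obtain ⟨z0, hz1, hz2⟩ := h.exists_between (show Ω.lo < Ω.lo + l / 4 by linarith)
  have hym : 0 < y m := by
    by_contra! h0
    nlinarith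
  have hstrip : ∀ i : ℕ, i ≤ N → y (z0 + i • m) ∈ Ω.carrier := by
    intro i hi
    have hi' : (i : ℝ) ≤ N := by exact_mod_cast hi
    apply Ω.Ioo_subset_carrier
    rw [map_add, map_nsmul, nsmul_eq_mul]
    constructor
    · have := mul_nonneg (Nat.cast_nonneg (α := ℝ) i) hym.le
      linarith
    · have := mul_le_mul_of_nonneg_right hi' hym.le
      linarith
  obtain ⟨t, ht⟩ := hA (|lam| * (|x z0| + N * |x m|))
  have hw : ∀ i : ℕ, i ≤ N → ∃ w, y w ∈ Ω.carrier ∧ x w = lam * x (z0 + i • m) + t := by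
    intro i hi
    refine (ht _ ?_).1 (hinfl _ ⟨_, hstrip i hi, rfl⟩)
    rw [abs_mul, map_add, map_nsmul, nsmul_eq_mul]
    have hi' : (i : ℝ) ≤ N := by exact_mod_cast hi
    gcongr
    refine (abs_add_le _ _).trans ?_
    rw [abs_mul, Nat.abs_cast]
    gcongr
  choose! w hw1 hw2 using hw
  have hjm : j * y m < κ - l := by
    have h1 : N * (j * y m) < N * (κ - l) := by nlinarith
    exact lt_of_mul_lt_mul_left h1 hN0.le
  -- The increment is known modulo κ. Both points lie in the window and l + j y m < κ, so the
  -- multiple of κ vanishes.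
  have hstep : ∀ i : ℕ, i + 1 ≤ N → y (w (i + 1)) = y (w i) + j * y m := by
    intro i hi
    obtain ⟨n, hn⟩ := hker (w (i + 1) - w i - j • m) (by
      rw [map_sub, map_sub, hw2 _ hi, hw2 i (by omega), map_zsmul, hj, map_add, map_add,
        map_nsmul, map_nsmul, zsmul_eq_mul, nsmul_eq_mul, nsmul_eq_mul]
      push_cast
      ring)
    rw [map_sub, map_sub, map_zsmul, zsmul_eq_mul] at hn
    have c1 := Ω.carrier_subset_Icc (hw1 _ hi)
    have c2 := Ω.carrier_subset_Icc (hw1 i (by omega))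
    have hjy : 0 < j * y m := by positivity
    have h1 : |n * κ| < κ := by
      rw [← hn, abs_lt]
      constructor <;> linarith [c1.1, c1.2, c2.1, c2.2]
    rw [abs_mul, abs_of_pos hκ] at h1
    have h2 : |(n : ℝ)| < 1 := by
      by_contra! h5
      nlinarith
    have h3 : n = 0 := by
      rw [← Int.cast_abs] at h2
      exact Int.abs_lt_one_iff.1 (by exact_mod_cast h2)
    rw [h3] at hn
    push_cast at hn
    linarith
  have hsum : ∀ i : ℕ, i ≤ N → y (w i) = y (w 0) + i * (j * y m) := by
    intro i
    induction i with
    | zero => intro; simp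
    | succ i ih =>
      intro hi
      rw [hstep i hi, ih (by omega)]
      push_cast
      ring
  have c1 := Ω.carrier_subset_Icc (hw1 N le_rfl)
  have c2 := Ω.carrier_subset_Icc (hw1 0 (Nat.zero_le _))
  have h1 := hsum N le_rfl
  -- Inflation would multiply the internal span, already above l/2, by j ≥ 2: more than the window
  -- can hold.
  have h2 : l < N * (j * y m) := by
    have h3 : 2 * (N * y m) ≤ j * (N * y m) := by
      apply mul_le_mul_of_nonneg_right hj2
      positivity
    linarith
  linarith [c1.2, c2.1]

end IsCutProject

/-! ### The linear map of an inflation -/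

namespace IsCutProject

variable {x y : (Fin 2 → ℤ) →+ ℝ}

theorem exists_hom_of_mul_eq (hx : Function.Injective x) {lam : ℝ}
    (h : ∀ z, ∃ z', x z' = lam * x z) :
    ∃ M : (Fin 2 → ℤ) →+ (Fin 2 → ℤ), ∀ z, x (M z) = lam * x z := by
  choose f hf using h
  exact ⟨AddMonoidHom.mk' f fun a b => hx (by rw [map_add, hf, hf, hf, map_add, mul_add]), hf⟩

/-- On the strip y and y ∘ M are bounded while x is not, so y ∘ M has no x-component. -/
theorem exists_contraction (h : IsCutProject x y)
    (hspan : ∀ g : (Fin 2 → ℤ) →+ ℝ, ∃ α β : ℝ, ∀ z, g z = α * x z + β * y z)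
    {M : (Fin 2 → ℤ) →+ (Fin 2 → ℤ)} {Ω Ω' : Window}
    (hM : ∀ z, y z ∈ Ω.carrier → y (M z) ∈ Ω'.carrier) : ∃ ν : ℝ, ∀ z, y (M z) = ν * y z := by
  obtain ⟨α, β, hαβ⟩ := hspan (y.comp M)
  have hα : α = 0 := by
    by_contra hα
    obtain ⟨K, hK, hstrip⟩ := h.exists_mem_carrier Ω
    have ha := abs_pos.2 hα
    set C := |Ω'.lo| + |Ω'.hi| + |β| * (|Ω.lo| + |Ω.hi|) with hC
    obtain ⟨z, hz1, -, hz2⟩ := hstrip ((C + 1) / |α|)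
    have h1 := Ω.carrier_subset_Icc hz2
    have h2 := Ω'.carrier_subset_Icc (hM z hz2)
    have h3 : α * x z = y (M z) - β * y z := by
      have := hαβ z
      simp only [AddMonoidHom.comp_apply] at this
      linarith
    have h4 : |y z| ≤ |Ω.lo| + |Ω.hi| := by
      rw [abs_le]
      constructor
      · linarith [h1.1, neg_abs_le Ω.lo, abs_nonneg Ω.hi]
      · linarith [h1.2, le_abs_self Ω.hi, abs_nonneg Ω.lo]
    have h5 : |y (M z)| ≤ |Ω'.lo| + |Ω'.hi| := by
      rw [abs_le]
      constructor
      · linarith [h2.1, neg_abs_le Ω'.lo, abs_nonneg Ω'.hi]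
      · linarith [h2.2, le_abs_self Ω'.hi, abs_nonneg Ω'.lo]
    have h6 : |α * x z| ≤ C := by
      rw [h3]
      refine (abs_sub _ _).trans ?_
      rw [abs_mul, hC]
      gcongr
    rw [div_le_iff₀ ha] at hz1
    rw [abs_mul] at h6
    nlinarith [le_abs_self (x z)]
  refine ⟨β, fun z => ?_⟩
  have := hαβ z
  rw [hα, zero_mul, zero_add] at this
  exact this

theorem map_Icc (h : IsCutProject x y) {M : (Fin 2 → ℤ) →+ (Fin 2 → ℤ)} {ν : ℝ}
    (hyM : ∀ z, y (M z) = ν * y z) {Ω Ω' : Window}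
    (hM : ∀ z, y z ∈ Ω.carrier → y (M z) ∈ Ω'.carrier) {u : ℝ} (hu : u ∈ Set.Icc Ω.lo Ω.hi) :
    ν * u ∈ Set.Icc Ω'.lo Ω'.hi := by
  have h1 : IsClosed {u | ν * u ∈ Set.Icc Ω'.lo Ω'.hi} :=
    isClosed_Icc.preimage (by fun_prop : Continuous fun u : ℝ => ν * u)
  have h2 : Set.Ioo Ω.lo Ω.hi ⊆ closure (Set.Ioo Ω.lo Ω.hi ∩ Set.range y) :=
    h.dense_range.open_subset_closure_inter isOpen_Ioo
  have h3 : closure (Set.Ioo Ω.lo Ω.hi ∩ Set.range y) ⊆ {u | ν * u ∈ Set.Icc Ω'.lo Ω'.hi} := by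
    refine closure_minimal ?_ h1
    rintro _ ⟨h4, z, rfl⟩
    have := Ω'.carrier_subset_Icc (hM z (Ω.Ioo_subset_carrier h4))
    rwa [hyM] at this
  rw [← closure_Ioo Ω.lo_lt_hi.ne] at hu
  exact h3 (closure_minimal h2 isClosed_closure hu)

/-- Equal window lengths give |ν| ≤ 1. If ν² = 1, then M² would fix the lattice by injectivity of y,
although it multiplies x by lam² > 1. If ν = 0, then M would vanish. -/
theorem contraction_bounds (h : IsCutProject x y)
    {M : (Fin 2 → ℤ) →+ (Fin 2 → ℤ)} {ν lam : ℝ} (hlam : 1 < lam)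
    (hxM : ∀ z, x (M z) = lam * x z) (hyM : ∀ z, y (M z) = ν * y z) {Ω Ω' : Window}
    (hlen : Ω'.length = Ω.length)
    (hM : ∀ z, y z ∈ Ω.carrier → y (M z) ∈ Ω'.carrier) : ν ≠ 0 ∧ |ν| < 1 := by
  obtain ⟨p, hp, -⟩ := h.exists_step one_pos
  have hp0 : ∀ z, x z = x p → z ≠ 0 := by
    rintro z hz rfl
    rw [map_zero] at hz
    linarith
  have hle : |ν| ≤ 1 := by
    have h1 := h.map_Icc hyM hM (Set.left_mem_Icc.2 Ω.lo_lt_hi.le)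
    have h2 := h.map_Icc hyM hM (Set.right_mem_Icc.2 Ω.lo_lt_hi.le)
    have hpos := Ω.length_pos
    have h3 : |ν * Ω.length| ≤ 1 * Ω.length := by
      rw [one_mul, abs_le]
      unfold Window.length at *
      constructor <;> nlinarith [h1.1, h1.2, h2.1, h2.2]
    rw [abs_mul, abs_of_pos hpos] at h3
    exact le_of_mul_le_mul_right h3 hpos
  have hsq : ν * ν ≠ 1 := by
    intro h1
    have h2 : M (M p) = p := h.y_injective (by rw [hyM, hyM, ← mul_assoc, h1, one_mul])
    have h3 := congrArg x h2
    rw [hxM, hxM] at h3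
    nlinarith [mul_pos hp (sub_pos.2 hlam)]
  refine ⟨?_, lt_of_le_of_ne hle fun h1 => hsq ?_⟩
  · rintro rfl
    have h2 : M p = 0 := h.y_injective (by rw [hyM, zero_mul, map_zero])
    have h3 := hxM p
    rw [h2, map_zero] at h3
    nlinarith
  · rw [← abs_mul_abs_self, h1, one_mul]

end IsCutProject

/-! ### Substitution tilings with the shape of a projection tiling -/

/-- A substitution tiling whose images under the substitution rule have the vertices of projection
tilings, with the induced action on the lattice. -/
structure InflatedTiling (x y : (Fin 2 → ℤ) →+ ℝ) (L : Type) where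
  cutProject : IsCutProject x y
  x_injective : Function.Injective x
  rule : SubstitutionRule L
  S : Set (ℝ × L)
  isSubst : rule.IsSubstitutionTiling S
  Ω : ℕ → Window
  verts : ∀ n, Prod.fst '' rule.subst^[n] S = cutPoints x y (Ω n).carrier
  length_eq : ∀ n, (Ω n).length = (Ω 0).length
  M : (Fin 2 → ℤ) →+ (Fin 2 → ℤ)
  ν : ℝ
  x_M : ∀ z, x (M z) = rule.factor * x z
  y_M : ∀ z, y (M z) = ν * y z
  ν_ne : ν ≠ 0
  ν_lt : |ν| < 1

namespace InflatedTiling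

variable {x y : (Fin 2 → ℤ) →+ ℝ} {L : Type} (T : InflatedTiling x y L)

theorem x_iterate (n : ℕ) (z : Fin 2 → ℤ) : x (T.M^[n] z) = T.rule.factor ^ n * x z := by
  induction n with
  | zero => simp
  | succ n ih => rw [Function.iterate_succ_apply', T.x_M, ih, pow_succ']; ring

theorem y_iterate (n : ℕ) (z : Fin 2 → ℤ) : y (T.M^[n] z) = T.ν ^ n * y z := by
  induction n with
  | zero => simp
  | succ n ih => rw [Function.iterate_succ_apply', T.y_M, ih, pow_succ']; ring

theorem mem_cutPoints_iff (J : Set ℝ) (hx : Function.Injective x) (z : Fin 2 → ℤ) :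
    x z ∈ cutPoints x y J ↔ y z ∈ J :=
  ⟨fun ⟨_, h1, h2⟩ => hx h2 ▸ h1, fun h => ⟨z, h, rfl⟩⟩

theorem x_mem_verts (n : ℕ) (z : Fin 2 → ℤ) :
    x z ∈ Prod.fst '' T.rule.subst^[n] T.S ↔ y z ∈ (T.Ω n).carrier := by
  rw [T.verts, mem_cutPoints_iff _ T.x_injective]

theorem exists_tile_at {z : Fin 2 → ℤ} (hz : y z ∈ (T.Ω 0).carrier) : ∃ p ∈ T.S, p.1 = x z :=
  (T.x_mem_verts 0 z).2 hz

theorem isTiling : IsTiling T.rule.len T.S := T.isSubst.1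

theorem map_mem {n : ℕ} {z : Fin 2 → ℤ} (hz : y z ∈ (T.Ω n).carrier) :
    y (T.M z) ∈ (T.Ω (n + 1)).carrier := by
  rw [← T.x_mem_verts] at hz ⊢
  rw [T.x_M, Function.iterate_succ_apply']
  exact T.rule.factor_mul_mem hz

/-- The tiles that start at distance less than `K` to the right of a vertex. -/
def patch (K : ℝ) (z : Fin 2 → ℤ) : Set (ℝ × L) := {p ∈ T.S | x z ≤ p.1 ∧ p.1 < x z + K}

theorem mem_patch_of_cover {K : ℝ} {z : Fin 2 → ℤ} (hz : y z ∈ (T.Ω 0).carrier) {p : ℝ × L}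
    (hp : p ∈ T.S) {r : ℝ} (h1 : x z ≤ r) (h2 : r < x z + K) (h3 : p.1 ≤ r)
    (h4 : r < p.1 + T.rule.len p.2) : p ∈ T.patch K z := by
  refine ⟨hp, ?_, by linarith⟩
  by_contra! h5
  obtain ⟨q, hq, hq'⟩ := T.exists_tile_at hz
  exact T.isTiling.not_mem_interior T.rule.len_pos hp hq (by linarith) (by linarith)

theorem translate_patch_symm {K : ℝ} {z z' : Fin 2 → ℤ} (hz : y z ∈ (T.Ω 0).carrier)
    (h : translateTiles (x z' - x z) (T.patch K z) ⊆ T.S) :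
    translateTiles (x z - x z') (T.patch K z') ⊆ T.S := by
  rintro _ ⟨p, ⟨hp, h1, h2⟩, rfl⟩
  obtain ⟨q, hq, h3, h4⟩ := T.isTiling.exists_tile (p.1 + (x z - x z'))
  have hqp := T.mem_patch_of_cover (K := K) hz hq (by linarith) (by linarith) h3 h4
  have hq' : (q.1 + (x z' - x z), q.2) ∈ T.S := h ⟨q, hqp, rfl⟩
  have heq := T.isTiling.eq_of_mem_tile hp hq' (x := p.1) le_rfl
    (by linarith [T.rule.len_pos p.2]) (by simp only; linarith) (by simp only; linarith)
  have e1 := congrArg Prod.fst heq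
  have e2 := congrArg Prod.snd heq
  simp only at e1 e2
  have : (p.1 + (x z - x z'), p.2) = q := Prod.ext (by simp only; linarith) e2
  simp only [this]
  exact hq

/-- A vertex of the n-th image in this range belongs to the image of a tile of the patch, and that
tile recurs at z'. -/
theorem verts_of_translate_patch {K : ℝ} {z z' : Fin 2 → ℤ} (hz : y z ∈ (T.Ω 0).carrier)
    (h : translateTiles (x z' - x z) (T.patch K z) ⊆ T.S) (n : ℕ) {r : ℝ}
    (h1 : T.rule.factor ^ n * x z ≤ r) (h2 : r < T.rule.factor ^ n * (x z + K))
    (hr : r ∈ Prod.fst '' T.rule.subst^[n] T.S) :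
    r + T.rule.factor ^ n * (x z' - x z) ∈ Prod.fst '' T.rule.subst^[n] T.S := by
  obtain ⟨q, hq, rfl⟩ := hr
  obtain ⟨p, hp, hqp⟩ := (T.rule.mem_iterate_subst_iff n).1 hq
  obtain ⟨h3, h4⟩ := T.rule.mem_iterate_supertile n hqp
  have hf := pow_pos T.rule.factor_pos n
  have hpp : p ∈ T.patch K z := by
    refine T.mem_patch_of_cover hz hp (r := q.1 / T.rule.factor ^ n) ?_ ?_ ?_ ?_
    · rw [le_div_iff₀ hf]; linarith
    · rw [div_lt_iff₀ hf]; linarith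
    · rw [le_div_iff₀ hf]; linarith
    · rw [div_lt_iff₀ hf]; linarith [T.rule.len_pos q.2]
  have h5 : (q.1 + T.rule.factor ^ n * (x z' - x z), q.2) ∈
      T.rule.subst^[n] (translateTiles (x z' - x z) (T.patch K z)) := by
    rw [T.rule.iterate_subst_translateTiles]
    exact ⟨q, (T.rule.mem_iterate_subst_iff n).2 ⟨p, hpp, hqp⟩, rfl⟩
  obtain ⟨p', hp', h6⟩ := (T.rule.mem_iterate_subst_iff n).1 h5
  exact ⟨_, (T.rule.mem_iterate_subst_iff n).2 ⟨p', h hp', h6⟩, rfl⟩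

/-- Equal patches have equal images under all powers of the substitution rule. -/
theorem mem_iff_of_translate_patch {K : ℝ} {z z' : Fin 2 → ℤ} (hz : y z ∈ (T.Ω 0).carrier)
    (hz' : y z' ∈ (T.Ω 0).carrier) (h : translateTiles (x z' - x z) (T.patch K z) ⊆ T.S)
    (n : ℕ) {m : Fin 2 → ℤ} (h0 : 0 ≤ x m) (h1 : x m < T.rule.factor ^ n * K) :
    T.ν ^ n * y z + y m ∈ (T.Ω n).carrier ↔ T.ν ^ n * y z' + y m ∈ (T.Ω n).carrier := by
  have key : ∀ z z', y z ∈ (T.Ω 0).carrier →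
      translateTiles (x z' - x z) (T.patch K z) ⊆ T.S →
      T.ν ^ n * y z + y m ∈ (T.Ω n).carrier → T.ν ^ n * y z' + y m ∈ (T.Ω n).carrier := by
    intro z z' hz h h2
    rw [← T.y_iterate, ← map_add, ← T.x_mem_verts] at h2 ⊢
    have h3 := T.verts_of_translate_patch hz h n
      (by rw [map_add, T.x_iterate]; linarith)
      (by rw [map_add, T.x_iterate]; linarith) h2
    convert h3 using 1
    rw [map_add, map_add, T.x_iterate, T.x_iterate]
    ring
  exact ⟨key z z' hz h, key z' z hz' (T.translate_patch_symm hz h)⟩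

/-! #### Finitely many cuts -/

/-- The positions in the window at which the pattern of an inflated patch of radius `K` changes. -/
def cuts (K : ℝ) : Set ℝ :=
  {p | (T.Ω 0).lo < p ∧ p < (T.Ω 0).hi ∧ ∃ n m, 0 ≤ x m ∧ x m < T.rule.factor ^ n * K ∧
    (T.ν ^ n * p + y m = (T.Ω n).lo ∨ T.ν ^ n * p + y m = (T.Ω n).hi)}

theorem not_mem_iff_mem (Ω : Window) {e t t' : ℝ} (he : e = Ω.lo ∨ e = Ω.hi)
    (h : t * t' < 0) (ht : |t| < Ω.length) (ht' : |t'| < Ω.length) :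
    ¬ (e + t ∈ Ω.carrier ↔ e + t' ∈ Ω.carrier) := by
  have key : ∀ t t', t < 0 → 0 < t' → |t| < Ω.length → |t'| < Ω.length →
      ¬ (e + t ∈ Ω.carrier ↔ e + t' ∈ Ω.carrier) := by
    intro t t' h1 h2 h3 h4 h5
    rw [abs_lt, Window.length] at h3 h4
    rcases he with rfl | rfl
    · have h6 := h5.2 (Ω.Ioo_subset_carrier ⟨by linarith, by linarith⟩)
      linarith [(Ω.carrier_subset_Icc h6).1]
    · have h6 := h5.1 (Ω.Ioo_subset_carrier ⟨by linarith, by linarith⟩)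
      linarith [(Ω.carrier_subset_Icc h6).2]
  rcases mul_neg_iff.1 h with ⟨h1, h2⟩ | ⟨h1, h2⟩
  · exact fun h5 => key t' t h2 h1 ht' ht h5.symm
  · exact key t t' h1 h2 ht ht'

/-- The affine map t ↦ ν^n t + y m sends p to an end of Ω n and contracts distances. So it sends
exactly one of y z, y z' into Ω n, and the n-th images of the two patches differ. -/
theorem patch_ne_of_cut {K p : ℝ} (hp : p ∈ T.cuts K) {z z' : Fin 2 → ℤ}
    (hz : y z ∈ (T.Ω 0).carrier) (hz' : y z' ∈ (T.Ω 0).carrier) (h1 : y z < p) (h2 : p < y z') :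
    ¬ translateTiles (x z' - x z) (T.patch K z) ⊆ T.S := by
  intro h
  obtain ⟨hp1, hp2, n, m, hm0, hm1, hm⟩ := hp
  have h3 := T.mem_iff_of_translate_patch hz hz' h n hm0 hm1
  have hz1 := (T.Ω 0).carrier_subset_Icc hz
  have hz1' := (T.Ω 0).carrier_subset_Icc hz'
  have hν : |T.ν ^ n| ≤ 1 := by
    rw [abs_pow]
    exact pow_le_one₀ (abs_nonneg _) T.ν_lt.le
  have hb : ∀ d, |d| < (T.Ω 0).length → |T.ν ^ n * d| < (T.Ω n).length := by
    intro d hd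
    rw [T.length_eq, abs_mul]
    nlinarith [abs_nonneg d, abs_nonneg (T.ν ^ n)]
  have e1 : T.ν ^ n * y z + y m = (T.ν ^ n * p + y m) + T.ν ^ n * (y z - p) := by ring
  have e2 : T.ν ^ n * y z' + y m = (T.ν ^ n * p + y m) + T.ν ^ n * (y z' - p) := by ring
  rw [e1, e2] at h3
  refine not_mem_iff_mem (T.Ω n) hm ?_ (hb _ ?_) (hb _ ?_) h3
  · have h4 : 0 < T.ν ^ n * T.ν ^ n := mul_self_pos.2 (pow_ne_zero n T.ν_ne)
    have h5 : (y z - p) * (y z' - p) < 0 := mul_neg_of_neg_of_pos (by linarith) (by linarith)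
    nlinarith
  · rw [abs_lt, Window.length]
    constructor <;> linarith [hz1.1, hz1.2]
  · rw [abs_lt, Window.length]
    constructor <;> linarith [hz1'.1, hz1'.2]

/-- The patch to the right of a vertex, translated to the origin. -/
def relPatch (K : ℝ) (z : Fin 2 → ℤ) : Set (ℝ × L) := translateTiles (- x z) (T.patch K z)

/-- Relative tile positions are x-values of lattice vectors in a bounded box, and there are finitely
many labels. -/
theorem finite_relPatch [Finite L] (K : ℝ) :
    {P | ∃ z, y z ∈ (T.Ω 0).carrier ∧ T.relPatch K z = P}.Finite := by
  have hF : (x '' {m | 0 ≤ x m ∧ x m ≤ K ∧ -(T.Ω 0).length ≤ y m ∧ y m ≤ (T.Ω 0).length}).Finite :=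
    (T.cutProject.finite_of_bounds _ _ _ _).image _
  refine (hF.prod (Set.finite_univ (α := L))).finite_subsets.subset ?_
  rintro _ ⟨z, hz, rfl⟩ _ ⟨p, ⟨hp, h1, h2⟩, rfl⟩
  have h3 : p.1 ∈ cutPoints x y (T.Ω 0).carrier := by
    rw [← T.verts]
    exact ⟨p, hp, rfl⟩
  obtain ⟨w, hw, hw'⟩ := h3
  have c1 := (T.Ω 0).carrier_subset_Icc hz
  have c2 := (T.Ω 0).carrier_subset_Icc hw
  refine ⟨⟨w - z, ⟨?_, ?_, ?_, ?_⟩, ?_⟩, trivial⟩ <;> rw [map_sub]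
  · linarith
  · linarith
  · rw [Window.length]; linarith [c1.2, c2.1]
  · rw [Window.length]; linarith [c1.1, c2.2]
  · simp only; linarith

theorem translate_patch_of_relPatch_eq {K : ℝ} {z z' : Fin 2 → ℤ}
    (h : T.relPatch K z = T.relPatch K z') :
    translateTiles (x z' - x z) (T.patch K z) ⊆ T.S := by
  have h1 : translateTiles (x z' - x z) (T.patch K z) = T.patch K z' := by
    have := congrArg (translateTiles (x z')) h
    rw [relPatch, relPatch, translateTiles_translateTiles, translateTiles_translateTiles,
      neg_add_cancel] at this
    rw [sub_eq_neg_add, this]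
    simp [translateTiles]
  rw [h1]
  exact fun p hp => hp.1

/-- Send a cut to the set of patches seen to the left of it. For cuts p < p' the patch of a vertex
between them occurs to the left of p', but not of p, since p separates patches. So this is an
injection into a finite set, whatever n defines the cuts. -/
theorem finite_cuts [Finite L] (K : ℝ) : (T.cuts K).Finite := by
  refine Set.Finite.of_finite_image (f := fun p => {P | ∃ z, y z ∈ (T.Ω 0).carrier ∧ y z < p ∧
    T.relPatch K z = P}) ?_ ?_
  · refine (T.finite_relPatch K).finite_subsets.subset ?_
    rintro _ ⟨p, -, rfl⟩ P ⟨z, hz, -, h⟩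
    exact ⟨z, hz, h⟩
  · have key : ∀ p ∈ T.cuts K, ∀ p' ∈ T.cuts K, p < p' →
        {P | ∃ z, y z ∈ (T.Ω 0).carrier ∧ y z < p ∧ T.relPatch K z = P} ≠
        {P | ∃ z, y z ∈ (T.Ω 0).carrier ∧ y z < p' ∧ T.relPatch K z = P} := by
      intro p hp p' hp' hlt heq
      obtain ⟨z, h1, h2⟩ := T.cutProject.exists_between hlt
      have hz : y z ∈ (T.Ω 0).carrier :=
        (T.Ω 0).Ioo_subset_carrier ⟨hp.1.trans h1, h2.trans hp'.2.1⟩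
      have h3 : T.relPatch K z ∈
          {P | ∃ z, y z ∈ (T.Ω 0).carrier ∧ y z < p' ∧ T.relPatch K z = P} := ⟨z, hz, h2, rfl⟩
      rw [← heq] at h3
      obtain ⟨z', hz', h4, h5⟩ := h3
      exact T.patch_ne_of_cut hp hz' hz h4 h1 (T.translate_patch_of_relPatch_eq h5)
    intro p hp p' hp' heq
    by_contra hne
    rcases lt_or_gt_of_ne hne with h | h
    · exact key p hp p' hp' h heq
    · exact key p' hp' p hp h heq.symm

/-- A lattice vector z brings the pulled-back end into Ω 0 and at the same time brings x (m + M^n z)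
into [0, factor^n K). One K serves all n because the strips are relatively dense uniformly in their
position. With `finite_cuts` this feeds the pigeonhole arguments below. -/
theorem exists_radius : ∃ K > 0, ∀ (n : ℕ) (e : ℝ) (m : Fin 2 → ℤ),
    (e = (T.Ω n).lo ∨ e = (T.Ω n).hi) → ∃ z, (e - y m) / T.ν ^ n - y z ∈ T.cuts K := by
  obtain ⟨K, hK, h⟩ := T.cutProject.exists_mem_strip (T.Ω 0).length_pos
  refine ⟨K, hK, fun n e m he => ?_⟩
  have hf := pow_pos T.rule.factor_pos n
  have hν := pow_ne_zero n T.ν_ne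
  obtain ⟨z, h1, h2, h3, h4⟩ := h ((e - y m) / T.ν ^ n - (T.Ω 0).hi) (- x m / T.rule.factor ^ n)
  rw [div_le_iff₀ hf] at h1
  rw [← sub_lt_iff_lt_add, lt_div_iff₀ hf] at h2
  have e1 : T.ν ^ n * ((e - y m) / T.ν ^ n - y z) + y (m + T.M^[n] z) = e := by
    rw [map_add, T.y_iterate, mul_sub, mul_div_cancel₀ _ hν]
    ring
  refine ⟨z, ?_, ?_, n, m + T.M^[n] z, ?_, ?_, ?_⟩
  · rw [Window.length] at h4; linarith
  · linarith
  · rw [map_add, T.x_iterate]; linarith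
  · rw [map_add, T.x_iterate]; linarith
  · rwa [e1]

/-! #### The lattice map is onto -/

/-- Pull back the lower ends, both shifted by y m and unshifted. Two indices i < j give the same
pair of cuts, and subtracting yields ν^(j-i) y m - y m = ν^j y w. So m differs from an image under M
by another such image. -/
theorem surjective_M [Finite L] : Function.Surjective T.M := by
  intro m
  obtain ⟨K, -, h⟩ := T.exists_radius
  choose f hf using fun n => h n _ 0 (Or.inl rfl)
  choose g hg using fun n => h n _ m (Or.inl rfl)
  obtain ⟨i, j, hij, heq⟩ := ((T.finite_cuts K).prod (T.finite_cuts K)).exists_lt_map_eq_of_forall_mem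
    (fun n => Set.mk_mem_prod (hf n) (hg n))
  rw [Prod.mk.injEq, map_zero, sub_zero, sub_zero] at heq
  obtain ⟨h1, h2⟩ := heq
  obtain ⟨k, rfl⟩ := Nat.exists_eq_add_of_lt hij
  have hνi := pow_ne_zero i T.ν_ne
  have hνj := pow_ne_zero (i + k + 1) T.ν_ne
  rw [sub_div, sub_div] at h2
  have h3 : y m / T.ν ^ i - y m / T.ν ^ (i + k + 1) =
      y (f i - f (i + k + 1) - g i + g (i + k + 1)) := by
    simp only [map_add, map_sub]
    linarith
  set w := f i - f (i + k + 1) - g i + g (i + k + 1)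
  have h4 : T.ν ^ (k + 1) * y m - y m = T.ν ^ (i + k + 1) * y w := by
    have h5 : T.ν ^ (i + k + 1) * (y m / T.ν ^ i) = T.ν ^ (k + 1) * y m := by
      rw [add_assoc, pow_add _ i]
      field_simp
    rw [← h3, mul_sub, mul_div_cancel₀ _ hνj, h5]
  refine ⟨T.M^[k] m - T.M^[i + k] w, T.cutProject.y_injective ?_⟩
  rw [T.y_M, map_sub, T.y_iterate, T.y_iterate]
  rw [pow_succ', pow_succ'] at h4
  linarith

/-! #### The offset of the windows -/

theorem exists_supertile_at {z : Fin 2 → ℤ} (hz : y z ∈ (T.Ω 1).carrier) :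
    ∃ p ∈ T.S, ∃ q ∈ T.rule.subst {p}, q.1 = x z := by
  obtain ⟨q, hq, hq'⟩ := (T.x_mem_verts 1 z).2 hz
  obtain ⟨p, hp, hpq⟩ := T.rule.mem_subst_iff.1 hq
  exact ⟨p, hp, q, hpq, hq'⟩

/-- A patch of the tiling can carry vertices close to both ends of Ω 0 and, after substitution,
vertices close to both ends of Ω 1. Where it recurs in the n-th image, translated by x m, y m is
within ε of the shift from Ω 0 to Ω n, and ν y m within ε of the shift from Ω 1 to Ω (n + 1). -/
theorem offset_eq (n : ℕ) :
    T.ν * (T.Ω n).lo - (T.Ω (n + 1)).lo = T.ν * (T.Ω 0).lo - (T.Ω 1).lo := by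
  have key : ∀ ε > 0, |T.ν * ((T.Ω n).lo - (T.Ω 0).lo) -
      ((T.Ω (n + 1)).lo - (T.Ω 1).lo)| ≤ 2 * ε := by
    intro ε hε
    have hnear : ∀ k, ∃ a b, y a ∈ (T.Ω k).carrier ∧ y b ∈ (T.Ω k).carrier ∧
        y a < (T.Ω k).lo + ε ∧ (T.Ω k).hi - ε < y b := by
      intro k
      have hlt := (T.Ω k).lo_lt_hi
      obtain ⟨a, ha1, ha2⟩ := T.cutProject.exists_between
        (show (T.Ω k).lo < min (T.Ω k).hi ((T.Ω k).lo + ε) from lt_min hlt (by linarith))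
      obtain ⟨b, hb1, hb2⟩ := T.cutProject.exists_between
        (show max (T.Ω k).lo ((T.Ω k).hi - ε) < (T.Ω k).hi from max_lt hlt (by linarith))
      rw [lt_min_iff] at ha2
      rw [max_lt_iff] at hb1
      exact ⟨a, b, (T.Ω k).Ioo_subset_carrier ⟨ha1, ha2.1⟩,
        (T.Ω k).Ioo_subset_carrier ⟨hb1.1, hb2⟩, ha2.2, hb1.2⟩
    obtain ⟨a, b, ha, hb, ha', hb'⟩ := hnear 0
    obtain ⟨c, d, hc, hd, hc', hd'⟩ := hnear 1
    obtain ⟨pa, hpa, hpa'⟩ := T.exists_tile_at ha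
    obtain ⟨pb, hpb, hpb'⟩ := T.exists_tile_at hb
    obtain ⟨pc, hpc, qc, hqc, hqc'⟩ := T.exists_supertile_at hc
    obtain ⟨pd, hpd, qd, hqd, hqd'⟩ := T.exists_supertile_at hd
    obtain ⟨t, ht⟩ := (T.isSubst.locallyIsomorphic_iterate n).1 {pa, pb, pc, pd}
      (by rintro p (rfl | rfl | rfl | rfl) <;> assumption) (Set.toFinite _)
    have hvert : ∀ p ∈ ({pa, pb, pc, pd} : Set (ℝ × L)),
        p.1 + t ∈ Prod.fst '' T.rule.subst^[n] T.S :=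
      fun p hp => ⟨_, ht ⟨p, hp, rfl⟩, rfl⟩
    obtain ⟨m, rfl⟩ : ∃ m, t = x m := by
      have h1 := hvert pa (by simp)
      rw [T.verts] at h1
      obtain ⟨w, -, hw⟩ := h1
      exact ⟨w - a, by rw [map_sub, hw, hpa']; ring⟩
    have hsub := T.rule.subst_mono ht
    rw [T.rule.subst_translateTiles, ← Function.iterate_succ_apply' (f := T.rule.subst)] at hsub
    have h0 : ∀ z p, p ∈ ({pa, pb, pc, pd} : Set (ℝ × L)) → p.1 = x z →
        y z + y m ∈ (T.Ω n).carrier := by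
      intro z p hp hpz
      have := hvert p hp
      rwa [hpz, ← map_add, T.x_mem_verts, map_add] at this
    have h1 : ∀ z p q, p ∈ ({pa, pb, pc, pd} : Set (ℝ × L)) → q ∈ T.rule.subst {p} →
        q.1 = x z → y z + T.ν * y m ∈ (T.Ω (n + 1)).carrier := by
      intro z p q hp hq hqz
      have h2 : q.1 + T.rule.factor * x m ∈ Prod.fst '' T.rule.subst^[n + 1] T.S :=
        ⟨_, hsub ⟨q, T.rule.mem_subst_iff.2 ⟨p, hp, hq⟩, rfl⟩, rfl⟩
      rwa [hqz, ← T.x_M, ← map_add, T.x_mem_verts, map_add, T.y_M] at h2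
    have ba := (T.Ω n).carrier_subset_Icc (h0 a pa (by simp) hpa')
    have bb := (T.Ω n).carrier_subset_Icc (h0 b pb (by simp) hpb')
    have bc := (T.Ω (n + 1)).carrier_subset_Icc (h1 c pc qc (by simp) hqc hqc')
    have bd := (T.Ω (n + 1)).carrier_subset_Icc (h1 d pd qd (by simp) hqd hqd')
    have ln := T.length_eq n
    have ln1 := T.length_eq (n + 1)
    have l1 := T.length_eq 1
    unfold Window.length at ln ln1 l1
    have b1 : |y m - ((T.Ω n).lo - (T.Ω 0).lo)| ≤ ε := by
      rw [abs_le]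
      constructor <;> linarith [ba.1, bb.2]
    have b2 : |T.ν * y m - ((T.Ω (n + 1)).lo - (T.Ω 1).lo)| ≤ ε := by
      rw [abs_le]
      constructor <;> linarith [bc.1, bd.2]
    have b3 : |T.ν * (y m - ((T.Ω n).lo - (T.Ω 0).lo))| ≤ ε := by
      rw [abs_mul]
      nlinarith [T.ν_lt, abs_nonneg T.ν, abs_nonneg (y m - ((T.Ω n).lo - (T.Ω 0).lo))]
    rw [abs_le] at b2 b3 ⊢
    constructor <;> linarith
  have h0 : T.ν * ((T.Ω n).lo - (T.Ω 0).lo) - ((T.Ω (n + 1)).lo - (T.Ω 1).lo) = 0 := by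
    by_contra hne
    have h1 := abs_pos.2 hne
    have := key _ (div_pos h1 (by norm_num : (0 : ℝ) < 4))
    linarith
  linarith

/-- P is the fixed point of the affine recursion that `offset_eq` gives for the lower ends. -/
theorem lo_eq (n : ℕ) (P : ℝ) (hP : (T.ν - 1) * P = T.ν * (T.Ω 0).lo - (T.Ω 1).lo) :
    (T.Ω n).lo = P + T.ν ^ n * ((T.Ω 0).lo - P) := by
  induction n with
  | zero => simp
  | succ n ih =>
    have h := T.offset_eq n
    have h1 : (T.Ω (n + 1)).lo = T.ν * (T.Ω n).lo - (T.ν - 1) * P := by linarith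
    rw [h1, ih, pow_succ']
    ring

/-- The offset and the length of the windows lie in every field that contains the internal
coordinates of the lattice and the contraction factor. -/
theorem offset_mem_and_length_mem [Finite L] (F : IntermediateField ℚ ℝ) (hF : ∀ z, y z ∈ F)
    (hν : T.ν ∈ F) :
    T.ν * (T.Ω 0).lo - (T.Ω 1).lo ∈ F ∧ (T.Ω 0).length ∈ F := by
  have hν1 : T.ν - 1 ≠ 0 := by
    have := T.ν_lt
    rw [abs_lt] at this
    linarith
  obtain ⟨P, hP⟩ : ∃ P, (T.ν - 1) * P = T.ν * (T.Ω 0).lo - (T.Ω 1).lo :=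
    ⟨_, mul_div_cancel₀ _ hν1⟩
  obtain ⟨K, -, h⟩ := T.exists_radius
  -- Pulled back, the ends are C + Q / ν^n. Two of them agree modulo the lattice, and the unknown C
  -- cancels from the difference, leaving an equation for Q over F.
  have key : ∀ (e : ℕ → ℝ) (C Q : ℝ), (∀ n, e n = (T.Ω n).lo ∨ e n = (T.Ω n).hi) →
      (∀ n, e n = T.ν ^ n * C + Q) → Q ∈ F := by
    intro e C Q he hC
    choose f hf using fun n => h n (e n) 0 (he n)
    obtain ⟨i, j, hij, heq⟩ := (T.finite_cuts K).exists_lt_map_eq_of_forall_mem hf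
    have hi := pow_ne_zero i T.ν_ne
    have hj := pow_ne_zero j T.ν_ne
    have hne : T.ν ^ i ≠ T.ν ^ j := by
      intro h1
      have h2 := congrArg abs h1
      rw [abs_pow, abs_pow] at h2
      exact (pow_right_strictAnti₀ (abs_pos.2 T.ν_ne) T.ν_lt).injective.ne hij.ne h2
    rw [map_zero, sub_zero, sub_zero, hC, hC, add_div, add_div, mul_div_cancel_left₀ _ hi,
      mul_div_cancel_left₀ _ hj] at heq
    have h3 : Q * (T.ν ^ j - T.ν ^ i) = T.ν ^ i * T.ν ^ j * y (f i - f j) := by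
      rw [map_sub]
      have : Q / T.ν ^ i - Q / T.ν ^ j = y (f i) - y (f j) := by linarith
      rw [← this]
      field_simp
    have h4 : Q = T.ν ^ i * T.ν ^ j * y (f i - f j) / (T.ν ^ j - T.ν ^ i) := by
      rw [← h3, mul_div_cancel_right₀ _ (sub_ne_zero.2 hne.symm)]
    rw [h4]
    exact div_mem (mul_mem (mul_mem (pow_mem hν _) (pow_mem hν _)) (hF _))
      (sub_mem (pow_mem hν _) (pow_mem hν _))
  have hPF : P ∈ F := key (fun n => (T.Ω n).lo) ((T.Ω 0).lo - P) P (fun n => Or.inl rfl)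
    fun n => by rw [T.lo_eq n P hP]; ring
  have hPl : P + (T.Ω 0).length ∈ F :=
    key (fun n => (T.Ω n).hi) ((T.Ω 0).lo - P) _ (fun n => Or.inr rfl) fun n => by
      have h1 := T.length_eq n
      have h2 := T.lo_eq n P hP
      rw [Window.length] at h1
      linarith
  refine ⟨?_, ?_⟩
  · rw [← hP]
    exact mul_mem (sub_mem hν (one_mem F)) hPF
  · have := sub_mem hPl hPF
    rwa [add_sub_cancel_left] at this

/-! #### Singular windows -/

/-- If a tiling contains a patch without repetition, then every locally isomorphic tiling is a
translate of it. -/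
theorem _root_.LocallyIsomorphic.eq_translate {len : L → ℝ} {S U : Set (ℝ × L)}
    (hlen : ∀ a, 0 < len a) (hS : IsTiling len S) (hU : IsTiling len U)
    (h : LocallyIsomorphic S U) {Q : Set (ℝ × L)} (hQ : Q ⊆ S) (hQf : Q.Finite)
    (huniq : ∀ t, translateTiles t Q ⊆ S → t = 0) : ∃ t, U = translateTiles t S := by
  -- Two occurrences of Q in U would recur together in S, which has only one.
  have hQU : ∀ t t', translateTiles t Q ⊆ U → translateTiles t' Q ⊆ U → t = t' := by
    intro t t' h1 h2
    obtain ⟨s, hs⟩ := h.2 (translateTiles t Q ∪ translateTiles t' Q) (Set.union_subset h1 h2)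
      ((hQf.image _).union (hQf.image _))
    have e : ∀ r, translateTiles r Q ⊆ translateTiles t Q ∪ translateTiles t' Q → r + s = 0 := by
      intro r hr
      refine huniq _ ?_
      rw [← translateTiles_translateTiles]
      exact (translateTiles_mono s hr).trans hs
    linarith [e t Set.subset_union_left, e t' Set.subset_union_right]
  obtain ⟨t, ht⟩ := h.1 Q hQ hQf
  refine ⟨t, ((hS.translate t).eq_of_subset hU hlen ?_).symm⟩
  rintro _ ⟨p, hp, rfl⟩
  -- The tile p recurs together with Q, so it is moved by the translation that Q prescribes.
  obtain ⟨t', ht'⟩ := h.1 (insert p Q) (Set.insert_subset hp hQ) (hQf.insert p)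
  obtain rfl := hQU t t' ht ((translateTiles_mono t' (Set.subset_insert p Q)).trans ht')
  exact ht' ⟨p, Set.mem_insert p Q, rfl⟩

/-- The hypotheses say that f + t lies in Ω 0 exactly when f' + ν t lies in Ω 1, for small t ≠ 0. If
this fails at t = 0, a patch that determines the vertex status of z0 and, after substitution, of z1
cannot recur elsewhere: equal patches at internal distance t ≠ 0 would equate both statuses with the
same sign condition on t. A patch without repetition makes the locally isomorphic image a translate.
-/
theorem exists_translate_of_mismatch [Finite L] {f f' s : ℝ} {z0 z1 : Fin 2 → ℤ}
    (h0 : y z0 = f) (h1 : y z1 = f')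
    (hf : ∀ t, t ≠ 0 → |t| < (T.Ω 0).length → (f + t ∈ (T.Ω 0).carrier ↔ s * t < 0))
    (hf' : ∀ t, t ≠ 0 → |t| < (T.Ω 0).length →
      (f' + t ∈ (T.Ω 1).carrier ↔ s * (T.ν * t) < 0))
    (hne : ¬ (f ∈ (T.Ω 0).carrier ↔ f' ∈ (T.Ω 1).carrier)) :
    ∃ t, T.rule.subst T.S = translateTiles t T.S := by
  have hfac := T.rule.factor_pos
  -- The vertex o lies to the left of z0 and of the deflated z1, and the radius K reaches both.
  obtain ⟨C, hC, hstrip⟩ := T.cutProject.exists_mem_carrier (T.Ω 0)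
  obtain ⟨o, -, ho1, ho⟩ := hstrip (min (x z0) (x z1 / T.rule.factor) - C)
  rw [sub_add_cancel, lt_min_iff, lt_div_iff₀ hfac] at ho1
  set K := |x z0 - x o| + |x z1 / T.rule.factor - x o| + 1 with hK
  have hKpos : 0 < K := by positivity
  have huniq : ∀ z, y z ∈ (T.Ω 0).carrier →
      translateTiles (x z - x o) (T.patch K o) ⊆ T.S → z = o := by
    intro z hz htr
    by_contra hzo
    have hτ : y z - y o ≠ 0 := fun h => hzo (T.cutProject.y_injective (sub_eq_zero.1 h))
    have c0 := T.mem_iff_of_translate_patch ho hz htr 0 (m := z0 - o)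
      (by rw [map_sub]; linarith) (by
        rw [map_sub, pow_zero, one_mul]
        linarith [le_abs_self (x z0 - x o), abs_nonneg (x z1 / T.rule.factor - x o)])
    have c1 := T.mem_iff_of_translate_patch ho hz htr 1 (m := z1 - T.M o)
      (by rw [map_sub, T.x_M]; linarith) (by
        rw [map_sub, T.x_M, pow_one]
        have e1 : x z1 - T.rule.factor * x o = T.rule.factor * (x z1 / T.rule.factor - x o) := by
          rw [mul_sub, mul_div_cancel₀ _ hfac.ne']
        rw [e1]
        refine mul_lt_mul_of_pos_left ?_ hfac
        linarith [le_abs_self (x z1 / T.rule.factor - x o), abs_nonneg (x z0 - x o)])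
    have hlt : |y z - y o| < (T.Ω 0).length := by
      have b1 := ((T.Ω 0).mem_carrier_iff _).1 hz
      have b2 := ((T.Ω 0).mem_carrier_iff _).1 ho
      have b3 := (T.Ω 0).carrier_subset_Icc hz
      have b4 := (T.Ω 0).carrier_subset_Icc ho
      by_contra! h5
      rw [Window.length] at h5
      rcases le_abs.1 h5 with h6 | h6
      · have e1 : y z = (T.Ω 0).hi := by linarith [b3.2, b4.1]
        have e2 : y o = (T.Ω 0).lo := by linarith [b3.2, b4.1]
        rw [e1] at b1
        rw [e2] at b2
        cases hs : (T.Ω 0).leftClosed <;> rw [hs] at b1 b2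
        · simp [SideLE] at b2
        · simp [SideLE] at b1
      · have e1 : y o = (T.Ω 0).hi := by linarith [b3.1, b4.2]
        have e2 : y z = (T.Ω 0).lo := by linarith [b3.1, b4.2]
        rw [e1] at b2
        rw [e2] at b1
        cases hs : (T.Ω 0).leftClosed <;> rw [hs] at b1 b2
        · simp [SideLE] at b1
        · simp [SideLE] at b2
    have hlt' : |T.ν * (y z - y o)| < (T.Ω 0).length := by
      rw [abs_mul]
      nlinarith [T.ν_lt, abs_nonneg T.ν, abs_nonneg (y z - y o)]
    have e0 : T.ν ^ 0 * y o + y (z0 - o) = f := by rw [map_sub, ← h0]; ring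
    have e0' : T.ν ^ 0 * y z + y (z0 - o) = f + (y z - y o) := by rw [map_sub, ← h0]; ring
    have e1 : T.ν ^ 1 * y o + y (z1 - T.M o) = f' := by rw [map_sub, ← h1, T.y_M]; ring
    have e1' : T.ν ^ 1 * y z + y (z1 - T.M o) = f' + T.ν * (y z - y o) := by
      rw [map_sub, ← h1, T.y_M]; ring
    rw [e0, e0', hf _ hτ hlt] at c0
    rw [e1, e1', hf' _ (mul_ne_zero T.ν_ne hτ) hlt'] at c1
    apply hne
    rw [c0, c1]
    have h6 : 0 < T.ν * T.ν := mul_self_pos.2 T.ν_ne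
    have h7 : s * (T.ν * (T.ν * (y z - y o))) = (T.ν * T.ν) * (s * (y z - y o)) := by ring
    rw [h7]
    constructor
    · exact fun h => mul_neg_of_pos_of_neg h6 h
    · intro h
      by_contra! h8
      exact absurd (mul_nonneg h6.le h8) (not_le.2 h)
  have hiso := T.isSubst.locallyIsomorphic_iterate 1
  refine hiso.eq_translate T.rule.len_pos T.isTiling (T.rule.isTiling_iterate_subst T.isTiling 1)
    (Q := T.patch K o) (fun p hp => hp.1) ?_ ?_
  · refine (T.isTiling.finite_abs_le T.rule.len_pos (|x o| + K)).subset ?_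
    rintro p ⟨hp, h2, h3⟩
    refine ⟨hp, abs_le.2 ⟨?_, ?_⟩⟩
    · linarith [neg_abs_le (x o)]
    · linarith [le_abs_self (x o)]
  · intro t ht
    obtain ⟨p, hp, hp'⟩ := T.exists_tile_at ho
    have h2 : (p.1 + t, p.2) ∈ T.S := ht ⟨p, ⟨hp, by linarith, by linarith⟩, rfl⟩
    have h3 : p.1 + t ∈ cutPoints x y (T.Ω 0).carrier := by
      rw [← T.verts]
      exact ⟨_, h2, rfl⟩
    obtain ⟨z, hz, hzt⟩ := h3
    have h4 : t = x z - x o := by linarith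
    rw [h4] at ht ⊢
    rw [huniq z hz ht, sub_self]

theorem _root_.Window.lo_le_lo_of_forall_mem (h : IsCutProject x y) {Ω Ω' : Window} {c : ℝ}
    (hm : ∀ z, y z ∈ Ω.carrier → y z + c ∈ Ω'.carrier) :
    Ω'.lo ≤ Ω.lo + c ∧ Ω.hi + c ≤ Ω'.hi := by
  have hlt := Ω.lo_lt_hi
  constructor
  · by_contra! h1
    obtain ⟨z, h2, h3⟩ := h.exists_between
      (show Ω.lo < min Ω.hi (Ω'.lo - c) from lt_min hlt (by linarith))
    rw [lt_min_iff] at h3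
    have := Ω'.carrier_subset_Icc (hm z (Ω.Ioo_subset_carrier ⟨h2, h3.1⟩))
    linarith [this.1]
  · by_contra! h1
    obtain ⟨z, h2, h3⟩ := h.exists_between
      (show max Ω.lo (Ω'.hi - c) < Ω.hi from max_lt hlt (by linarith))
    rw [max_lt_iff] at h2
    have := Ω'.carrier_subset_Icc (hm z (Ω.Ioo_subset_carrier ⟨h2.1, h3⟩))
    linarith [this.2]

/-- In case of a mismatch the windows themselves are translates by some y m. Then `hend` identifies
f' with the translate of f, so the two memberships agree after all. -/
theorem not_mismatch [Finite L] {f f' s : ℝ} {z0 z1 : Fin 2 → ℤ}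
    (h0 : y z0 = f) (h1 : y z1 = f')
    (hf : ∀ t, t ≠ 0 → |t| < (T.Ω 0).length → (f + t ∈ (T.Ω 0).carrier ↔ s * t < 0))
    (hf' : ∀ t, t ≠ 0 → |t| < (T.Ω 0).length →
      (f' + t ∈ (T.Ω 1).carrier ↔ s * (T.ν * t) < 0))
    (hend : ∀ m, (T.Ω 1).lo = (T.Ω 0).lo + y m → (T.Ω 1).hi = (T.Ω 0).hi + y m → f' = f + y m) :
    f ∈ (T.Ω 0).carrier ↔ f' ∈ (T.Ω 1).carrier := by
  by_contra hne
  obtain ⟨t, ht⟩ := T.exists_translate_of_mismatch h0 h1 hf hf' hne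
  have hv : ∀ r, r ∈ cutPoints x y (T.Ω 0).carrier ↔ r + t ∈ cutPoints x y (T.Ω 1).carrier := by
    intro r
    rw [← T.verts, ← T.verts, Function.iterate_one, ht]
    constructor
    · rintro ⟨p, hp, rfl⟩
      exact ⟨_, ⟨p, hp, rfl⟩, rfl⟩
    · rintro ⟨_, ⟨p, hp, rfl⟩, hpt⟩
      exact ⟨p, hp, by simpa using hpt⟩
  obtain ⟨C, -, hstrip⟩ := T.cutProject.exists_mem_carrier (T.Ω 0)
  obtain ⟨o, -, -, ho⟩ := hstrip 0
  obtain ⟨w, -, hw⟩ := (hv (x o)).1 ⟨o, ho, rfl⟩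
  obtain ⟨m, rfl⟩ : ∃ m, t = x m := ⟨w - o, by rw [map_sub, hw]; ring⟩
  have hmem : ∀ z, y z ∈ (T.Ω 0).carrier ↔ y z + y m ∈ (T.Ω 1).carrier := by
    intro z
    rw [← mem_cutPoints_iff (T.Ω 0).carrier T.x_injective, hv, ← map_add, ← map_add,
      mem_cutPoints_iff _ T.x_injective]
  have b1 := Window.lo_le_lo_of_forall_mem T.cutProject fun z hz => (hmem z).1 hz
  have l1 := T.length_eq 1
  unfold Window.length at l1
  have h2 := hend m (by linarith [b1.1, b1.2]) (by linarith [b1.1, b1.2])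
  apply hne
  rw [h2, ← h0]
  exact hmem z0

end InflatedTiling

/-! ### Scaling and flipping of windows -/

namespace Window

/-- The image of a window under multiplication by `ν`. -/
noncomputable def scale (ν : ℝ) (hν : ν ≠ 0) (Ω : Window) : Window where
  lo := if 0 < ν then ν * Ω.lo else ν * Ω.hi
  hi := if 0 < ν then ν * Ω.hi else ν * Ω.lo
  lo_lt_hi := by
    split_ifs with h
    · exact mul_lt_mul_of_pos_left Ω.lo_lt_hi h
    · exact mul_lt_mul_of_neg_left Ω.lo_lt_hi (lt_of_le_of_ne (not_lt.1 h) hν)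
  leftClosed := flipSide ν Ω.leftClosed

theorem mul_mem_scale {ν : ℝ} (hν : ν ≠ 0) (Ω : Window) (u : ℝ) :
    ν * u ∈ (Ω.scale ν hν).carrier ↔ u ∈ Ω.carrier := by
  rw [mem_carrier_iff, mem_carrier_iff]
  simp only [scale]
  rcases hν.lt_or_gt with h | h
  · have h1 := sideLE_affine_neg h Ω.leftClosed 0 Ω.lo u
    have h2 := sideLE_affine_neg h Ω.leftClosed 0 Ω.hi u
    simp only [add_zero] at h1 h2
    rw [if_neg (not_lt.2 h.le), if_neg (not_lt.2 h.le), h1, h2, not_not, and_comm]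
  · have h1 := sideLE_affine_pos h Ω.leftClosed 0 Ω.lo u
    have h2 := sideLE_affine_pos h Ω.leftClosed 0 Ω.hi u
    simp only [add_zero] at h1 h2
    rw [if_pos h, if_pos h, h1, h2]

theorem carrier_scale {ν : ℝ} (hν : ν ≠ 0) (Ω : Window) :
    (Ω.scale ν hν).carrier = (fun u => ν * u) '' Ω.carrier := by
  ext u
  constructor
  · intro hu
    refine ⟨u / ν, ?_, mul_div_cancel₀ _ hν⟩
    rwa [← mul_mem_scale hν, mul_div_cancel₀ _ hν]
  · rintro ⟨u, hu, rfl⟩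
    exact (mul_mem_scale hν Ω u).2 hu

theorem length_scale {ν : ℝ} (hν : ν ≠ 0) (Ω : Window) :
    (Ω.scale ν hν).length = |ν| * Ω.length := by
  simp only [length, scale]
  rcases hν.lt_or_gt with h | h
  · rw [if_neg (not_lt.2 h.le), if_neg (not_lt.2 h.le), abs_of_neg h]; ring
  · rw [if_pos h, if_pos h, abs_of_pos h]; ring

/-- The window with the same endpoints that is closed on the other side. -/
def flip (Ω : Window) : Window := { Ω with leftClosed := !Ω.leftClosed }

theorem mem_flip_iff (Ω : Window) {u : ℝ} (h : u ≠ Ω.lo) (h' : u ≠ Ω.hi) :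
    u ∈ Ω.flip.carrier ↔ u ∈ Ω.carrier := by
  rw [mem_carrier_iff, mem_carrier_iff]
  simp [flip, SideLE, h.symm, h'.symm]

theorem cutPoints_flip {x y : (Fin 2 → ℤ) →+ ℝ} (Ω : Window)
    (h : ¬ ∃ z, y z = Ω.lo ∨ y z = Ω.hi) :
    cutPoints x y Ω.flip.carrier = cutPoints x y Ω.carrier := by
  push Not at h
  ext a
  exact exists_congr fun z => and_congr_left fun _ => Ω.mem_flip_iff (h z).1 (h z).2

theorem flipSide_not (ν : ℝ) (s : Bool) : flipSide ν (!s) = !flipSide ν s := by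
  unfold flipSide
  split_ifs <;> rfl

theorem lo_mem_iff (Ω : Window) : Ω.lo ∈ Ω.carrier ↔ Ω.leftClosed = true := by
  rw [mem_carrier_iff, and_iff_left (not_sideLE_of_lt Ω.lo_lt_hi)]
  simp [SideLE]

theorem hi_mem_iff (Ω : Window) : Ω.hi ∈ Ω.carrier ↔ Ω.leftClosed = false := by
  rw [mem_carrier_iff, and_iff_right (SideLE.of_lt Ω.lo_lt_hi)]
  simp [SideLE]

theorem exists_isLeast_iff (Ω : Window) :
    (∃ u, IsLeast Ω.carrier u) ↔ Ω.leftClosed = true := by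
  rw [← lo_mem_iff]
  have hlt := Ω.lo_lt_hi
  constructor
  · rintro ⟨u, hu, hmin⟩
    have h1 := Ω.carrier_subset_Icc hu
    rcases h1.1.lt_or_eq with h2 | h2
    · have h3 : (Ω.lo + min u Ω.hi) / 2 ∈ Ω.carrier := by
        have := lt_min h2 hlt
        have := min_le_right u Ω.hi
        exact Ω.Ioo_subset_carrier ⟨by linarith, by linarith⟩
      have h4 := hmin h3
      have := min_le_left u Ω.hi
      linarith
    · rwa [h2]
  · exact fun h => ⟨_, h, fun u hu => (Ω.carrier_subset_Icc hu).1⟩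

theorem carrier_subset_carrier {J Ω : Window} (h1 : Ω.lo ≤ J.lo) (h2 : J.hi ≤ Ω.hi)
    (h3 : J.leftClosed = Ω.leftClosed) : J.carrier ⊆ Ω.carrier := by
  intro u hu
  rw [mem_carrier_iff, h3] at hu
  exact (Ω.mem_carrier_iff u).2 ⟨hu.1.le_trans h1, fun h => hu.2 (h.le_trans h2)⟩

theorem hi_add_mem_iff (Ω : Window) {t : ℝ} (h0 : t ≠ 0) (ht : |t| < Ω.length) :
    Ω.hi + t ∈ Ω.carrier ↔ t < 0 := by
  rw [abs_lt, length] at ht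
  constructor
  · intro h
    refine lt_of_le_of_ne ?_ h0
    linarith [(Ω.carrier_subset_Icc h).2]
  · exact fun h => Ω.Ioo_subset_carrier ⟨by linarith, by linarith⟩

theorem lo_add_mem_iff (Ω : Window) {t : ℝ} (h0 : t ≠ 0) (ht : |t| < Ω.length) :
    Ω.lo + t ∈ Ω.carrier ↔ 0 < t := by
  rw [abs_lt, length] at ht
  constructor
  · intro h
    refine lt_of_le_of_ne ?_ h0.symm
    linarith [(Ω.carrier_subset_Icc h).1]
  · exact fun h => Ω.Ioo_subset_carrier ⟨by linarith, by linarith⟩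

end Window

/-! ### The closed sides of the windows of a substitution tiling -/

namespace InflatedTiling

variable {x y : (Fin 2 → ℤ) →+ ℝ} {L : Type} (T : InflatedTiling x y L)

/-- The image of the first window in internal space. -/
noncomputable def image : Window := (T.Ω 0).scale T.ν T.ν_ne

theorem image_bounds : (T.Ω 1).lo ≤ T.image.lo ∧ T.image.hi ≤ (T.Ω 1).hi := by
  have h1 := T.cutProject.map_Icc T.y_M (fun z => T.map_mem (n := 0))
    (Set.left_mem_Icc.2 (T.Ω 0).lo_lt_hi.le)
  have h2 := T.cutProject.map_Icc T.y_M (fun z => T.map_mem (n := 0))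
    (Set.right_mem_Icc.2 (T.Ω 0).lo_lt_hi.le)
  rw [Nat.zero_add] at h1 h2
  simp only [image, Window.scale]
  split_ifs
  exacts [⟨h1.1, h2.2⟩, ⟨h2.1, h1.2⟩]

/-- As M is onto, a point u violating the inclusion is not the coordinate of a lattice point, so u
is a common end of the image and of Ω 1. The lattice points on the window ends must then sit at the
opposite ends. There `not_mismatch` shows that the closed sides agree, a contradiction at u. -/
theorem image_subset_of_singular [Finite L] (h0 : ∃ z, y z = (T.Ω 0).lo ∨ y z = (T.Ω 0).hi)
    (h1 : ∃ z, y z = (T.Ω 1).lo ∨ y z = (T.Ω 1).hi) :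
    T.image.carrier ⊆ (T.Ω 1).carrier := by
  intro u hu
  by_contra hu'
  obtain ⟨hlo, hhi⟩ := T.image_bounds
  have hrange : u ∉ Set.range y := by
    rintro ⟨z, rfl⟩
    obtain ⟨z, rfl⟩ := T.surjective_M z
    rw [T.y_M, image, Window.mul_mem_scale] at hu
    exact hu' (T.map_mem hu)
  have hi0 : (T.ν * (T.Ω 0).lo = T.image.lo ∧ T.ν * (T.Ω 0).hi = T.image.hi) ∨
      (T.ν * (T.Ω 0).lo = T.image.hi ∧ T.ν * (T.Ω 0).hi = T.image.lo) := by
    simp only [image, Window.scale]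
    split_ifs
    exacts [Or.inl ⟨rfl, rfl⟩, Or.inr ⟨rfl, rfl⟩]
  have hmem : ∀ v, v ∈ (T.Ω 0).carrier ↔ T.ν * v ∈ T.image.carrier := fun v =>
    (Window.mul_mem_scale T.ν_ne _ v).symm
  have hlen : T.image.length = |T.ν| * (T.Ω 0).length := Window.length_scale T.ν_ne _
  have hsmall : ∀ t, |t| < (T.Ω 0).length → |T.ν * t| < T.image.length := by
    intro t ht
    rw [hlen, abs_mul]
    exact mul_lt_mul_of_pos_left ht (abs_pos.2 T.ν_ne)
  have hνν : 0 < T.ν * T.ν := mul_self_pos.2 T.ν_ne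
  obtain ⟨z0, hz0⟩ := h0
  obtain ⟨z1, hz1⟩ := h1
  have hz0' : T.ν * y z0 = T.image.lo ∨ T.ν * y z0 = T.image.hi := by
    rcases hi0 with ⟨e1, e2⟩ | ⟨e1, e2⟩ <;> rcases hz0 with h | h <;> rw [h]
    exacts [Or.inl e1, Or.inr e2, Or.inr e1, Or.inl e2]
  rw [← T.y_M] at hz0'
  have hinj : ∀ {a b : ℝ}, T.ν * a = T.ν * b → a = b := fun h => mul_left_cancel₀ T.ν_ne h
  have b := T.image.carrier_subset_Icc hu
  have hu1 : u = (T.Ω 1).lo ∨ u = (T.Ω 1).hi := by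
    by_contra! h
    exact hu' ((T.Ω 1).Ioo_subset_carrier ⟨lt_of_le_of_ne (hlo.trans b.1) h.1.symm,
      lt_of_le_of_ne (b.2.trans hhi) h.2⟩)
  rcases hu1 with hul | hul
  · have hl : u = T.image.lo := le_antisymm (hul.le.trans hlo) b.1
    have hf1 : y z1 = (T.Ω 1).hi :=
      hz1.resolve_left fun h => hrange ⟨z1, by rw [h, hul]⟩
    have hf0 : T.ν * y z0 = T.image.hi := by
      rw [← T.y_M]
      exact hz0'.resolve_left fun h => hrange ⟨_, by rw [h, hl]⟩
    have := T.not_mismatch (s := T.ν) (z0 := z0) (z1 := z1) rfl rfl ?_ ?_ ?_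
    · rw [hmem, hf0, hf1, Window.hi_mem_iff, Window.hi_mem_iff] at this
      have c1 : T.image.leftClosed = true := by rwa [← Window.lo_mem_iff, ← hl]
      have c2 : ¬ (T.Ω 1).leftClosed = true := by rwa [← Window.lo_mem_iff, ← hul]
      rw [c1] at this
      simp only [Bool.true_eq_false, false_iff] at this
      simp [this] at c2
    · intro t ht0 ht
      rw [hmem, mul_add, hf0, Window.hi_add_mem_iff _ (mul_ne_zero T.ν_ne ht0) (hsmall t ht)]
    · intro t ht0 ht
      rw [hf1, Window.hi_add_mem_iff _ ht0 (by rwa [T.length_eq]), ← mul_assoc,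
        ← neg_pos, ← neg_pos (a := T.ν * T.ν * t), ← mul_neg, mul_pos_iff_of_pos_left hνν]
    · intro m hm1 hm2
      rcases hi0 with ⟨e1, e2⟩ | ⟨e1, e2⟩
      · rw [hf1, hm2, hinj (hf0.trans e2.symm)]
      · refine (hrange ⟨z0 + m, ?_⟩).elim
        rw [map_add, hinj (hf0.trans e1.symm), hul, hm1]
  · have hl : u = T.image.hi := le_antisymm b.2 (hhi.trans hul.ge)
    have hf1 : y z1 = (T.Ω 1).lo :=
      hz1.resolve_right fun h => hrange ⟨z1, by rw [h, hul]⟩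
    have hf0 : T.ν * y z0 = T.image.lo := by
      rw [← T.y_M]
      exact hz0'.resolve_right fun h => hrange ⟨_, by rw [h, hl]⟩
    have := T.not_mismatch (s := -T.ν) (z0 := z0) (z1 := z1) rfl rfl ?_ ?_ ?_
    · rw [hmem, hf0, hf1, Window.lo_mem_iff, Window.lo_mem_iff] at this
      have c1 : T.image.leftClosed = false := by rwa [← Window.hi_mem_iff, ← hl]
      have c2 : ¬ (T.Ω 1).leftClosed = false := by rwa [← Window.hi_mem_iff, ← hul]
      rw [c1] at this
      simp only [Bool.false_eq_true, false_iff] at this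
      simp [this] at c2
    · intro t ht0 ht
      rw [hmem, mul_add, hf0, Window.lo_add_mem_iff _ (mul_ne_zero T.ν_ne ht0) (hsmall t ht),
        neg_mul, neg_lt_zero]
    · intro t ht0 ht
      rw [hf1, Window.lo_add_mem_iff _ ht0 (by rwa [T.length_eq]), neg_mul, neg_lt_zero,
        ← mul_assoc, mul_pos_iff_of_pos_left hνν]
    · intro m hm1 hm2
      rcases hi0 with ⟨e1, e2⟩ | ⟨e1, e2⟩
      · rw [hf1, hm1, hinj (hf0.trans e1.symm)]
      · refine (hrange ⟨z0 + m, ?_⟩).elim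
        rw [map_add, hinj (hf0.trans e2.symm), hul, hm2]

/-- The closed sides of the windows can be chosen such that the image of the first window is
contained in the second one. -/
theorem exists_windows [Finite L] : ∃ Ω₀ Ω' : Window,
    Ω₀.lo = (T.Ω 0).lo ∧ Ω₀.hi = (T.Ω 0).hi ∧
    cutPoints x y Ω₀.carrier = cutPoints x y (T.Ω 0).carrier ∧
    Ω'.lo = (T.Ω 1).lo ∧ Ω'.hi = (T.Ω 1).hi ∧
    cutPoints x y Ω'.carrier = cutPoints x y (T.Ω 1).carrier ∧
    (Ω₀.scale T.ν T.ν_ne).carrier ⊆ Ω'.carrier := by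
  obtain ⟨hlo, hhi⟩ := T.image_bounds
  by_cases hs : T.image.leftClosed = (T.Ω 1).leftClosed
  · exact ⟨T.Ω 0, T.Ω 1, rfl, rfl, rfl, rfl, rfl, rfl, Window.carrier_subset_carrier hlo hhi hs⟩
  have hs' : (!T.image.leftClosed) = (T.Ω 1).leftClosed := by
    revert hs
    cases T.image.leftClosed <;> cases (T.Ω 1).leftClosed <;> simp
  -- A window with no lattice coordinate at its ends can be flipped without changing the vertices.
  -- Only the doubly singular case is left to the preceding theorem.
  by_cases h0 : ∃ z, y z = (T.Ω 0).lo ∨ y z = (T.Ω 0).hi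
  · by_cases h1 : ∃ z, y z = (T.Ω 1).lo ∨ y z = (T.Ω 1).hi
    · exact ⟨T.Ω 0, T.Ω 1, rfl, rfl, rfl, rfl, rfl, rfl, T.image_subset_of_singular h0 h1⟩
    · refine ⟨T.Ω 0, (T.Ω 1).flip, rfl, rfl, rfl, rfl, rfl, (T.Ω 1).cutPoints_flip h1,
        Window.carrier_subset_carrier hlo hhi ?_⟩
      change T.image.leftClosed = !(T.Ω 1).leftClosed
      rw [← hs', Bool.not_not]
  · refine ⟨(T.Ω 0).flip, T.Ω 1, rfl, rfl, (T.Ω 0).cutPoints_flip h0, rfl, rfl, rfl,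
      Window.carrier_subset_carrier hlo hhi ?_⟩
    rw [← hs']
    exact Window.flipSide_not _ _

end InflatedTiling

/-! ### Existence of inflations -/

/-- If the offset and the length of the windows are rational multiples of internal coordinates of
lattice points, then there is a finite set of cut points as required for an inflation. -/
theorem IsCutProject.exists_inflation {x y : (Fin 2 → ℤ) →+ ℝ} (h : IsCutProject x y)
    (hx : Function.Injective x) {M : (Fin 2 → ℤ) →+ (Fin 2 → ℤ)} (hM : Function.Surjective M)
    {lam ν c l : ℝ} (hxM : ∀ z, x (M z) = lam * x z) (hyM : ∀ z, y (M z) = ν * y z)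
    (hlam : 1 < lam) (hν : ν ≠ 0) (hl : 0 < l)
    (hmaps : ∀ u, 0 ≤ u → u ≤ l → 0 ≤ ν * u + c ∧ ν * u + c ≤ l)
    {N : ℕ} (hN : 0 < N) {zc zl : Fin 2 → ℤ} (hc : N * c = y zc) (hzl : N * l = y zl) :
    ∃ I : Inflation x y, I.lam = lam ∧ I.ν = ν ∧ I.c = c ∧ I.l = l := by
  obtain ⟨δ, hδ, K, hK⟩ := h.exists_forward hl
  have hN' : (0 : ℝ) < N := by exact_mod_cast hN
  have hl1 : 0 < lam - 1 := by linarith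
  have hK0 : 0 ≤ K := by
    obtain ⟨p, h1, h2, -⟩ := (hK 0 le_rfl hl.le).1
    linarith
  set B := lam * K with hB
  have hB0 : 0 ≤ B := by positivity
  set R := |x zl| + N * B + (|x zc| + N * B) / (lam - 1) with hR
  have hR1 : |x zl| + N * B ≤ R := le_add_of_nonneg_right (by positivity)
  have hR2 : R + |x zc| + N * B ≤ lam * R := by
    have h1 : (|x zc| + N * B) / (lam - 1) ≤ R := le_add_of_nonneg_left (by positivity)
    rw [div_le_iff₀ hl1] at h1
    linarith
  have hNm : ∀ m, |x m| ≤ B → |N * x m| ≤ N * B := by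
    intro m hm
    rw [abs_mul, Nat.abs_cast]
    gcongr
  refine ⟨{ cutProject := h, x_injective := hx, M := M, lam := lam, ν := ν, c := c, l := l, K := K
            D := {d | 0 ≤ d ∧ d ≤ l ∧ ∃ z, N * d = y z ∧ |x z| ≤ R}
            x_M := hxM, y_M := hyM, one_lt_lam := hlam, ν_ne := hν, l_pos := hl, maps := hmaps
            step := ?_, D_finite := ?_, lower_mem := ?_, upper_mem := ?_, preimage_mem := ?_ },
    rfl, rfl, rfl, rfl⟩
  · intro u h0 h1
    obtain ⟨p, h2, h3, h4, h5⟩ := (hK u h0 h1).1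
    exact ⟨p, by linarith, h3, h4, h5⟩
  · refine ((h.finite_of_bounds (-R) R 0 (N * l)).image fun z => y z / N).subset ?_
    rintro d ⟨h0, h1, z, h2, h3⟩
    rw [abs_le] at h3
    refine ⟨z, ⟨h3.1, h3.2, ?_, ?_⟩, ?_⟩
    · rw [← h2]; positivity
    · rw [← h2]; gcongr
    · simp only
      rw [← h2, mul_div_cancel_left₀ _ hN'.ne']
  · intro m hm h0 h1
    refine ⟨h0, h1, -(N • m), ?_, ?_⟩
    · rw [map_neg, map_nsmul, nsmul_eq_mul]; ring
    · rw [map_neg, map_nsmul, nsmul_eq_mul, abs_neg]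
      linarith [hNm m hm, abs_nonneg (x zl)]
  · intro m hm h0 h1
    refine ⟨h0, h1, zl - N • m, ?_, ?_⟩
    · rw [map_sub, map_nsmul, nsmul_eq_mul, ← hzl]; ring
    · rw [map_sub, map_nsmul, nsmul_eq_mul]
      linarith [hNm m hm, abs_sub (x zl) (N * x m)]
  · rintro d ⟨-, -, z, h2, h3⟩ m hm h0 h1
    -- N times the preimage of d is the internal coordinate of this z'; surjectivity of M keeps the
    -- denominator N from growing.
    obtain ⟨z', hz'⟩ := hM (z - zc - N • m)
    refine ⟨h0, h1, z', ?_, ?_⟩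
    · have h4 := hyM z'
      rw [hz', map_sub, map_sub, map_nsmul, nsmul_eq_mul, ← hc, ← h2] at h4
      rw [mul_div_assoc', div_eq_iff hν]
      linarith
    · have h4 := hxM z'
      rw [hz', map_sub, map_sub, map_nsmul, nsmul_eq_mul] at h4
      have h5 : |lam * x z'| ≤ lam * R := by
        rw [← h4]
        linarith [hNm m hm, abs_sub (x z - x zc) (N * x m), abs_sub (x z) (x zc)]
      rw [abs_mul, abs_of_pos (by linarith)] at h5
      exact le_of_mul_le_mul_left h5 (by linarith)

/-! ### Lengths of connected components -/

/-- The component lies between an open and a closed interval with the same ends. The case c = d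
covers components that are single points. -/
theorem volume_connectedComponentIn {F : Set ℝ} {u c d : ℝ} (hcd : c ≤ d)
    (h1 : ∀ t ∈ Set.Ioo c d, Set.uIcc u t ⊆ F) (h2 : connectedComponentIn F u ⊆ Set.Icc c d) :
    (MeasureTheory.volume (connectedComponentIn F u)).toReal = d - c := by
  have h3 : Set.Ioo c d ⊆ connectedComponentIn F u := fun t ht =>
    isPreconnected_uIcc.subset_connectedComponentIn Set.left_mem_uIcc (h1 t ht)
      Set.right_mem_uIcc
  have h4 : MeasureTheory.volume (connectedComponentIn F u) = ENNReal.ofReal (d - c) := by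
    apply le_antisymm
    · exact (MeasureTheory.measure_mono h2).trans Real.volume_Icc.le
    · exact Real.volume_Ioo.ge.trans (MeasureTheory.measure_mono h3)
  rw [h4, ENNReal.toReal_ofReal (sub_nonneg.2 hcd)]

theorem Window.ordConnected_carrier (Ω : Window) : Ω.carrier.OrdConnected := by
  unfold Window.carrier
  split_ifs <;> infer_instance

/-- The component of the complement of a subwindow to the left of it is the whole gap. -/
theorem Window.volume_component_left {J Ω : Window} (h1 : Ω.lo ≤ J.lo) (h2 : J.hi ≤ Ω.hi) {u : ℝ}
    (hu : u ∈ Ω.carrier \ J.carrier) (hul : u ≤ J.lo) :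
    (MeasureTheory.volume (connectedComponentIn (Ω.carrier \ J.carrier) u)).toReal =
      J.lo - Ω.lo := by
  have hlt := J.lo_lt_hi
  refine volume_connectedComponentIn h1 (fun t ht s hs => ?_) fun t ht => ?_
  · have htΩ : t ∈ Ω.carrier := Ω.Ioo_subset_carrier ⟨ht.1, by linarith [ht.2]⟩
    refine ⟨Ω.ordConnected_carrier.uIcc_subset hu.1 htΩ hs, fun hsJ => ?_⟩
    have h4 := (J.carrier_subset_Icc hsJ).1
    have h6 : s = u := by
      rcases le_max_iff.1 hs.2 with h7 | h7
      · linarith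
      · linarith [ht.2]
    rw [h6] at hsJ
    exact hu.2 hsJ
  · have hsub := connectedComponentIn_subset _ _ ht
    refine ⟨(Ω.carrier_subset_Icc hsub.1).1, ?_⟩
    by_contra! h3
    have hm : J.lo < min t ((J.lo + J.hi) / 2) := lt_min h3 (by linarith)
    have h4 : min t ((J.lo + J.hi) / 2) ∈ connectedComponentIn (Ω.carrier \ J.carrier) u :=
      isPreconnected_connectedComponentIn.ordConnected.out (mem_connectedComponentIn hu) ht
        ⟨by linarith, min_le_left _ _⟩
    exact (connectedComponentIn_subset _ _ h4).2 (J.Ioo_subset_carrier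
      ⟨hm, by linarith [min_le_right t ((J.lo + J.hi) / 2)]⟩)

/-- The component of the complement of a subwindow to the right of it is the whole gap. -/
theorem Window.volume_component_right {J Ω : Window} (h1 : Ω.lo ≤ J.lo) (h2 : J.hi ≤ Ω.hi) {u : ℝ}
    (hu : u ∈ Ω.carrier \ J.carrier) (huh : J.hi ≤ u) :
    (MeasureTheory.volume (connectedComponentIn (Ω.carrier \ J.carrier) u)).toReal =
      Ω.hi - J.hi := by
  have hlt := J.lo_lt_hi
  refine volume_connectedComponentIn h2 (fun t ht s hs => ?_) fun t ht => ?_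
  · have htΩ : t ∈ Ω.carrier := Ω.Ioo_subset_carrier ⟨by linarith [ht.1], ht.2⟩
    refine ⟨Ω.ordConnected_carrier.uIcc_subset hu.1 htΩ hs, fun hsJ => ?_⟩
    have h4 := (J.carrier_subset_Icc hsJ).2
    have h6 : s = u := by
      rcases min_le_iff.1 hs.1 with h7 | h7
      · linarith
      · linarith [ht.1]
    rw [h6] at hsJ
    exact hu.2 hsJ
  · have hsub := connectedComponentIn_subset _ _ ht
    refine ⟨?_, (Ω.carrier_subset_Icc hsub.1).2⟩
    by_contra! h3
    have hm : max t ((J.lo + J.hi) / 2) < J.hi := max_lt h3 (by linarith)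
    have h4 : max t ((J.lo + J.hi) / 2) ∈ connectedComponentIn (Ω.carrier \ J.carrier) u :=
      isPreconnected_connectedComponentIn.ordConnected.out ht (mem_connectedComponentIn hu)
        ⟨le_max_left _ _, by linarith⟩
    exact (connectedComponentIn_subset _ _ h4).2 (J.Ioo_subset_carrier
      ⟨by linarith [le_max_right t ((J.lo + J.hi) / 2)], hm⟩)

/-- The components of the complement of a subwindow have lengths in a given set if and only if the
two gaps do. -/
theorem Window.forall_component_iff {J Ω : Window} (h1 : Ω.lo ≤ J.lo) (h2 : J.hi ≤ Ω.hi)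
    {F : Set ℝ} (hF : 0 ∈ F) :
    (∀ u ∈ Ω.carrier \ J.carrier,
      (MeasureTheory.volume (connectedComponentIn (Ω.carrier \ J.carrier) u)).toReal ∈ F) ↔
    J.lo - Ω.lo ∈ F ∧ Ω.hi - J.hi ∈ F := by
  have hlt := J.lo_lt_hi
  constructor
  · intro h
    constructor
    · rcases h1.lt_or_eq with h3 | h3
      · have hu : (Ω.lo + J.lo) / 2 ∈ Ω.carrier \ J.carrier :=
          ⟨Ω.Ioo_subset_carrier ⟨by linarith, by linarith⟩, fun h4 => by
            linarith [(J.carrier_subset_Icc h4).1]⟩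
        have h5 := h _ hu
        rwa [volume_component_left h1 h2 hu (by linarith)] at h5
      -- Without a gap nothing is known from the components; its length 0 is in F by hypothesis.
      · rwa [h3, sub_self]
    · rcases h2.lt_or_eq with h3 | h3
      · have hu : (J.hi + Ω.hi) / 2 ∈ Ω.carrier \ J.carrier :=
          ⟨Ω.Ioo_subset_carrier ⟨by linarith, by linarith⟩, fun h4 => by
            linarith [(J.carrier_subset_Icc h4).2]⟩
        have h5 := h _ hu
        rwa [volume_component_right h1 h2 hu (by linarith)] at h5
      · rwa [h3, sub_self]
  · rintro ⟨h3, h4⟩ u hu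
    rcases le_or_gt u J.lo with h5 | h5
    · rwa [volume_component_left h1 h2 hu h5]
    · rw [volume_component_right h1 h2 hu]
      · exact h4
      · by_contra! h6
        exact hu.2 (J.Ioo_subset_carrier ⟨h5, h6⟩)

/-! ### Coordinates of the integer lattice -/

theorem projV_add (v w r s : Fin 2 → ℝ) : projV v w (r + s) = projV v w r + projV v w s := by
  simp only [projV, Pi.add_apply]
  ring

theorem projV_smul (v w : Fin 2 → ℝ) (a : ℝ) (r : Fin 2 → ℝ) :
    projV v w (a • r) = a * projV v w r := by
  simp only [projV, Pi.smul_apply, smul_eq_mul]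
  ring

theorem projY_add (v r s : Fin 2 → ℝ) : projY v (r + s) = projY v r + projY v s := by
  simp only [projY, Pi.add_apply]
  ring

theorem projY_smul (v : Fin 2 → ℝ) (a : ℝ) (r : Fin 2 → ℝ) :
    projY v (a • r) = a * projY v r := by
  simp only [projY, Pi.smul_apply, smul_eq_mul]
  ring

theorem latticePt_add (z z' : Fin 2 → ℤ) : latticePt (z + z') = latticePt z + latticePt z' := by
  ext i
  simp [latticePt]

/-- The tiling coordinate of a lattice point. -/
noncomputable def latX (v w : Fin 2 → ℝ) : (Fin 2 → ℤ) →+ ℝ :=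
  AddMonoidHom.mk' (fun z => projV v w (latticePt z)) fun a b => by
    rw [latticePt_add, projV_add]

/-- The internal coordinate of a lattice point. -/
noncomputable def latY (v : Fin 2 → ℝ) : (Fin 2 → ℤ) →+ ℝ :=
  AddMonoidHom.mk' (fun z => projY v (latticePt z)) fun a b => by
    rw [latticePt_add, projY_add]

theorem latX_apply (v w : Fin 2 → ℝ) (z : Fin 2 → ℤ) : latX v w z = projV v w (latticePt z) := rfl

theorem latY_apply (v : Fin 2 → ℝ) (z : Fin 2 → ℤ) : latY v z = projY v (latticePt z) := rfl

theorem projTiling_eq {v : Fin 2 → ℝ} (hv : v 0 ≠ 0) (w : Fin 2 → ℝ) (Ω : Window) :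
    projTiling v w Ω = tilesOf (cutPoints (latX v w) (latY v) Ω.carrier) := by
  have h : projVertices v w Ω = cutPoints (latX v w) (latY v) Ω.carrier := by
    ext a
    exact exists_congr fun z => and_congr_left fun _ => mem_strip_iff v _ _ hv
  rw [projTiling, h]

section Coordinates

variable {v w : Fin 2 → ℝ} (hv : v 0 ≠ 0) (hvw : v 0 * w 1 - v 1 * w 0 ≠ 0)

include hv hvw

/-- The coefficient of w is a multiple of `projY`, so `projV` and `projY` together are linear
coordinates of the plane, although Y is not W. -/
theorem eq_proj_add_proj (r : Fin 2 → ℝ) :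
    r = projV v w r • v + (projY v r * (v 0 / (v 0 * w 1 - v 1 * w 0))) • w := by
  set D := v 0 * w 1 - v 1 * w 0 with hD
  ext i
  fin_cases i
  · simp only [projV, projY, Fin.zero_eta, Pi.add_apply, Pi.smul_apply, smul_eq_mul, ← hD]
    field_simp
    rw [hD]
    ring
  · simp only [projV, projY, Fin.mk_one, Pi.add_apply, Pi.smul_apply, smul_eq_mul, ← hD]
    field_simp
    rw [hD]
    ring

theorem eq_zero_of_lat {z : Fin 2 → ℤ} (hx : latX v w z = 0) (hy : latY v z = 0) : z = 0 := by
  have h := eq_proj_add_proj hv hvw (latticePt z)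
  rw [← latX_apply, ← latY_apply, hx, hy] at h
  ext i
  have := congrFun h i
  simpa [latticePt] using this

theorem finite_lat_box (R : ℝ) : {z | |latX v w z| ≤ R ∧ |latY v z| ≤ R}.Finite := by
  set k := v 0 / (v 0 * w 1 - v 1 * w 0) with hk
  set B : Fin 2 → ℤ := fun i => ⌈R * |v i| + R * |k| * |w i|⌉ with hB
  refine (Set.finite_Icc (-B) B).subset ?_
  rintro z ⟨h1, h2⟩
  have key : ∀ i, |z i| ≤ B i := by
    intro i
    have h3 := congrFun (eq_proj_add_proj hv hvw (latticePt z)) i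
    rw [← latX_apply, ← latY_apply, ← hk] at h3
    simp only [latticePt, Pi.add_apply, Pi.smul_apply, smul_eq_mul] at h3
    have h4 : |(z i : ℝ)| ≤ R * |v i| + R * |k| * |w i| := by
      rw [h3]
      refine (abs_add_le _ _).trans ?_
      rw [abs_mul, abs_mul, abs_mul]
      gcongr
    have h5 := h4.trans (Int.le_ceil _)
    exact_mod_cast h5
  exact ⟨fun i => (abs_le.1 (key i)).1, fun i => (abs_le.1 (key i)).2⟩

theorem exists_coeff_lat (g : (Fin 2 → ℤ) →+ ℝ) :
    ∃ α β : ℝ, ∀ z, g z = α * latX v w z + β * latY v z := by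
  set k := v 0 / (v 0 * w 1 - v 1 * w 0) with hk
  refine ⟨v 0 * g ![1, 0] + v 1 * g ![0, 1], k * (w 0 * g ![1, 0] + w 1 * g ![0, 1]),
    fun z => ?_⟩
  have h := eq_proj_add_proj hv hvw (latticePt z)
  rw [← latX_apply, ← latY_apply, ← hk] at h
  have h0 := congrFun h 0
  have h1 := congrFun h 1
  simp only [latticePt, Pi.add_apply, Pi.smul_apply, smul_eq_mul] at h0 h1
  have hz : z = z 0 • ![1, 0] + z 1 • ![0, 1] := by ext i; fin_cases i <;> simp
  have hg : g z = z 0 * g ![1, 0] + z 1 * g ![0, 1] := by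
    conv_lhs => rw [hz]
    rw [map_add, map_zsmul, map_zsmul, zsmul_eq_mul, zsmul_eq_mul]
  rw [hg, h0, h1]
  ring

end Coordinates

/-! ### The action of an integer matrix -/

theorem actOn_add (M : Matrix.GeneralLinearGroup (Fin 2) ℤ) (r s : Fin 2 → ℝ) :
    actOn M (r + s) = actOn M r + actOn M s := Matrix.mulVec_add _ _ _

theorem actOn_smul (M : Matrix.GeneralLinearGroup (Fin 2) ℤ) (a : ℝ) (r : Fin 2 → ℝ) :
    actOn M (a • r) = a • actOn M r := Matrix.mulVec_smul _ _ _

theorem actOn_apply (M : Matrix.GeneralLinearGroup (Fin 2) ℤ) (r : Fin 2 → ℝ) (i : Fin 2) :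
    actOn M r i = M.val i 0 * r 0 + M.val i 1 * r 1 := by
  simp [actOn, Matrix.mulVec, dotProduct, Fin.sum_univ_two]

/-- The action of an integer matrix on the lattice. -/
def latM (M : Matrix.GeneralLinearGroup (Fin 2) ℤ) : (Fin 2 → ℤ) →+ (Fin 2 → ℤ) :=
  (M.val.mulVecLin).toAddMonoidHom

theorem latM_apply (M : Matrix.GeneralLinearGroup (Fin 2) ℤ) (z : Fin 2 → ℤ) :
    latM M z = M.val.mulVec z := rfl

theorem latticePt_latM (M : Matrix.GeneralLinearGroup (Fin 2) ℤ) (z : Fin 2 → ℤ) :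
    latticePt (latM M z) = actOn M (latticePt z) := by
  ext i
  rw [actOn_apply]
  simp [latM_apply, latticePt, Matrix.mulVec, dotProduct, Fin.sum_univ_two]

theorem latM_surjective (M : Matrix.GeneralLinearGroup (Fin 2) ℤ) :
    Function.Surjective (latM M) := fun z =>
  ⟨(M⁻¹).val.mulVec z, by rw [latM_apply, Matrix.mulVec_mulVec, ← Units.val_mul]; simp⟩

/-- The coordinates of `actOn M` are scaled by the eigenvalues. -/
structure ScalesCoordinates (M : Matrix.GeneralLinearGroup (Fin 2) ℤ) (v w : Fin 2 → ℝ)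
    (lam ν : ℝ) : Prop where
  projV_actOn : ∀ r, projV v w (actOn M r) = lam * projV v w r
  projY_actOn : ∀ r, projY v (actOn M r) = ν * projY v r

section Action

variable {v w : Fin 2 → ℝ} (hv : v 0 ≠ 0) (hvw : v 0 * w 1 - v 1 * w 0 ≠ 0)
  {M : Matrix.GeneralLinearGroup (Fin 2) ℤ} {lam ν : ℝ}

include hvw in
theorem projV_self : projV v w v = 1 ∧ projV v w w = 0 := by
  constructor
  · rw [projV, div_eq_one_iff_eq hvw]
  · rw [projV, mul_comm, sub_self, zero_div]

include hv in
theorem projY_self : projY v v = 0 := by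
  rw [projY, div_self hv, one_mul, sub_self]

include hv hvw

theorem ScalesCoordinates.of_eigen (h1 : actOn M v = lam • v) (h2 : actOn M w = ν • w) :
    ScalesCoordinates M v w lam ν := by
  obtain ⟨e1, e2⟩ := projV_self hvw
  have e3 := projY_self hv
  constructor <;> intro r <;>
  · conv_lhs => rw [eq_proj_add_proj hv hvw r]
    conv_rhs => rw [eq_proj_add_proj hv hvw r]
    rw [actOn_add, actOn_smul, actOn_smul, h1, h2]
    simp only [projV_add, projV_smul, projY_add, projY_smul, e1, e2, e3]
    ring

theorem ScalesCoordinates.eigen (h : ScalesCoordinates M v w lam ν) :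
    actOn M v = lam • v ∧ actOn M w = ν • w := by
  obtain ⟨e1, e2⟩ := projV_self hvw
  have e3 := projY_self hv
  constructor
  · rw [eq_proj_add_proj hv hvw (actOn M v), h.projV_actOn, h.projY_actOn, e1, e3]
    simp
  · conv_rhs => rw [eq_proj_add_proj hv hvw w]
    rw [eq_proj_add_proj hv hvw (actOn M w), h.projV_actOn, h.projY_actOn, e2]
    simp [smul_smul, mul_assoc]

omit hv hvw in
theorem ScalesCoordinates.of_lat (hx : ∀ z, latX v w (latM M z) = lam * latX v w z)
    (hy : ∀ z, latY v (latM M z) = ν * latY v z) : ScalesCoordinates M v w lam ν := by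
  have hr : ∀ r : Fin 2 → ℝ, r = r 0 • latticePt ![1, 0] + r 1 • latticePt ![0, 1] := by
    intro r
    ext i
    fin_cases i <;> simp [latticePt]
  simp only [latX_apply, latY_apply, latticePt_latM] at hx hy
  constructor <;> intro r <;> rw [hr r]
  · simp only [actOn_add, actOn_smul, projV_add, projV_smul, hx]
    ring
  · simp only [actOn_add, actOn_smul, projY_add, projY_smul, hy]
    ring

omit hv hvw in
theorem ScalesCoordinates.latX_latM (h : ScalesCoordinates M v w lam ν) (z : Fin 2 → ℤ) :
    latX v w (latM M z) = lam * latX v w z := by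
  rw [latX_apply, latticePt_latM, h.projV_actOn, latX_apply]

omit hv hvw in
theorem ScalesCoordinates.latY_latM (h : ScalesCoordinates M v w lam ν) (z : Fin 2 → ℤ) :
    latY v (latM M z) = ν * latY v z := by
  rw [latY_apply, latticePt_latM, h.projY_actOn, latY_apply]

omit hv hvw in
theorem ScalesCoordinates.subwindow_eq (h : ScalesCoordinates M v w lam ν) (hν : ν ≠ 0)
    (Ω : Window) : subwindow v M Ω = (Ω.scale ν hν).carrier := by
  rw [Window.carrier_scale, subwindow]
  refine Set.image_congr fun u _ => ?_
  rw [h.projY_actOn]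
  simp [projY]

omit hvw in
theorem ScalesCoordinates.image_strip_subset_iff (h : ScalesCoordinates M v w lam ν) (hν : ν ≠ 0)
    (Ω Ω' : Window) : actOn M '' strip v Ω.carrier ⊆ strip v Ω'.carrier ↔
      (Ω.scale ν hν).carrier ⊆ Ω'.carrier := by
  rw [Window.carrier_scale, Set.image_subset_iff, Set.image_subset_iff]
  constructor
  · intro h1 u hu
    have h2 : ![0, u] ∈ strip v Ω.carrier := ⟨u, hu, 0, by simp⟩
    have h3 := (mem_strip_iff v _ _ hv).1 (h1 h2)
    rw [h.projY_actOn] at h3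
    simpa [projY] using h3
  · intro h1 z hz
    rw [Set.mem_preimage, mem_strip_iff v _ _ hv, h.projY_actOn]
    exact h1 ((mem_strip_iff v _ _ hv).1 hz)

omit hv hvw in
theorem latY_basis : latY v ![0, 1] = 1 := by
  simp [latY_apply, projY, latticePt]

omit hv hvw in
theorem ScalesCoordinates.ne_zero (h : ScalesCoordinates M v w lam ν) : ν ≠ 0 := by
  rintro rfl
  obtain ⟨z, hz⟩ := latM_surjective M ![0, 1]
  have h1 := h.latY_latM z
  rw [hz, latY_basis, zero_mul] at h1
  exact one_ne_zero h1

/-- A nonzero lattice vector with y = 0 could be pulled back by M again and again. Its x-coordinate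
shrinks, and infinitely many lattice points would lie in a box. -/
theorem ScalesCoordinates.isCutProject (h : ScalesCoordinates M v w lam ν) (hlam : 1 < lam) :
    IsCutProject (latX v w) (latY v) where
  finite_box := finite_lat_box hv hvw
  y_injective := by
    rw [injective_iff_map_eq_zero]
    intro z hz
    by_contra hne
    have hx : latX v w z ≠ 0 := fun hx => hne (eq_zero_of_lat hv hvw hx hz)
    have hlam0 : lam ≠ 0 := by positivity
    have key : ∀ n : ℕ, ∃ z', latX v w z' = latX v w z / lam ^ n ∧ latY v z' = 0 := by
      intro n
      induction n with
      | zero => exact ⟨z, by simp, hz⟩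
      | succ n ih =>
        obtain ⟨z', h1, h2⟩ := ih
        obtain ⟨z'', rfl⟩ := latM_surjective M z'
        rw [h.latX_latM] at h1
        rw [h.latY_latM] at h2
        refine ⟨z'', ?_, (mul_eq_zero.1 h2).resolve_left h.ne_zero⟩
        rw [pow_succ, ← div_div, ← h1, mul_div_cancel_left₀ _ hlam0]
    choose f hf1 hf2 using key
    refine Set.infinite_of_injective_forall_mem (f := f) ?_ (fun n => ?_)
      (finite_lat_box hv hvw |latX v w z|)
    · intro i j hij
      have h1 := congrArg (latX v w) hij
      rw [hf1, hf1, div_eq_div_iff (pow_ne_zero _ hlam0) (pow_ne_zero _ hlam0)] at h1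
      exact (pow_right_strictMono₀ hlam).injective (mul_left_cancel₀ hx h1).symm
    · rw [Set.mem_ofPred_eq, hf1, hf2, abs_zero, abs_div, abs_of_pos (pow_pos (show 0 < lam by linarith) n)]
      exact ⟨div_le_self (abs_nonneg _) (one_le_pow₀ hlam.le), abs_nonneg _⟩

/-- Dually, the forward images of a nonzero lattice vector with x = 0 would be infinitely many
lattice points in a box. -/
theorem ScalesCoordinates.latX_injective (h : ScalesCoordinates M v w lam ν) (hν : |ν| < 1) :
    Function.Injective (latX v w) := by
  rw [injective_iff_map_eq_zero]
  intro z hz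
  by_contra hne
  have hy : latY v z ≠ 0 := fun hy => hne (eq_zero_of_lat hv hvw hz hy)
  have hxn : ∀ n : ℕ, latX v w ((latM M)^[n] z) = 0 := by
    intro n
    induction n with
    | zero => exact hz
    | succ n ih => rw [Function.iterate_succ_apply', h.latX_latM, ih, mul_zero]
  have hyn : ∀ n : ℕ, latY v ((latM M)^[n] z) = ν ^ n * latY v z := by
    intro n
    induction n with
    | zero => simp
    | succ n ih => rw [Function.iterate_succ_apply', h.latY_latM, ih, pow_succ', mul_assoc]
  refine Set.infinite_of_injective_forall_mem (f := fun n => (latM M)^[n] z) ?_ (fun n => ?_)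
    (finite_lat_box hv hvw |latY v z|)
  · intro i j hij
    have h1 := congrArg (latY v) hij
    simp only at h1
    rw [hyn, hyn] at h1
    have h2 := congrArg abs (mul_right_cancel₀ hy h1)
    rw [abs_pow, abs_pow] at h2
    exact (pow_right_strictAnti₀ (abs_pos.2 h.ne_zero) hν).injective h2
  · rw [Set.mem_ofPred_eq, hxn, hyn, abs_zero, abs_mul, abs_pow]
    exact ⟨abs_nonneg _, mul_le_of_le_one_left (abs_nonneg _) (pow_le_one₀ (abs_nonneg _) hν.le)⟩

end Action

/-! ### The field of the inflation factor -/

/-- As lam is algebraic, the field is the algebra generated by lam, and the quadratic equation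
reduces products to combinations of 1 and lam. -/
theorem exists_rat_of_mem_adjoin {lam : ℝ} {t d : ℤ} (h : lam * lam = t * lam - d) {q : ℝ}
    (hq : q ∈ IntermediateField.adjoin ℚ {lam}) : ∃ a b : ℚ, q = a + b * lam := by
  have hint : IsIntegral ℚ lam := by
    refine ⟨Polynomial.X ^ 2 - Polynomial.C (t : ℚ) * Polynomial.X + Polynomial.C (d : ℚ),
      ?_, ?_⟩
    · monicity!
    · rw [Polynomial.eval₂_add, Polynomial.eval₂_sub, Polynomial.eval₂_mul, Polynomial.eval₂_pow,
        Polynomial.eval₂_X, Polynomial.eval₂_C, Polynomial.eval₂_C, map_intCast, map_intCast,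
        pow_two, h]
      ring
  rw [← IntermediateField.mem_toSubalgebra,
    IntermediateField.adjoin_simple_toSubalgebra_of_isAlgebraic hint.isAlgebraic] at hq
  induction hq using Algebra.adjoin_induction with
  | mem x hx =>
    obtain rfl : x = lam := hx
    exact ⟨0, 1, by simp⟩
  | algebraMap r => exact ⟨r, 0, by simp⟩
  | add x y _ _ hx hy =>
    obtain ⟨a, b, rfl⟩ := hx
    obtain ⟨a', b', rfl⟩ := hy
    exact ⟨a + a', b + b', by push_cast; ring⟩
  | mul x y _ _ hx hy =>
    obtain ⟨a, b, rfl⟩ := hx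
    obtain ⟨a', b', rfl⟩ := hy
    refine ⟨a * a' - b * b' * d, a * b' + a' * b + b * b' * t, ?_⟩
    push_cast
    linear_combination (b * b' : ℝ) * h

section Field

variable {v w : Fin 2 → ℝ} {M : Matrix.GeneralLinearGroup (Fin 2) ℤ} {lam ν : ℝ}

theorem latY_eq (v : Fin 2 → ℝ) (z : Fin 2 → ℤ) : latY v z = z 1 - z 0 * (v 1 / v 0) := by
  simp only [latY_apply, projY, latticePt]
  ring

theorem ScalesCoordinates.nu_eq (h : ScalesCoordinates M v w lam ν) :
    ν = M.val 1 1 - M.val 0 1 * (v 1 / v 0) := by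
  have h1 := h.latY_latM ![0, 1]
  rw [latY_basis, mul_one, latY_eq] at h1
  rw [← h1]
  simp [latM_apply, Matrix.mulVec, dotProduct, Fin.sum_univ_two]

theorem ScalesCoordinates.lam_eq (hv : v 0 ≠ 0) (hvw : v 0 * w 1 - v 1 * w 0 ≠ 0)
    (h : ScalesCoordinates M v w lam ν) : lam = M.val 0 0 + M.val 0 1 * (v 1 / v 0) := by
  have h1 := congrFun (h.eigen hv hvw).1 0
  rw [actOn_apply] at h1
  simp only [Pi.smul_apply, smul_eq_mul] at h1
  field_simp
  linarith

/-- Elements of the field of the inflation factor are rational multiples of internal coordinates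
of lattice points. -/
theorem ScalesCoordinates.exists_latY_eq (hv : v 0 ≠ 0) (hv1 : v 1 ≠ 0)
    (hvw : v 0 * w 1 - v 1 * w 0 ≠ 0) (h : ScalesCoordinates M v w lam ν) {q : ℝ}
    (hq : q ∈ IntermediateField.adjoin ℚ {lam}) :
    ∃ N : ℕ, 0 < N ∧ ∃ z, N * q = latY v z := by
  have e0 := congrFun (h.eigen hv hvw).1 0
  have e1 := congrFun (h.eigen hv hvw).1 1
  rw [actOn_apply] at e0 e1
  simp only [Pi.smul_apply, smul_eq_mul] at e0 e1
  have hchar : lam * lam = ((M.val 0 0 + M.val 1 1 : ℤ) : ℝ) * lam -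
      ((M.val 0 0 * M.val 1 1 - M.val 0 1 * M.val 1 0 : ℤ) : ℝ) := by
    have hvv : v 0 * v 1 ≠ 0 := mul_ne_zero hv hv1
    apply mul_right_cancel₀ hvv
    push_cast
    linear_combination (M.val 0 0 * v 0 - lam * v 0) * e1 - (M.val 1 0 * v 0) * e0
  obtain ⟨a, b, rfl⟩ := exists_rat_of_mem_adjoin hchar hq
  -- Both 1 and lam are internal coordinates of lattice points; the denominators of a and b are then
  -- cleared.
  have hlam : latY v ![-M.val 0 1, M.val 0 0] = lam := by
    rw [latY_eq, h.lam_eq hv hvw]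
    simp
  refine ⟨a.den * b.den, Nat.mul_pos a.den_pos b.den_pos,
    (a.num * b.den) • ![0, 1] + (b.num * a.den) • ![-M.val 0 1, M.val 0 0], ?_⟩
  rw [map_add, map_zsmul, map_zsmul, latY_basis, hlam, zsmul_eq_mul, zsmul_eq_mul]
  have ha : (a.den : ℝ) * a = a.num := by exact_mod_cast Rat.den_mul_eq_num a
  have hb : (b.den : ℝ) * b = b.num := by exact_mod_cast Rat.den_mul_eq_num b
  push_cast
  linear_combination (b.den : ℝ) * ha + (a.den : ℝ) * lam * hb

/-- The slope of V is (lam - M₀₀) / M₀₁. Here M₀₁ is nonzero, as otherwise ν would be a nonzero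
integer of absolute value less than 1. -/
theorem ScalesCoordinates.mem_adjoin (hv : v 0 ≠ 0) (hvw : v 0 * w 1 - v 1 * w 0 ≠ 0)
    (h : ScalesCoordinates M v w lam ν) (hν : |ν| < 1) :
    (∀ z, latY v z ∈ IntermediateField.adjoin ℚ {lam}) ∧
      ν ∈ IntermediateField.adjoin ℚ {lam} := by
  have hlam := h.lam_eq hv hvw
  have hnu := h.nu_eq
  have h01 : (M.val 0 1 : ℝ) ≠ 0 := by
    intro h0
    rw [h0, zero_mul, sub_zero] at hnu
    have h1 : |M.val 1 1| < 1 := by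
      rw [hnu] at hν
      exact_mod_cast hν
    rw [Int.abs_lt_one_iff] at h1
    rw [h1] at hnu
    exact h.ne_zero (by simpa using hnu)
  set F := IntermediateField.adjoin ℚ {lam}
  have hl : lam ∈ F := IntermediateField.mem_adjoin_simple_self ℚ lam
  have hs : v 1 / v 0 ∈ F := by
    have : v 1 / v 0 = (lam - M.val 0 0) / M.val 0 1 := by
      rw [hlam, add_sub_cancel_left, mul_div_cancel_left₀ _ h01]
    rw [this]
    exact div_mem (sub_mem hl (intCast_mem F _)) (intCast_mem F _)
  refine ⟨fun z => ?_, ?_⟩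
  · rw [latY_eq]
    exact sub_mem (intCast_mem F _) (mul_mem (intCast_mem F _) hs)
  · rw [hnu]
    exact sub_mem (intCast_mem F _) (mul_mem (intCast_mem F _) hs)

/-- The entries of M^n have the form lam^n a + ν^n b. Since neither line is parallel to an axis, a ≠
0, and the first term dominates for large n. -/
theorem ScalesCoordinates.isPrimitiveMatrix (hv : ∀ i, v i ≠ 0) (hw : ∀ i, w i ≠ 0)
    (hvw : v 0 * w 1 - v 1 * w 0 ≠ 0) (h : ScalesCoordinates M v w lam ν) (hlam : 1 < lam)
    (hν : |ν| < 1) : IsPrimitiveMatrix M := by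
  have hpow : ∀ n z, latX v w ((M.val ^ n).mulVec z) = lam ^ n * latX v w z ∧
      latY v ((M.val ^ n).mulVec z) = ν ^ n * latY v z := by
    intro n z
    induction n with
    | zero => simp
    | succ n ih =>
      rw [pow_succ', ← Matrix.mulVec_mulVec, ← latM_apply, h.latX_latM, h.latY_latM, ih.1, ih.2,
        pow_succ', pow_succ']
      exact ⟨by ring, by ring⟩
  set k := v 0 / (v 0 * w 1 - v 1 * w 0) with hk
  have hentry : ∀ n i j, (((M.val ^ n) i j : ℤ) : ℝ) =
      lam ^ n * (latX v w (Pi.single j 1) * v i) + ν ^ n * (latY v (Pi.single j 1) * k * w i) := by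
    intro n i j
    have h1 := congrFun (eq_proj_add_proj (hv 0) hvw
      (latticePt ((M.val ^ n).mulVec (Pi.single j 1)))) i
    rw [← latX_apply, ← latY_apply, (hpow n _).1, (hpow n _).2, ← hk] at h1
    simp only [latticePt, Matrix.mulVec_single_one, Pi.add_apply, Pi.smul_apply, smul_eq_mul,
      Matrix.col_apply] at h1
    rw [h1]
    ring
  have hx : ∀ j, latX v w (Pi.single j 1) ≠ 0 := by
    intro j
    rw [latX_apply, projV]
    refine div_ne_zero ?_ hvw
    fin_cases j <;> simp [latticePt, hw]
  have hev : ∀ i j, ∀ᶠ n in Filter.atTop, (M.val ^ n) i j ≠ 0 := by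
    intro i j
    have ha : latX v w (Pi.single j 1) * v i ≠ 0 := mul_ne_zero (hx j) (hv i)
    set a := latX v w (Pi.single j 1) * v i
    set b := latY v (Pi.single j 1) * k * w i with hb
    filter_upwards [(tendsto_pow_atTop_atTop_of_one_lt hlam).eventually_gt_atTop (|b| / |a|)]
      with n hn h0
    rw [div_lt_iff₀ (abs_pos.2 ha)] at hn
    have h1 := hentry n i j
    rw [h0, Int.cast_zero, ← hb] at h1
    have h2 : lam ^ n * a = - (ν ^ n * b) := by linarith
    have h3 := congrArg abs h2
    rw [abs_neg, abs_mul (lam ^ n) a, abs_mul (ν ^ n) b, abs_of_pos (pow_pos (show 0 < lam by linarith) n),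
      abs_pow] at h3
    have h4 : |ν| ^ n * |b| ≤ |b| :=
      mul_le_of_le_one_left (abs_nonneg _) (pow_le_one₀ (abs_nonneg _) hν.le)
    linarith
  have hall : ∀ᶠ n in Filter.atTop, ∀ i j, (M.val ^ n) i j ≠ 0 := by
    simp only [Filter.eventually_all]
    exact hev
  exact hall.exists

end Field

/-! ### Window pairs -/

theorem sameSide_iff {v w : Fin 2 → ℝ} {M : Matrix.GeneralLinearGroup (Fin 2) ℤ} {lam ν : ℝ}
    (h : ScalesCoordinates M v w lam ν) (hν : ν ≠ 0) (Ω Ω' : Window) :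
    SameSide v M Ω Ω' ↔ (Ω.scale ν hν).leftClosed = Ω'.leftClosed := by
  rw [SameSide, h.subwindow_eq hν, Window.exists_isLeast_iff, Window.exists_isLeast_iff,
    ← Bool.eq_iff_iff, eq_comm]

/-- The two gaps add up to (1 - |ν|) times the window length. Over a field containing ν, the gaps
and the pair of offset and length determine each other. -/
theorem scale_gaps_iff {ν : ℝ} (hν : ν ≠ 0) (hν1 : |ν| < 1) {Ω Ω' : Window}
    (hlen : Ω'.length = Ω.length) (F : IntermediateField ℚ ℝ) (hF : ν ∈ F) :
    ((Ω.scale ν hν).lo - Ω'.lo ∈ F ∧ Ω'.hi - (Ω.scale ν hν).hi ∈ F) ↔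
      (ν * Ω.lo - Ω'.lo ∈ F ∧ Ω.length ∈ F) := by
  have hhi : Ω.hi = Ω.lo + Ω.length := by rw [Window.length]; ring
  have hhi' : Ω'.hi = Ω'.lo + Ω.length := by rw [← hlen, Window.length]; ring
  rw [abs_lt] at hν1
  have hl1 : 1 - ν ≠ 0 := by linarith
  have hl2 : 1 + ν ≠ 0 := by linarith
  simp only [Window.scale]
  split_ifs with hpos
  · constructor
    · rintro ⟨h1, h2⟩
      refine ⟨h1, ?_⟩
      have h3 : Ω.length = ((ν * Ω.lo - Ω'.lo) + (Ω'.hi - ν * Ω.hi)) / (1 - ν) := by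
        rw [eq_div_iff hl1, hhi, hhi']; ring
      rw [h3]
      exact div_mem (add_mem h1 h2) (sub_mem (one_mem F) hF)
    · rintro ⟨h1, h2⟩
      refine ⟨h1, ?_⟩
      have h3 : Ω'.hi - ν * Ω.hi = (1 - ν) * Ω.length - (ν * Ω.lo - Ω'.lo) := by
        rw [hhi, hhi']; ring
      rw [h3]
      exact sub_mem (mul_mem (sub_mem (one_mem F) hF) h2) h1
  · constructor
    · rintro ⟨h1, h2⟩
      have h3 : Ω.length = ((ν * Ω.hi - Ω'.lo) + (Ω'.hi - ν * Ω.lo)) / (1 + ν) := by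
        rw [eq_div_iff hl2, hhi, hhi']; ring
      have h4 : Ω.length ∈ F := by
        rw [h3]
        exact div_mem (add_mem h1 h2) (add_mem (one_mem F) hF)
      refine ⟨?_, h4⟩
      have h5 : ν * Ω.lo - Ω'.lo = (ν * Ω.hi - Ω'.lo) - ν * Ω.length := by rw [hhi]; ring
      rw [h5]
      exact sub_mem h1 (mul_mem hF h4)
    · rintro ⟨h1, h2⟩
      constructor
      · have h5 : ν * Ω.hi - Ω'.lo = (ν * Ω.lo - Ω'.lo) + ν * Ω.length := by rw [hhi]; ring
        rw [h5]
        exact add_mem h1 (mul_mem hF h2)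
      · have h5 : Ω'.hi - ν * Ω.lo = Ω.length - (ν * Ω.lo - Ω'.lo) := by rw [hhi']; ring
        rw [h5]
        exact sub_mem h2 h1

theorem Window.bounds_of_subset {J Ω : Window} (h : J.carrier ⊆ Ω.carrier) :
    Ω.lo ≤ J.lo ∧ J.hi ≤ Ω.hi := by
  have h1 : Set.Ioo J.lo J.hi ⊆ Set.Icc Ω.lo Ω.hi :=
    J.Ioo_subset_carrier.trans (h.trans Ω.carrier_subset_Icc)
  have h2 := closure_minimal h1 isClosed_Icc
  rw [closure_Ioo J.lo_lt_hi.ne] at h2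
  exact ⟨(h2 (Set.left_mem_Icc.2 J.lo_lt_hi.le)).1, (h2 (Set.right_mem_Icc.2 J.lo_lt_hi.le)).2⟩

theorem isWindowPair_iff {v w : Fin 2 → ℝ} (hv : v 0 ≠ 0) (hvw : v 0 * w 1 - v 1 * w 0 ≠ 0)
    {M : Matrix.GeneralLinearGroup (Fin 2) ℤ} {lam ν : ℝ}
    (h : ScalesCoordinates M v w lam ν) (hν : ν ≠ 0) (hν1 : |ν| < 1) (Ω Ω' : Window) :
    IsWindowPair v M lam Ω Ω' ↔ Ω'.length = Ω.length ∧
      (Ω.scale ν hν).carrier ⊆ Ω'.carrier ∧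
      ν * Ω.lo - Ω'.lo ∈ IntermediateField.adjoin ℚ {lam} ∧
      Ω.length ∈ IntermediateField.adjoin ℚ {lam} := by
  have hF := (h.mem_adjoin hv hvw hν1).2
  constructor
  · rintro ⟨h1, h2, h3⟩
    rw [h.image_strip_subset_iff hv hν] at h2
    refine ⟨h1, h2, (scale_gaps_iff hν hν1 h1 _ hF).1 ?_⟩
    rw [h.subwindow_eq hν] at h3
    obtain ⟨b1, b2⟩ := Window.bounds_of_subset h2
    exact (Window.forall_component_iff b1 b2
      (F := (IntermediateField.adjoin ℚ {lam} : Set ℝ)) (zero_mem _)).1 h3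
  · rintro ⟨h1, h2, h3⟩
    refine ⟨h1, (h.image_strip_subset_iff hv hν Ω Ω').2 h2, ?_⟩
    rw [h.subwindow_eq hν]
    obtain ⟨b1, b2⟩ := Window.bounds_of_subset h2
    exact (Window.forall_component_iff b1 b2
      (F := (IntermediateField.adjoin ℚ {lam} : Set ℝ)) (zero_mem _)).2
      ((scale_gaps_iff hν hν1 h1 _ hF).2 h3)

/-! ### From window pairs to substitution rules -/

theorem exists_substitution {v w : Fin 2 → ℝ} (hv : ∀ i, v i ≠ 0)
    (hvw : v 0 * w 1 - v 1 * w 0 ≠ 0) {M : Matrix.GeneralLinearGroup (Fin 2) ℤ} {lam : ℝ}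
    (hM : HasEigenlines M v w lam) {Ω Ω' : Window} (hΩ : IsWindowPair v M lam Ω Ω')
    (hside : Ω.IsSingular v → Ω'.IsSingular v → SameSide v M Ω Ω') :
    LocallyIsomorphic (projTiling v w Ω) (projTiling v w Ω') ∧
      ∃ (L : Type) (_ : Finite L) (σ : SubstitutionRule L) (S : Set (ℝ × L)),
        σ.factor = lam ∧ σ.IsSubstitutionTiling S ∧
        σ.shape S = projTiling v w Ω ∧ σ.shape (σ.subst S) = projTiling v w Ω' := by
  obtain ⟨hlam, hMv, ν, hν1, hMw⟩ := hM
  have h := ScalesCoordinates.of_eigen (hv 0) hvw hMv hMw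
  have hν := h.ne_zero
  rw [isWindowPair_iff (hv 0) hvw h hν hν1] at hΩ
  obtain ⟨hlen, hsub, hc, hl⟩ := hΩ
  rw [sameSide_iff h hν] at hside
  obtain ⟨b1, b2⟩ := Window.bounds_of_subset hsub
  have hcp := h.isCutProject (hv 0) hvw hlam
  have hx := h.latX_injective (hv 0) hvw hν1
  -- A nonsingular window may be closed on the other side without changing the tiling. With `hside`
  -- for two singular windows, the sides can always be matched.
  obtain ⟨Ω₀, Ω₁, hlo0, hhi0, hcut0, hlo1, hhi1, hcut1, hs⟩ : ∃ Ω₀ Ω₁ : Window,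
      Ω₀.lo = Ω.lo ∧ Ω₀.hi = Ω.hi ∧
      cutPoints (latX v w) (latY v) Ω₀.carrier = cutPoints (latX v w) (latY v) Ω.carrier ∧
      Ω₁.lo = Ω'.lo ∧ Ω₁.hi = Ω'.hi ∧
      cutPoints (latX v w) (latY v) Ω₁.carrier = cutPoints (latX v w) (latY v) Ω'.carrier ∧
      flipSide ν Ω₀.leftClosed = Ω₁.leftClosed := by
    by_cases hs : flipSide ν Ω.leftClosed = Ω'.leftClosed
    · exact ⟨Ω, Ω', rfl, rfl, rfl, rfl, rfl, rfl, hs⟩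
    have hs' : (!flipSide ν Ω.leftClosed) = Ω'.leftClosed := by
      revert hs
      cases flipSide ν Ω.leftClosed <;> cases Ω'.leftClosed <;> simp
    by_cases h0 : Ω.IsSingular v
    · by_cases h1 : Ω'.IsSingular v
      · exact absurd (hside h0 h1) hs
      · refine ⟨Ω, Ω'.flip, rfl, rfl, rfl, rfl, rfl, Ω'.cutPoints_flip h1, ?_⟩
        change _ = !Ω'.leftClosed
        rw [← hs', Bool.not_not]
    · refine ⟨Ω.flip, Ω', rfl, rfl, Ω.cutPoints_flip h0, rfl, rfl, rfl, ?_⟩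
      rw [← hs']
      exact Window.flipSide_not _ _
  obtain ⟨Nc, hNc, zc, hzc⟩ := h.exists_latY_eq (hv 0) (hv 1) hvw hc
  obtain ⟨Nl, hNl, zl, hzl⟩ := h.exists_latY_eq (hv 0) (hv 1) hvw hl
  have hmaps : ∀ u, 0 ≤ u → u ≤ Ω.length →
      0 ≤ ν * u + (ν * Ω.lo - Ω'.lo) ∧ ν * u + (ν * Ω.lo - Ω'.lo) ≤ Ω.length := by
    intro u h0 h1
    have hhi' : Ω'.hi = Ω'.lo + Ω.length := by rw [← hlen, Window.length]; ring
    have hhi : Ω.hi = Ω.lo + Ω.length := by rw [Window.length]; ring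
    rw [hhi'] at b2
    simp only [Window.scale] at b1 b2
    split_ifs at b1 b2 with hpos
    · rw [hhi] at b2
      constructor <;> nlinarith
    · rw [hhi] at b1
      constructor <;> nlinarith
  -- Nc * Nl is a common denominator for the offset and the length.
  obtain ⟨I, hIlam, hIν, hIc, hIl⟩ := hcp.exists_inflation hx (latM_surjective M) h.latX_latM
    h.latY_latM hlam hν Ω.length_pos hmaps (N := Nc * Nl) (Nat.mul_pos hNc hNl)
    (zc := Nl • zc) (zl := Nc • zl)
    (by rw [map_nsmul, nsmul_eq_mul, ← hzc]; push_cast; ring)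
    (by rw [map_nsmul, nsmul_eq_mul, ← hzl]; push_cast; ring)
  have hl0 : Ω₀.length = I.l := by rw [hIl, Window.length, Window.length, hlo0, hhi0]
  have hl1 : Ω₁.length = I.l := by rw [hIl, ← hlen, Window.length, Window.length, hlo1, hhi1]
  have e0 : I.rule.shape (I.tiling Ω₀.leftClosed Ω₀.lo) = projTiling v w Ω := by
    rw [Inflation.shape_tiling Ω₀ hl0, projTiling_eq (hv 0), hcut0]
  have e1 : I.rule.subst (I.tiling Ω₀.leftClosed Ω₀.lo) = I.tiling Ω₁.leftClosed Ω₁.lo := by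
    rw [Inflation.subst_tiling, hIν, hIc, hs, hlo0, hlo1, sub_sub_cancel]
  have e2 : I.rule.shape (I.tiling Ω₁.leftClosed Ω₁.lo) = projTiling v w Ω' := by
    rw [Inflation.shape_tiling Ω₁ hl1, projTiling_eq (hv 0), hcut1]
  refine ⟨?_, I.Label, Inflation.finite_label, I.rule, I.tiling Ω₀.leftClosed Ω₀.lo, hIlam,
    Inflation.isSubstitutionTiling_tiling _ _, e0, by rw [e1, e2]⟩
  rw [← e0, ← e2]
  exact (Inflation.locallyIsomorphic_tiling _ _ _ _).relabel I.rule.len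

/-! ### From substitution rules to window pairs -/

theorem translateTiles_tilesOf {A : Set ℝ} {t : ℝ} (h : ∀ a, a ∈ A ↔ a + t ∈ A) :
    translateTiles t (tilesOf A) = tilesOf A := by
  have key : ∀ s, (∀ a, a ∈ A ↔ a + s ∈ A) → translateTiles s (tilesOf A) ⊆ tilesOf A := by
    rintro s hs _ ⟨p, ⟨h1, h2, h3, h4⟩, rfl⟩
    refine ⟨h1, (hs _).1 h2, ?_, fun b hb hb' => ?_⟩
    · have := (hs _).1 h3
      simp only
      rwa [add_right_comm]
    · simp only at hb'
      refine h4 (b - s) ((hs _).2 (by rwa [sub_add_cancel])) ⟨by linarith [hb'.1], by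
        linarith [hb'.2]⟩
  refine (key t h).antisymm fun p hp => ?_
  have h1 : ∀ a, a ∈ A ↔ a + -t ∈ A := fun a => by
    rw [h (a + -t), neg_add_cancel_right]
  exact ⟨_, key (-t) h1 ⟨p, hp, rfl⟩, by simp⟩

/-- A surjective endomorphism of ℤ² has a right inverse matrix, which for square matrices is an
inverse. -/
theorem exists_generalLinearGroup {f : (Fin 2 → ℤ) →+ (Fin 2 → ℤ)}
    (hf : Function.Surjective f) : ∃ M : Matrix.GeneralLinearGroup (Fin 2) ℤ, latM M = f := by
  set A := LinearMap.toMatrix' f.toIntLinearMap with hA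
  have hAf : ∀ z, A.mulVec z = f z := by
    intro z
    rw [hA, LinearMap.toMatrix'_mulVec]
    rfl
  obtain ⟨B, hB⟩ := Matrix.mulVec_surjective_iff_exists_right_inverse.1
    (show Function.Surjective A.mulVec from fun z => by
      obtain ⟨z', hz'⟩ := hf z
      exact ⟨z', by rw [hAf, hz']⟩)
  refine ⟨⟨A, B, hB, mul_eq_one_comm.1 hB⟩, ?_⟩
  exact AddMonoidHom.ext hAf

theorem exists_inflatedTiling {v w : Fin 2 → ℝ} (hv : ∀ i, v i ≠ 0)
    (hvw : v 0 * w 1 - v 1 * w 0 ≠ 0) {Ω : Window} (hnp : IsNonperiodic (projTiling v w Ω))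
    {L : Type} [Finite L] {σ : SubstitutionRule L} {S : Set (ℝ × L)}
    (hS : σ.IsSubstitutionTiling S) (hshape : σ.shape S = projTiling v w Ω) :
    ∃ T : InflatedTiling (latX v w) (latY v) L, T.rule = σ ∧ T.S = S ∧ T.Ω 0 = Ω := by
  rw [projTiling_eq (hv 0)] at hnp hshape
  set x := latX v w with hx
  set y := latY v with hy
  set X := cutPoints x y Ω.carrier with hX
  have hper : ∀ t, (∀ a, a ∈ X ↔ a + t ∈ X) → t = 0 := fun t ht =>
    hnp t (translateTiles_tilesOf ht)
  -- A lattice vector with y = 0 preserves the strip, so its x-coordinate is a period of the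
  -- vertices.
  have hcp : IsCutProject x y := by
    refine ⟨finite_lat_box (hv 0) hvw, ?_⟩
    rw [injective_iff_map_eq_zero]
    intro z hz
    refine eq_zero_of_lat (hv 0) hvw (hper _ fun a => ?_) hz
    constructor
    · rintro ⟨z', h1, rfl⟩
      exact ⟨z' + z, by rwa [map_add, hz, add_zero], map_add _ _ _⟩
    · rintro ⟨z', h1, h2⟩
      exact ⟨z' - z, by rwa [map_sub, hz, sub_zero], by rw [map_sub, h2, hx]; ring⟩
  have hverts : Prod.fst '' S = X := hcp.fst_image_of_shape hshape
  have hmatch : ∀ n, LocallyMatches (Prod.fst '' σ.subst^[n] S) X := by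
    intro n
    rw [← hverts]
    exact (hS.locallyIsomorphic_iterate n).locallyMatches σ.len_pos hS.1
      (σ.isTiling_iterate_subst hS.1 n)
  have hinfl : ∀ a ∈ X, σ.factor * a ∈ Prod.fst '' σ.subst^[1] S := by
    intro a ha
    rw [← hverts] at ha
    exact σ.factor_mul_mem ha
  have hxinj := hcp.x_injective_of_inflation Ω hper σ.one_lt_factor (hmatch 1) hinfl
  obtain ⟨M, hxM⟩ := IsCutProject.exists_hom_of_mul_eq hxinj
    (hcp.exists_mul_eq Ω (hmatch 1) hinfl)
  obtain ⟨C, -, hstrip⟩ := hcp.exists_mem_carrier Ω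
  obtain ⟨o, -, -, ho⟩ := hstrip 0
  have hxn : ∀ n, x (M^[n] o) = σ.factor ^ n * x o := by
    intro n
    induction n with
    | zero => simp
    | succ n ih => rw [Function.iterate_succ_apply', hxM, ih, pow_succ', mul_assoc]
  -- The inflated vertex over M^n o shows that the n-th image meets the projected lattice, as
  -- `exists_window` requires.
  have hwin : ∀ n, ∃ Ω' : Window, Ω'.length = Ω.length ∧
      Prod.fst '' σ.subst^[n] S = cutPoints x y Ω'.carrier := fun n =>
    hcp.exists_window hxinj Ω ⟨M^[n] o, by
      rw [hxn]
      exact σ.factor_pow_mul_mem (hverts ▸ ⟨o, ho, rfl⟩) n⟩ (hmatch n)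
  choose W hW1 hW2 using hwin
  -- At index 0 the window must be the given Ω, while `exists_window` only provides some window with
  -- the same vertices.
  set Ωs : ℕ → Window := fun n => if n = 0 then Ω else W n with hΩs
  have hΩ0 : Ωs 0 = Ω := if_pos rfl
  have hΩ1 : ∀ n, (Ωs n).length = Ω.length ∧
      Prod.fst '' σ.subst^[n] S = cutPoints x y (Ωs n).carrier := by
    intro n
    simp only [hΩs]
    split_ifs with hn
    · subst hn
      exact ⟨rfl, hverts⟩
    · exact ⟨hW1 n, hW2 n⟩
  have hmap : ∀ z, y z ∈ Ω.carrier → y (M z) ∈ (Ωs 1).carrier := by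
    intro z hz
    rw [← InflatedTiling.mem_cutPoints_iff (x := x) _ hxinj, ← (hΩ1 1).2, hxM]
    exact hinfl _ ⟨z, hz, rfl⟩
  obtain ⟨ν, hyM⟩ := hcp.exists_contraction (exists_coeff_lat (hv 0) hvw) hmap
  obtain ⟨hν0, hν1⟩ := hcp.contraction_bounds σ.one_lt_factor hxM hyM (hΩ1 1).1 hmap
  exact ⟨{ cutProject := hcp, x_injective := hxinj, rule := σ, S := S, isSubst := hS, Ω := Ωs
           verts := fun n => (hΩ1 n).2, length_eq := fun n => by rw [(hΩ1 n).1, hΩ0]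
           M := M, ν := ν, x_M := hxM, y_M := hyM, ν_ne := hν0, ν_lt := hν1 }, rfl, rfl, hΩ0⟩

theorem exists_windowPair {v w : Fin 2 → ℝ} (hv : ∀ i, v i ≠ 0) (hw : ∀ i, w i ≠ 0)
    (hvw : v 0 * w 1 - v 1 * w 0 ≠ 0) {Ω : Window} (hnp : IsNonperiodic (projTiling v w Ω))
    {L : Type} [Finite L] {σ : SubstitutionRule L} {S : Set (ℝ × L)}
    (hS : σ.IsSubstitutionTiling S) (hshape : σ.shape S = projTiling v w Ω) :
    ∃ M : Matrix.GeneralLinearGroup (Fin 2) ℤ,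
      IsPrimitiveMatrix M ∧ HasEigenlines M v w σ.factor ∧
      ∃ Ω₀ Ω' : Window,
        Ω₀.lo = Ω.lo ∧ Ω₀.hi = Ω.hi ∧ projTiling v w Ω₀ = projTiling v w Ω ∧
        IsWindowPair v M σ.factor Ω₀ Ω' ∧
        σ.shape (σ.subst S) = projTiling v w Ω' ∧
        LocallyIsomorphic (projTiling v w Ω) (projTiling v w Ω') := by
  obtain ⟨T, rfl, rfl, rfl⟩ := exists_inflatedTiling hv hvw hnp hS hshape
  obtain ⟨M, hM⟩ := exists_generalLinearGroup T.surjective_M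
  have h : ScalesCoordinates M v w T.rule.factor T.ν :=
    ScalesCoordinates.of_lat (hM ▸ T.x_M) (hM ▸ T.y_M)
  obtain ⟨Ω₀, Ω', hlo0, hhi0, hcut0, hlo1, hhi1, hcut1, hsub⟩ := T.exists_windows
  obtain ⟨hF, hνF⟩ := h.mem_adjoin (hv 0) hvw T.ν_lt
  obtain ⟨hc, hl⟩ := T.offset_mem_and_length_mem _ hF hνF
  have hl0 : Ω₀.length = (T.Ω 0).length := by rw [Window.length, Window.length, hlo0, hhi0]
  have hl1 : Ω'.length = (T.Ω 0).length := by
    rw [← T.length_eq 1, Window.length, Window.length, hlo1, hhi1]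
  obtain ⟨hMv, hMw⟩ := h.eigen (hv 0) hvw
  have hshape' : T.rule.shape (T.rule.subst T.S) = projTiling v w Ω' := by
    rw [projTiling_eq (hv 0), hcut1, ← T.verts 1]
    exact (T.rule.isTiling_subst T.isTiling).image_eq_tilesOf T.rule.len_pos
  refine ⟨M, h.isPrimitiveMatrix hv hw hvw T.rule.one_lt_factor T.ν_lt,
    ⟨T.rule.one_lt_factor, hMv, T.ν, T.ν_lt, hMw⟩, Ω₀, Ω', hlo0, hhi0, ?_, ?_, hshape', ?_⟩
  · rw [projTiling_eq (hv 0), projTiling_eq (hv 0), hcut0]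
  · rw [isWindowPair_iff (hv 0) hvw h T.ν_ne T.ν_lt]
    exact ⟨hl1.trans hl0.symm, hsub, by rwa [hlo0, hlo1], by rwa [hl0]⟩
  · rw [← hshape, ← hshape']
    exact (T.isSubst.locallyIsomorphic_iterate 1).relabel T.rule.len

theorem mainTheorem2 (v w : Fin 2 → ℝ) (hv : ∀ i, v i ≠ 0) (hw : ∀ i, w i ≠ 0)
    (hvw : v 0 * w 1 - v 1 * w 0 ≠ 0) (Ω : Window) :
    (∀ (M : Matrix.GeneralLinearGroup (Fin 2) ℤ) (lam : ℝ),
      IsPrimitiveMatrix M → HasEigenlines M v w lam →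
      ∀ Ω' : Window, IsWindowPair v M lam Ω Ω' →
        (Ω.IsSingular v → Ω'.IsSingular v → SameSide v M Ω Ω') →
        LocallyIsomorphic (projTiling v w Ω) (projTiling v w Ω') ∧
        ∃ (L : Type) (_ : Finite L) (σ : SubstitutionRule L) (S : Set (ℝ × L)),
          σ.factor = lam ∧ σ.IsSubstitutionTiling S ∧
          σ.shape S = projTiling v w Ω ∧ σ.shape (σ.subst S) = projTiling v w Ω') ∧
    (IsNonperiodic (projTiling v w Ω) →
      ∀ (L : Type) (_ : Finite L) (σ : SubstitutionRule L) (S : Set (ℝ × L)),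
        σ.IsSubstitutionTiling S → σ.shape S = projTiling v w Ω →
        ∃ M : Matrix.GeneralLinearGroup (Fin 2) ℤ,
          IsPrimitiveMatrix M ∧ HasEigenlines M v w σ.factor ∧
          ∃ Ω₀ Ω' : Window,
            Ω₀.lo = Ω.lo ∧ Ω₀.hi = Ω.hi ∧ projTiling v w Ω₀ = projTiling v w Ω ∧
            IsWindowPair v M σ.factor Ω₀ Ω' ∧
            σ.shape (σ.subst S) = projTiling v w Ω' ∧
            LocallyIsomorphic (projTiling v w Ω) (projTiling v w Ω')) :=
  ⟨fun _ _ _ hM _ hΩ hside => exists_substitution hv hvw hM hΩ hside,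
    fun hnp _ _ _ _ hS hshape => exists_windowPair hv hw hvw hnp hS hshape⟩
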